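/- Theorem 6.2. Let $k$ be an algebraically closed field of characteristic zero, $L$ a simple Lie algebra over $k$ of type $A_r$ or $C_r$, $\pi$ a parabolic subalgebra of $L$ (a Lie subalgebra containing a Borel subalgebra, i.e. a maximal solvable subalgebra), and $N$ the nilradical (largest nilpotent ideal) of $\pi$. For a finite-dimensional Lie algebra $M$ and $f\in M^*$ put $M(f)=\{x\in M: f([x,y])=0 \text{ for all } y\in M\}$; the index of $M$ is $i(M)=\min_{f\in M^*}\dim M(f)$, and $f$ is regular if $\dim M(f)=i(M)$. A CP-ideal of $M$ is a commutative ideal $P$ of $M$ that is a polarization with respect to every regular $f$, i.e. $f([P,P])=0$ and $\dim P=\frac12(\dim M+\dim M(f))$. Then $N$ has a CP-ideal. More precisely: (1) Let $L$ be of type $A_r$, identified with $\mathfrak{sl}(V)$, $n=\dim V=r+1$. Then $\pi$ is the set of all $x\in L$ with $xF_i\subset F_i$ for all $i$, for some flag $0=F_0\subsetneq F_1\subsetneq\dots\subsetneq F_m=V$. For every such flag put $p_i=\dim F_i/F_{i-1}$ (so $\pi$ is of type $(p_1,\dots,p_m)$), let $1\le\ell\le m$ be such that $\left|p_1+\dots+p_\ell-\frac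 n2\right|$ is as small as possible, and put $p=p_1+\dots+p_\ell$. Then $P=\{x\in N: xV\subset F_\ell,\ xF_\ell=0\}$ is a CP-ideal of $N$, and $$i(N)=2p(n-p)-\tfrac12\Big(n^2-\sum_{i=1}^m p_i^2\Big).$$ (2) Let $L$ be of type $C_r$, $r\ge1$, identified with $\mathfrak{sp}(V)$, where $\dim V=2r$ and $V$ carries a nondegenerate alternating bilinear form. Then $\pi$ is the set of all $x\in L$ with $xF_i\subset F_i$ for all $i$, for some flag $0=F_0\subsetneq\dots\subsetneq F_m=V$ with $F_i^\perp=F_{m-i}$ for $0\le i\le m$. For every such flag put $p_i=\dim F_i/F_{i-1}$ and $\ell=[m/2]$. Then for every subspace $W=W^\perp$ of $V$ containing $F_\ell$, $P=\{x\in N: xV\subset W,\ xW=0\}$ is a CP-ideal of $N$, and $$i(N)=\tfrac12\sum_{i=1}^{\ell}p_i(p_i+1).$$ -/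

import Mathlib

open Module

section LieNotions

variable (k : Type*) [Field k] {M : Type*} [LieRing M] [LieAlgebra k M]

/-- For a linear form `f` on a Lie algebra `M`, the subspace
`M(f) = {x | f [x, y] = 0 for all y}`. -/
def formRadical (f : Dual k M) : Submodule k M where
  carrier := {x | ∀ y : M, f ⁅x, y⁆ = 0}
  add_mem' := by
    intro a b ha hb y
    rw [add_lie, map_add, ha y, hb y, add_zero]
  zero_mem' := by
    intro y
    rw [zero_lie, map_zero]
  smul_mem' := by
    intro c x hx y
    rw [smul_lie, map_smul, hx y, smul_zero]

variable (M) in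
/-- The index `i(M)` of a (finite-dimensional) Lie algebra: the minimum of `dim M(f)` over all
linear forms `f`. The infimum is taken over a nonempty family of natural numbers, hence is a
minimum. -/
noncomputable def lieIndex : ℕ :=
  ⨅ f : Dual k M, finrank k (formRadical k f)

/-- `f` is regular if `dim M(f) = i(M)`. -/
def IsRegularForm (f : Dual k M) : Prop :=
  finrank k (formRadical k f) = lieIndex k M

/-- A Lie subalgebra `P` is a polarization with respect to `f` if `f [P, P] = 0` and
`dim P = (dim M + dim M(f)) / 2`. -/
def IsPolarization (f : Dual k M) (P : LieSubalgebra k M) : Prop :=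
  (∀ x ∈ P, ∀ y ∈ P, f ⁅x, y⁆ = 0) ∧
    2 * finrank k P = finrank k M + finrank k (formRadical k f)

/-- A commutative polarization (CP) of `M`: a commutative Lie subalgebra which is a polarization
with respect to each regular linear form. -/
def IsCommutativePolarization (P : LieSubalgebra k M) : Prop :=
  (∀ x ∈ P, ∀ y ∈ P, ⁅x, y⁆ = 0) ∧
    ∀ f : Dual k M, IsRegularForm k f → IsPolarization k f P

/-- A CP-ideal: a commutative polarization which is an ideal. -/
def IsCPIdeal (P : LieIdeal k M) : Prop :=
  IsCommutativePolarization k (LieIdeal.toLieSubalgebra k M P)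

variable (M) in
/-- The nilradical of a (finite-dimensional) Lie algebra: its largest nilpotent ideal, i.e. the sum
of all ideals that are nilpotent as Lie algebras. -/
def lieNilradical : LieIdeal k M :=
  sSup {I : LieIdeal k M | LieRing.IsNilpotent I}

/-- A Borel subalgebra: a maximal solvable Lie subalgebra. -/
def IsBorelSubalgebra (b : LieSubalgebra k M) : Prop :=
  Maximal (fun c : LieSubalgebra k M => LieAlgebra.IsSolvable c) b

/-- A parabolic subalgebra: a Lie subalgebra containing a Borel subalgebra. -/
def IsParabolicSubalgebra (q : LieSubalgebra k M) : Prop :=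
  ∃ b : LieSubalgebra k M, IsBorelSubalgebra k b ∧ b ≤ q

end LieNotions

section Flags

variable {k : Type*} [Field k] {V : Type*} [AddCommGroup V] [Module k V]

/-- `F` is a flag `0 = F 0 ⊂ F 1 ⊂ ... ⊂ F m = V` with strict inclusions, and its successive
quotients have the dimensions listed by `p` (which is indexed from `0`). -/
structure IsFlagOfType {m : ℕ} (F : Fin (m + 1) → Submodule k V) (p : Fin m → ℕ) : Prop where
  bot : F 0 = ⊥
  top : F (Fin.last m) = ⊤
  lt : ∀ i : Fin m, F i.castSucc < F i.succ
  dim : ∀ i : Fin m, finrank k (F i.succ) = finrank k (F i.castSucc) + p i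

/-- `q` consists of all the `x` with `x (F i) ⊆ F i` for each `i`, where `x` acts on `V`
as the endomorphism `ρ x`. -/
def IsFlagStabilizer {L : Type*} [LieRing L] [LieAlgebra k L] (ρ : L → V →ₗ[k] V)
    {m : ℕ} (F : Fin (m + 1) → Submodule k V) (q : LieSubalgebra k L) : Prop :=
  ∀ x : L, x ∈ q ↔ ∀ i, ∀ v ∈ F i, ρ x v ∈ F i

/-- The flag `F` is isotropic with respect to the bilinear form `φ`: `(F i)ᗮ = F (m - i)`
for each `i`. -/
def IsIsotropicFlag (φ : LinearMap.BilinForm k V) {m : ℕ}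
    (F : Fin (m + 1) → Submodule k V) : Prop :=
  ∀ i, φ.orthogonal (F i) = F i.rev

end Flags

/-- The partial sum of the first `l` entries of `p`. -/
def partialSum {m : ℕ} (p : Fin m → ℕ) (l : Fin (m + 1)) : ℕ :=
  ∑ i : Fin m with i.castSucc < l, p i

/-- Among all `l` with `1 ≤ l ≤ m`, the number `l` makes `|p₁ + ... + p_l - n / 2|`
as small as possible. -/
def IsClosestToHalf (n : ℕ) {m : ℕ} (p : Fin m → ℕ) (l : Fin (m + 1)) : Prop :=
  l ≠ 0 ∧ ∀ j : Fin (m + 1), j ≠ 0 →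
    |(partialSum p l : ℚ) - n / 2| ≤ |(partialSum p j : ℚ) - n / 2|

section Classical

open LieAlgebra.SpecialLinear LieAlgebra.Symplectic

attribute [local instance 100] LieRing.ofAssociativeRing

variable {k : Type*} [Field k] {L : Type*} [LieRing L] [LieAlgebra k L]

/-- A Lie algebra isomorphism of `L` with `sl (r + 1, k)`, that is, an identification of `L`
as the simple Lie algebra of type `A_r`. -/
abbrev TypeAIso (r : ℕ) (k : Type*) [Field k] (L : Type*) [LieRing L] [LieAlgebra k L] : Type _ :=
  L ≃ₗ⁅k⁆ sl (Fin (r + 1)) k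

/-- A Lie algebra isomorphism of `L` with `sp (2 r, k)`, that is, an identification of `L`
as the simple Lie algebra of type `C_r`. -/
abbrev TypeCIso (r : ℕ) (k : Type*) [Field k] (L : Type*) [LieRing L] [LieAlgebra k L] : Type _ :=
  L ≃ₗ⁅k⁆ sp (Fin r) k

/-- The resulting action of `L` on `V = k ^ (r + 1)`. -/
def TypeAIso.act {r : ℕ} (e : TypeAIso r k L) (x : L) :
    (Fin (r + 1) → k) →ₗ[k] (Fin (r + 1) → k) :=
  Matrix.toLin' (e x : Matrix (Fin (r + 1)) (Fin (r + 1)) k)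

/-- The resulting action of `L` on `V = k ^ (2 r)`. -/
def TypeCIso.act {r : ℕ} (e : TypeCIso r k L) (x : L) :
    (Fin r ⊕ Fin r → k) →ₗ[k] (Fin r ⊕ Fin r → k) :=
  Matrix.toLin' (e x : Matrix (Fin r ⊕ Fin r) (Fin r ⊕ Fin r) k)

/-- The nondegenerate alternating bilinear form on `V = k ^ (2 r)` that defines `sp (2 r, k)`. -/
noncomputable def symplecticForm (r : ℕ) (k : Type*) [Field k] :
    LinearMap.BilinForm k (Fin r ⊕ Fin r → k) :=
  Matrix.toBilin' (Matrix.J (Fin r) k)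

end Classical

/-! The heart is a dimension count. Let `P` be a commutative ideal of `N`. For every form `g`,
commutativity puts `P` inside its orthogonal under `(x, y) ↦ g [x, y]`, so `2 dim P ≤ dim N + dim
N(g)`. If for a single form `f` the orthogonal of `P` lies in `P`, equality holds at `f`. Then `dim
N(f)` is the minimum, `i(N) = 2 dim P - dim N`, and the same equality holds at every regular form,
so `P` is a CP-ideal (`isCPIdeal_and_lieIndex`). It remains to describe `N` in coordinates, to
exhibit one `f`, and to count matrix positions.

In a basis adapted to the flag, `π` consists of the block upper triangular matrices of `L`, and `N`
of the strictly block upper triangular ones (`IsRootRep.mem_lieNilradical_iff`). In type C the basis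
is symplectic and `W` is spanned by its first half. In both types `P` is the part of `N` supported
on one upper right block.

In type A (`exists_cpIdeal_sl`), `f` sums the antidiagonal entries in the first `min(p, n - p)`
rows. An element orthogonal to `P` is tested against the elementary matrices in `P`. This kills its
entries outside the upper right block, except possibly those whose two indices both lie between `p`
and `n - p`. Because `p` is as close to `n / 2` as possible, no flag dimension lies strictly between
`p` and `n - p`, so `N` has no such entries.

In type C (`exists_cpIdeal_sp`), `f` sums the entries that pair a basis vector of `W` with its dual
vector. Orthogonality to `P` makes the diagonal block on `W` skew at the relevant positions. Strict
triangularity leaves at most one of two transposed entries nonzero, so that block vanishes, and the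
opposite diagonal block vanishes with it.

For the shape of parabolic subalgebras, Lie's theorem gives a full flag invariant under a Borel
subalgebra, isotropic in type C. By maximality the Borel subalgebra contains all upper triangular
elements of `L`. A larger subalgebra is then determined by the steps of the full flag that it
preserves (`IsRootRep.mem_of_preserves_steps`). -/

/-- A faithful matrix representation of a Lie algebra, together with a diagonal matrix in its image
with distinct entries `c a` whose root spaces are one-dimensional and multiply as the root spaces of
a semisimple Lie algebra do. The root space of the root `μ` consists of the elements whose matrix is
supported on the positions `(a, b)` with `c a - c b = μ`. -/
structure IsRootRep {k L ι : Type*} [Field k] [LieRing L] [LieAlgebra k L] [Fintype ι]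
    [DecidableEq ι] (ρ : L →ₗ[k] Matrix ι ι k) (c : ι → k) : Prop where
  injective : Function.Injective ρ
  map_lie : ∀ x y, ρ ⁅x, y⁆ = ρ x * ρ y - ρ y * ρ x
  weight_injective : Function.Injective c
  exists_diagonal : ∃ h, ρ h = Matrix.diagonal c
  exists_ne_zero : ∀ a b, a ≠ b → ∃ x, ρ x a b ≠ 0
  line : ∀ a b x, a ≠ b → ρ x a b = 0 →
    (∀ a' b', ρ x a' b' ≠ 0 → c a' - c b' = c a - c b) → x = 0
  lie_ne_zero : ∀ a b d x y, a ≠ b → b ≠ d → a ≠ d →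
    (∀ a' b', ρ x a' b' ≠ 0 → c a' - c b' = c a - c b) →
    (∀ a' b', ρ y a' b' ≠ 0 → c a' - c b' = c b - c d) →
    ρ x a b ≠ 0 → ρ y b d ≠ 0 → ρ ⁅x, y⁆ a d ≠ 0
  coroot : ∀ a b x y, a ≠ b →
    (∀ a' b', ρ x a' b' ≠ 0 → c a' - c b' = c a - c b) →
    (∀ a' b', ρ y a' b' ≠ 0 → c a' - c b' = c b - c a) →
    ρ x a b ≠ 0 → ρ y b a ≠ 0 → ρ ⁅x, y⁆ a a ≠ ρ ⁅x, y⁆ b b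
  scalar : ∀ x, (∀ a b, a ≠ b → ρ x a b = 0) → (∀ a b, ρ x a a = ρ x b b) → x = 0

/-! ### Root components and subalgebras containing the triangular elements -/

namespace IsRootRep

open Classical in
theorem weight_of_component {k ι : Type*} [Field k] {c : ι → k} {A B : Matrix ι ι k} {μ : k}
    (h : ∀ a b, B a b = if c a - c b = μ then A a b else 0) (a b : ι) (hab : B a b ≠ 0) :
    c a - c b = μ := by
  by_contra hne
  exact hab (by rw [h, if_neg hne])

variable {k L ι : Type*} [Field k] [LieRing L] [LieAlgebra k L] [Fintype ι] [DecidableEq ι]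
  {ρ : L →ₗ[k] Matrix ι ι k} {c : ι → k}

theorem lie_diagonal (R : IsRootRep ρ c) {h : L} {d : ι → k} (hh : ρ h = Matrix.diagonal d) (x : L)
    (a b : ι) : ρ ⁅h, x⁆ a b = (d a - d b) * ρ x a b := by
  rw [R.map_lie, hh, Matrix.sub_apply, Matrix.diagonal_mul, Matrix.mul_diagonal]
  ring

theorem aeval_ad_apply (R : IsRootRep ρ c) {h : L} (hh : ρ h = Matrix.diagonal c)
    (p : Polynomial k) (x : L) (a b : ι) :
    ρ (Polynomial.aeval (LieAlgebra.ad k L h) p x) a b = p.eval (c a - c b) * ρ x a b := by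
  induction p using Polynomial.induction_on' with
  | add p q hp hq => simp [hp, hq, add_mul]
  | monomial n t =>
    simp only [Polynomial.aeval_monomial, Polynomial.eval_monomial, Module.algebraMap_end_eq_smul_id,
      Module.End.mul_apply, LinearMap.smul_apply, LinearMap.id_apply, map_smul, Matrix.smul_apply,
      smul_eq_mul, mul_assoc]
    congr 1
    induction n with
    | zero => simp
    | succ n ih =>
      rw [pow_succ', Module.End.mul_apply, LieAlgebra.ad_apply, R.lie_diagonal hh, ih]
      ring

open Classical in
/-- Root components of the elements of a subspace stable under the torus stay in the subspace. -/
theorem exists_component (R : IsRootRep ρ c) (S : Submodule k L)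
    (hS : ∀ h, ρ h = Matrix.diagonal c → ∀ x ∈ S, ⁅h, x⁆ ∈ S) {x : L} (hx : x ∈ S) (μ : k) :
    ∃ y ∈ S, ∀ a b, ρ y a b = if c a - c b = μ then ρ x a b else 0 := by
  classical
  obtain ⟨h, hh⟩ := R.exists_diagonal
  -- The projection onto a weight space of `ad h` is a polynomial in `ad h`: interpolate the
  -- indicator of `μ` on the finite set of weights. Stability of `S` under `h` then suffices.
  set D : Finset k := insert μ (Finset.univ.image fun i : ι × ι => c i.1 - c i.2)
  set p := Lagrange.interpolate D id (fun t => if t = μ then (1 : k) else 0)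
  refine ⟨Polynomial.aeval (LieAlgebra.ad k L h) p x, ?_, fun a b => ?_⟩
  · have key : ∀ p : Polynomial k, Polynomial.aeval (LieAlgebra.ad k L h) p x ∈ S := by
      intro p
      induction p using Polynomial.induction_on' with
      | add p q hp hq => simpa using S.add_mem hp hq
      | monomial n t =>
        simp only [Polynomial.aeval_monomial, Module.algebraMap_end_eq_smul_id,
          Module.End.mul_apply, LinearMap.smul_apply, LinearMap.id_apply]
        refine S.smul_mem _ ?_
        induction n with
        | zero => simpa
        | succ n ih =>
          rw [pow_succ', Module.End.mul_apply, LieAlgebra.ad_apply]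
          exact hS h hh _ ih
    exact key p
  · rw [R.aeval_ad_apply hh]
    have : p.eval (c a - c b) = if c a - c b = μ then (1 : k) else 0 := by
      have := Lagrange.eval_interpolate_at_node (s := D) (v := id)
        (fun t => if t = μ then (1 : k) else 0) (i := c a - c b) (Function.injective_id.injOn) ?_
      · exact this
      · simp only [D, Finset.mem_insert, Finset.mem_image, Finset.mem_univ, true_and]
        exact Or.inr ⟨(a, b), rfl⟩
    rw [this]
    split_ifs <;> simp

/-- A subalgebra that contains all upper triangular elements contains all elements that preserve
each of the steps of the standard flag that the subalgebra preserves. -/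
theorem mem_of_preserves_steps (R : IsRootRep ρ c) (q : LieSubalgebra k L) (o : ι → ℕ) {n : ℕ}
    (ho : Function.Injective o) (hlt : ∀ a, o a < n) (hsurj : ∀ t < n, ∃ a, o a = t)
    (hcompat : ∀ a b a' b', a ≠ b → c a' - c b' = c a - c b → o a ≤ o b → o a' ≤ o b')
    (hT : ∀ x, (∀ a b, ρ x a b ≠ 0 → o a ≤ o b) → x ∈ q) (x : L)
    (hx : ∀ t ≤ n, (∀ y ∈ q, ∀ a b, o b < t → t ≤ o a → ρ y a b = 0) →
      ∀ a b, o b < t → t ≤ o a → ρ x a b = 0) : x ∈ q := by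
  classical
  have hq : ∀ h, ρ h = Matrix.diagonal c → ∀ y ∈ q.toSubmodule, ⁅h, y⁆ ∈ q.toSubmodule := by
    intro h hh y hy
    refine q.lie_mem (hT h fun a b hab => ?_) hy
    rw [hh] at hab
    by_cases hab' : a = b
    · rw [hab']
    · exact absurd (Matrix.diagonal_apply_ne _ hab') hab
  -- The positions occupied by `q` form a preorder that contains the order `o`. Transitivity comes
  -- from bracketing root components, which stay in `q` because the torus element lies in `q`.
  set r : ι → ι → Prop := fun a b => a = b ∨ ∃ y ∈ q, ρ y a b ≠ 0 with hr
  have r_le : ∀ a b, o a ≤ o b → r a b := by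
    intro a b hab
    by_cases hne : a = b
    · exact Or.inl hne
    obtain ⟨y, hy⟩ := R.exists_ne_zero a b hne
    obtain ⟨y', -, hy'⟩ := R.exists_component ⊤ (fun _ _ _ _ => trivial) (x := y) trivial
      (c a - c b)
    refine Or.inr ⟨y', hT _ fun a' b' h' => ?_, by rw [hy' a b, if_pos rfl]; exact hy⟩
    exact hcompat a b a' b' hne (weight_of_component hy' _ _ h') hab
  have r_trans : ∀ a b d, r a b → r b d → r a d := by
    intro a b d hab hbd
    by_cases had : a = d
    · exact Or.inl had
    by_cases hab' : a = b
    · rwa [hab']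
    by_cases hbd' : b = d
    · rwa [← hbd']
    obtain ⟨y, hy, hyab⟩ := hab.resolve_left hab'
    obtain ⟨z, hz, hzbd⟩ := hbd.resolve_left hbd'
    obtain ⟨y', hyq, hy'⟩ := R.exists_component q.toSubmodule hq hy (c a - c b)
    obtain ⟨z', hzq, hz'⟩ := R.exists_component q.toSubmodule hq hz (c b - c d)
    refine Or.inr ⟨⁅y', z'⁆, q.lie_mem hyq hzq, ?_⟩
    refine R.lie_ne_zero a b d y' z' hab' hbd' had (weight_of_component hy')
      (weight_of_component hz') ?_ ?_
    · rwa [hy', if_pos rfl]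
    · rwa [hz', if_pos rfl]
  have key : ∀ a b, ρ x a b ≠ 0 → r a b := by
    intro a b hab
    rcases le_or_gt (o a) (o b) with hle | hlt'
    · exact r_le a b hle
    -- Climb from `b` to `a` one position at a time. If `q` could not climb from `e'` to the next
    -- position `e`, it would preserve the step of the flag between them. Then `x` would preserve it
    -- too, against `ρ x a b ≠ 0`.
    have step : ∀ j, o b + j ≤ o a → ∀ e, o e = o b + j → r e b := by
      intro j
      induction j with
      | zero => intro _ e he; exact Or.inl (ho he)
      | succ j ih =>
        intro hj e he
        obtain ⟨e', he'⟩ := hsurj (o b + j) (by have := hlt a; omega)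
        refine r_trans e e' b ?_ (ih (by omega) e' he')
        by_contra hcon
        refine hab (hx (o b + j + 1) (by have := hlt a; omega) ?_ a b (by omega) (by omega))
        intro y hy a' b' hb' ha'
        by_contra hne
        exact hcon (r_trans e a' e' (r_le _ _ (by omega))
          (r_trans a' b' e' (Or.inr ⟨y, hy, hne⟩) (r_le _ _ (by omega))))
    exact step (o a - o b) (by omega) a (by omega)
  choose X hX using fun μ : k =>
    R.exists_component ⊤ (fun _ _ _ _ => trivial) (x := x) trivial μ
  have hXq : ∀ μ, X μ ∈ q := by
    intro μ
    by_cases h0 : ∀ a b, ρ (X μ) a b ≠ 0 → a = b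
    · exact hT _ fun a b hab => (congrArg o (h0 a b hab)).le
    push Not at h0
    obtain ⟨a, b, hab, hne⟩ := h0
    have hμ := weight_of_component (hX μ).2 a b hab
    have hxab : ρ x a b ≠ 0 := by rwa [(hX μ).2, if_pos hμ] at hab
    obtain ⟨y, hy, hyab⟩ := (key a b hxab).resolve_left hne
    obtain ⟨y', hyq, hy'⟩ := R.exists_component q.toSubmodule hq hy μ
    -- The root space is a line already met by `q`, so the component of `x` is a multiple of an
    -- element of `q`.
    have hz : X μ - (ρ x a b / ρ y a b) • y' = 0 := by
      refine R.line a b _ hne ?_ ?_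
      · simp [(hX μ).2, hy', hμ, hyab]
      · intro a' b' h'
        by_contra hne'
        rw [hμ] at hne'
        exact h' (by simp [(hX μ).2, hy', hne'])
    rw [sub_eq_zero.1 hz]
    exact q.smul_mem _ hyq
  have hsum : x = ∑ μ ∈ Finset.univ.image (fun i : ι × ι => c i.1 - c i.2), X μ := by
    apply R.injective
    ext a b
    rw [map_sum, Matrix.sum_apply]
    simp only [(hX _).2]
    rw [Finset.sum_ite_eq, if_pos]
    exact Finset.mem_image.2 ⟨(a, b), Finset.mem_univ _, rfl⟩
  rw [hsum]
  exact q.toSubmodule.sum_mem fun μ _ => hXq μ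

end IsRootRep

/-! ### Solvability of triangular matrix algebras -/

section Filtered

variable {k L ι : Type*} [Field k] [LieRing L] [LieAlgebra k L] [Fintype ι]

/-- For `j ≥ 1` each product alone moves at least `2 * j` off the diagonal. For `j = 0` the only
obstruction is on the diagonal, where the scalar entries of the two products cancel. -/
theorem commutator_shift {A B : Matrix ι ι k} {o : ι → ℕ} (ho : Function.Injective o) {j : ℕ}
    (hA : ∀ a b, A a b ≠ 0 → o a + j ≤ o b) (hB : ∀ a b, B a b ≠ 0 → o a + j ≤ o b) (a b : ι)
    (hab : (A * B - B * A) a b ≠ 0) : o a + (j + 1) ≤ o b := by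
  by_contra hlt
  refine hab ?_
  rw [Matrix.sub_apply, Matrix.mul_apply, Matrix.mul_apply, ← Finset.sum_sub_distrib]
  refine Finset.sum_eq_zero fun t _ => ?_
  by_cases h : A a t * B t b ≠ 0 ∨ B a t * A t b ≠ 0
  · have h1 : o a + j ≤ o t ∧ o t + j ≤ o b := by
      rcases h with h | h
      · exact ⟨hA _ _ (left_ne_zero_of_mul h), hB _ _ (right_ne_zero_of_mul h)⟩
      · exact ⟨hB _ _ (left_ne_zero_of_mul h), hA _ _ (right_ne_zero_of_mul h)⟩
    have h2 : a = t := ho (by omega)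
    have h3 : a = b := ho (by omega)
    subst h2; subst h3
    ring
  · push Not at h
    rw [h.1, h.2, sub_zero]

/-- A Lie algebra of upper triangular matrices is solvable. -/
theorem isSolvable_of_upperTriangular {ρ : L →ₗ[k] Matrix ι ι k} (hinj : Function.Injective ρ)
    (hlie : ∀ x y, ρ ⁅x, y⁆ = ρ x * ρ y - ρ y * ρ x) {o : ι → ℕ} (ho : Function.Injective o)
    (q : LieSubalgebra k L) (hq : ∀ x ∈ q, ∀ a b, ρ x a b ≠ 0 → o a ≤ o b) :
    LieAlgebra.IsSolvable q := by
  have key : ∀ j, ∀ x ∈ LieAlgebra.derivedSeries k q j, ∀ a b, ρ x a b ≠ 0 → o a + j ≤ o b := by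
    intro j
    induction j with
    | zero => intro x _; simpa using hq x x.2
    | succ j ih =>
      intro x hx
      rw [LieAlgebra.derivedSeries_def, LieAlgebra.derivedSeriesOfIdeal_succ,
        ← LieSubmodule.mem_toSubmodule, LieSubmodule.lieIdeal_oper_eq_linear_span'] at hx
      induction hx using Submodule.span_induction with
      | mem x hx =>
        obtain ⟨y, hy, z, hz, rfl⟩ := hx
        intro a b hab
        rw [LieSubalgebra.coe_bracket, hlie] at hab
        exact commutator_shift ho (ih y hy) (ih z hz) a b hab
      | zero => intro a b h; simp at h
      | add x y _ _ hx hy =>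
        intro a b h
        by_cases h' : ρ x a b = 0
        · refine hy a b fun h'' => h ?_
          simp [h', h'']
        · exact hx a b h'
      | smul t x _ hx =>
        intro a b h
        refine hx a b fun h' => h ?_
        simp [h']
  -- Every derived step gains one in the distance to the diagonal, which cannot exceed the largest
  -- value of `o`.
  refine LieAlgebra.IsSolvable.mk (R := k) (k := Finset.univ.sup o + 1) ?_
  rw [eq_bot_iff]
  intro x hx
  rw [LieSubmodule.mem_bot, Subtype.ext_iff]
  apply hinj
  ext a b
  by_contra hne
  have h1 := key _ x hx a b (by simpa using hne)
  have h2 : o b ≤ Finset.univ.sup o := Finset.le_sup (Finset.mem_univ b)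
  omega

end Filtered

/-! ### The nilradical of a block triangular subalgebra -/

namespace IsRootRep

variable {k L ι : Type*} [Field k] [LieRing L] [LieAlgebra k L] [Fintype ι] [DecidableEq ι]
  {ρ : L →ₗ[k] Matrix ι ι k} {c : ι → k}

/-- The strictly block upper triangular elements of an algebra of block upper triangular matrices. -/
def strictIdeal (R : IsRootRep ρ c) (q : LieSubalgebra k L) (blk : ι → ℕ)
    (hq : ∀ x ∈ q, ∀ a b, ρ x a b ≠ 0 → blk a ≤ blk b) : LieIdeal k q where
  carrier := {x | ∀ a b, ρ x a b ≠ 0 → blk a < blk b}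
  add_mem' := by
    intro x y hx hy a b h
    by_cases h' : ρ x a b = 0
    · refine hy a b fun h'' => h ?_
      simp [h', h'']
    · exact hx a b h'
  zero_mem' := by intro a b h; simp at h
  smul_mem' := by
    intro t x hx a b h
    refine hx a b fun h' => h ?_
    simp [h']
  lie_mem := by
    intro x y hy a b h
    rw [LieSubalgebra.coe_bracket, R.map_lie] at h
    by_contra hlt
    refine h ?_
    rw [Matrix.sub_apply, Matrix.mul_apply, Matrix.mul_apply, ← Finset.sum_sub_distrib]
    refine Finset.sum_eq_zero fun t _ => ?_
    rw [sub_eq_zero]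
    have h1 : ρ x a t * ρ y t b = 0 := by
      by_contra hne
      have := hq x x.2 _ _ (left_ne_zero_of_mul hne)
      have := hy _ _ (right_ne_zero_of_mul hne)
      omega
    have h2 : ρ y a t * ρ x t b = 0 := by
      by_contra hne
      have := hy _ _ (left_ne_zero_of_mul hne)
      have := hq x x.2 _ _ (right_ne_zero_of_mul hne)
      omega
    rw [h1, h2]

/-- By Engel's theorem it is enough that each `ad x` is nilpotent, and `ad x` raises the distance
between blocks by at least one. -/
theorem isNilpotent_strictIdeal [FiniteDimensional k L] (R : IsRootRep ρ c) (q : LieSubalgebra k L)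
    (blk : ι → ℕ) (hq : ∀ x ∈ q, ∀ a b, ρ x a b ≠ 0 → blk a ≤ blk b) :
    LieRing.IsNilpotent (R.strictIdeal q blk hq) := by
  rw [LieAlgebra.isNilpotent_iff_forall (R := k)]
  intro x
  have key : ∀ j, ∀ y : R.strictIdeal q blk hq, ∀ a b,
      ρ ((LieAlgebra.ad k _ x ^ j) y : R.strictIdeal q blk hq) a b ≠ 0 → blk a + j ≤ blk b := by
    intro j
    induction j with
    | zero => intro y a b h; exact (y.2 a b h).le
    | succ j ih =>
      intro y a b h
      rw [pow_succ', Module.End.mul_apply, LieAlgebra.ad_apply] at h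
      rw [show ∀ z : R.strictIdeal q blk hq, ((⁅x, z⁆ : R.strictIdeal q blk hq) : L) =
        ⁅(x : L), (z : L)⁆ from fun _ => rfl, R.map_lie] at h
      by_contra hlt
      refine h ?_
      rw [Matrix.sub_apply, Matrix.mul_apply, Matrix.mul_apply, ← Finset.sum_sub_distrib]
      refine Finset.sum_eq_zero fun t _ => ?_
      rw [sub_eq_zero]
      set z := (LieAlgebra.ad k _ x ^ j) y
      have h1 : ρ x a t * ρ z t b = 0 := by
        by_contra hne
        have := x.2 _ _ (left_ne_zero_of_mul hne)
        have := ih _ _ _ (right_ne_zero_of_mul hne)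
        omega
      have h2 : ρ z a t * ρ x t b = 0 := by
        by_contra hne
        have := ih _ _ _ (left_ne_zero_of_mul hne)
        have := x.2 _ _ (right_ne_zero_of_mul hne)
        omega
      exact h1.trans h2.symm
  refine ⟨Finset.univ.sup blk + 1, ?_⟩
  ext y
  apply R.injective
  ext a b
  by_contra hne
  have h1 := key _ y a b (by simpa using hne)
  have h2 : blk b ≤ Finset.univ.sup blk := Finset.le_sup (Finset.mem_univ b)
  omega

/-- Powers of `ad x` multiply the entry at `(a, b)` by powers of `d a - d b`. Nilpotency on `I`
forces this factor to vanish. -/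
theorem diagonal_eq_of_mem_nilpotent (R : IsRootRep ρ c) (q : LieSubalgebra k L) (I : LieIdeal k q)
    [LieRing.IsNilpotent I] {x y : q} (hx : x ∈ I) (hy : y ∈ I) {d : ι → k}
    (hd : ρ x = Matrix.diagonal d) {a b : ι} (hab : ρ y a b ≠ 0) : d a = d b := by
  obtain ⟨n, hn⟩ := LieModule.isNilpotent_toEnd_of_isNilpotent k I I ⟨x, hx⟩
  have key : ∀ n, ρ ((LieModule.toEnd k I I ⟨x, hx⟩ ^ n) ⟨y, hy⟩ : I) a b
      = (d a - d b) ^ n * ρ y a b := by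
    intro n
    induction n with
    | zero => simp
    | succ n ih =>
      rw [pow_succ', Module.End.mul_apply, LieModule.toEnd_apply_apply,
        show ∀ z : I, ((⁅(⟨x, hx⟩ : I), z⁆ : I) : L) = ⁅(x : L), (z : L)⁆ from fun _ => rfl, R.lie_diagonal hd, ih]
      ring
  have := key n
  rw [hn] at this
  simp only [LinearMap.zero_apply, LieSubmodule.coe_zero, ZeroMemClass.coe_zero, map_zero,
    Matrix.zero_apply] at this
  have := (mul_eq_zero.1 this.symm).resolve_right hab
  exact sub_eq_zero.1 (by_contra fun h0 => pow_ne_zero _ h0 this)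

/-- A nilpotent ideal is a sum of its root components. A root component inside a diagonal block
would produce a coroot in the ideal, and a nonzero diagonal component would act on some root vector
with nonzero eigenvalue. Both contradict nilpotency. -/
theorem mem_lieNilradical_iff [FiniteDimensional k L] (R : IsRootRep ρ c) (q : LieSubalgebra k L)
    (blk : ι → ℕ) (hq : ∀ x, x ∈ q ↔ ∀ a b, ρ x a b ≠ 0 → blk a ≤ blk b)
    (hcompat : ∀ a b a' b', a ≠ b → c a' - c b' = c a - c b → blk a ≤ blk b → blk a' ≤ blk b')
    (x : q) : x ∈ lieNilradical k q ↔ ∀ a b, ρ x a b ≠ 0 → blk a < blk b := by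
  classical
  have hq' : ∀ x ∈ q, ∀ a b, ρ x a b ≠ 0 → blk a ≤ blk b := fun x => (hq x).1
  suffices h : lieNilradical k q = R.strictIdeal q blk hq' by
    rw [h]; rfl
  apply le_antisymm
  swap
  · exact le_sSup (R.isNilpotent_strictIdeal q blk hq')
  refine sSup_le fun I hI => ?_
  have : LieRing.IsNilpotent I := hI
  have hdiag : ∀ {h : L} {d}, ρ h = Matrix.diagonal d → h ∈ q := by
    intro h d hh
    refine (hq h).2 fun a b hab => ?_
    rw [hh] at hab
    by_cases hab' : a = b
    · rw [hab']
    · exact absurd (Matrix.diagonal_apply_ne _ hab') hab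
  have hcomp : ∀ x ∈ I, ∀ μ, ∃ y ∈ I, ∀ a b, ρ y a b = if c a - c b = μ then ρ x a b else 0 := by
    intro x hx μ
    obtain ⟨y, hy, h⟩ := R.exists_component (I.toSubmodule.map q.toSubmodule.subtype) (by
      rintro h hh _ ⟨y, hy, rfl⟩
      exact ⟨⁅(⟨h, hdiag hh⟩ : q), y⁆, I.lie_mem hy, rfl⟩) ⟨x, hx, rfl⟩ μ
    obtain ⟨y, hy, rfl⟩ := hy
    exact ⟨y, hy, h⟩
  have hroot : ∀ a b, a ≠ b → blk a ≤ blk b → ∃ y : q, ρ y a b ≠ 0 ∧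
      ∀ a' b', ρ y a' b' ≠ 0 → c a' - c b' = c a - c b := by
    intro a b hne hle
    obtain ⟨y, hy⟩ := R.exists_ne_zero a b hne
    obtain ⟨y', -, hy'⟩ := R.exists_component ⊤ (fun _ _ _ _ => trivial) (x := y) trivial
      (c a - c b)
    have hw := weight_of_component hy'
    exact ⟨⟨y', (hq _).2 fun a' b' h => hcompat a b a' b' hne (hw _ _ h) hle⟩,
      by simpa [hy'] using hy, hw⟩
  have hdiagonal : ∀ {y : L}, (∀ a b, ρ y a b ≠ 0 → c a - c b = 0) →
      ρ y = Matrix.diagonal fun a => ρ y a a := by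
    intro y hy
    ext a b
    by_cases hab : a = b
    · simp [hab]
    · rw [Matrix.diagonal_apply_ne _ hab]
      by_contra hne
      exact hab (R.weight_injective (sub_eq_zero.1 (hy a b hne)))
  -- Within one block the opposite root vector `y` also lies in `q`. So `[x', y]` is a diagonal
  -- element of `I` whose entries at `a` and `b` differ, while `x'` in `I` has a nonzero entry at
  -- `(a, b)`.
  have hstrict : ∀ x ∈ I, ∀ a b, a ≠ b → ρ x a b ≠ 0 → blk a < blk b := by
    intro x hx a b hne hab
    refine lt_of_le_of_ne (hq' x x.2 a b hab) fun heq => ?_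
    obtain ⟨x', hx', hx'c⟩ := hcomp x hx (c a - c b)
    have hw := weight_of_component hx'c
    obtain ⟨y, hy, hyw⟩ := hroot b a hne.symm heq.ge
    have hx'ab : ρ x' a b ≠ 0 := by simpa [hx'c] using hab
    have hd : ρ ⁅(x' : L), (y : L)⁆ = Matrix.diagonal fun t => ρ ⁅(x' : L), (y : L)⁆ t t := by
      apply hdiagonal
      intro a' b' h
      rw [R.map_lie] at h
      by_contra hne'
      refine h ?_
      rw [Matrix.sub_apply, Matrix.mul_apply, Matrix.mul_apply, ← Finset.sum_sub_distrib]
      refine Finset.sum_eq_zero fun t _ => ?_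
      rw [sub_eq_zero]
      have h1 : ρ x' a' t * ρ y t b' = 0 := by
        by_contra h0
        refine hne' ?_
        have h1 := hw _ _ (left_ne_zero_of_mul h0)
        have h2 := hyw _ _ (right_ne_zero_of_mul h0)
        linear_combination h1 + h2
      have h2 : ρ y a' t * ρ x' t b' = 0 := by
        by_contra h0
        refine hne' ?_
        have h1 := hyw _ _ (left_ne_zero_of_mul h0)
        have h2 := hw _ _ (right_ne_zero_of_mul h0)
        linear_combination h1 + h2
      rw [h1, h2]
    have hmem : ⁅x', y⁆ ∈ I := lie_mem_left k q I x' y hx'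
    have := R.diagonal_eq_of_mem_nilpotent q I hmem hx' hd hx'ab
    exact R.coroot a b x' y hne hw hyw hx'ab hy this
  intro x hx a b hab
  by_cases hne : a = b
  swap
  · exact hstrict x hx a b hne hab
  exfalso
  obtain ⟨x', hx', hx'c⟩ := hcomp x hx 0
  have hw := weight_of_component hx'c
  have hd := hdiagonal hw
  -- Bracketing the diagonal `x'` with a root vector of `q` stays in `I`, so unequal entries would
  -- be a nonzero eigenvalue of `ad x'` on `I`. Any two blocks are comparable, so `x'` is scalar and
  -- hence zero.
  have hscal : ∀ a b, blk a ≤ blk b → ρ x' a a = ρ x' b b := by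
    intro a b hle
    by_cases hne : a = b
    · rw [hne]
    by_contra hne'
    obtain ⟨y, hy, -⟩ := hroot a b hne hle
    have hmem : ⁅x', y⁆ ∈ I := lie_mem_left k q I x' y hx'
    refine hne' (R.diagonal_eq_of_mem_nilpotent q I hx' hmem hd (a := a) (b := b) ?_)
    rw [LieSubalgebra.coe_bracket, R.lie_diagonal hd]
    exact mul_ne_zero (sub_ne_zero.2 hne') hy
  have h0 := R.scalar x' (fun a b hne => by rw [hd, Matrix.diagonal_apply_ne _ hne])
    (fun a b => (le_total (blk a) (blk b)).elim (hscal a b) fun h => (hscal b a h).symm)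
  apply hab
  have := hx'c a b
  rw [h0, if_pos (by rw [hne, sub_self])] at this
  simpa using this.symm

end IsRootRep

/-! ### A criterion for commutative polarizations -/

section CommutativePolarization

variable {k M : Type*} [Field k] [LieRing M] [LieAlgebra k M]

/-- The alternating form `(x, y) ↦ f [x, y]`. -/
def bracketForm (f : Dual k M) : LinearMap.BilinForm k M :=
  LinearMap.mk₂ k (fun x y => f ⁅x, y⁆) (by simp) (by simp) (by simp) (by simp)

theorem bracketForm_apply (f : Dual k M) (x y : M) : bracketForm f x y = f ⁅x, y⁆ := rfl

theorem bracketForm_isRefl (f : Dual k M) : (bracketForm f).IsRefl := by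
  intro x y h
  rw [bracketForm_apply] at h ⊢
  rw [← lie_skew, map_neg, h, neg_zero]

theorem formRadical_eq_orthogonal_top (f : Dual k M) :
    formRadical k f = (bracketForm f).orthogonal ⊤ := by
  ext x
  rw [LinearMap.BilinForm.mem_orthogonal_iff]
  constructor
  · intro h y _
    change f ⁅y, x⁆ = 0
    rw [← lie_skew, map_neg, h y, neg_zero]
  · intro h y
    have : f ⁅y, x⁆ = 0 := h y trivial
    rw [← lie_skew, map_neg, this, neg_zero]

/-- A commutative ideal that is its own orthogonal for one of the forms `f [x, y]` is a
commutative polarization. -/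
theorem isCPIdeal_and_lieIndex [FiniteDimensional k M] (P : LieIdeal k M)
    (hcomm : ∀ x ∈ P, ∀ y ∈ P, ⁅x, y⁆ = 0) (f : Dual k M)
    (hf : ∀ x, (∀ y ∈ P, f ⁅y, x⁆ = 0) → x ∈ P) :
    IsCPIdeal k P ∧ lieIndex k M + finrank k M = 2 * finrank k P := by
  have hle : ∀ g : Dual k M, 2 * finrank k P ≤ finrank k M + finrank k (formRadical k g) := by
    intro g
    -- The identity `dim P + dim P^⊥ = dim M + dim (P ∩ M(g))`, combined with `P ≤ P^⊥`.
    have h1 := LinearMap.BilinForm.finrank_add_finrank_orthogonal (bracketForm_isRefl g)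
      P.toSubmodule
    have h2 : P.toSubmodule ≤ (bracketForm g).orthogonal P.toSubmodule := by
      intro x hx
      rw [LinearMap.BilinForm.mem_orthogonal_iff]
      intro y hy
      change g ⁅y, x⁆ = 0
      rw [hcomm y hy x hx, map_zero]
    have h3 := Submodule.finrank_mono h2
    rw [← formRadical_eq_orthogonal_top] at h1
    have h4 : finrank k (P.toSubmodule ⊓ formRadical k g : Submodule k M) ≤
        finrank k (formRadical k g) := Submodule.finrank_mono inf_le_right
    change 2 * finrank k P.toSubmodule ≤ _
    omega
  have heq : 2 * finrank k P = finrank k M + finrank k (formRadical k f) := by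
    refine le_antisymm (hle f) ?_
    have h1 := LinearMap.BilinForm.finrank_add_finrank_orthogonal (bracketForm_isRefl f)
      P.toSubmodule
    have h2 : (bracketForm f).orthogonal P.toSubmodule ≤ P.toSubmodule := by
      intro x hx
      rw [LinearMap.BilinForm.mem_orthogonal_iff] at hx
      exact hf x hx
    have h3 := Submodule.finrank_mono h2
    -- The radical `M(f)` lies in `P^⊥ ≤ P`, so the intersection in `h1` is all of `M(f)` and the
    -- inequality reverses.
    have h4 : (bracketForm f).orthogonal ⊤ ≤ P.toSubmodule :=
      (LinearMap.BilinForm.orthogonal_le le_top).trans h2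
    rw [inf_eq_right.2 h4, ← formRadical_eq_orthogonal_top] at h1
    change _ ≤ 2 * finrank k P.toSubmodule
    omega
  have hindex : lieIndex k M + finrank k M = 2 * finrank k P := by
    have h1 : lieIndex k M ≤ finrank k (formRadical k f) := ciInf_le' _ f
    have h2 : finrank k (formRadical k f) ≤ lieIndex k M :=
      le_ciInf fun g => by have := hle g; omega
    omega
  refine ⟨⟨hcomm, fun g hg => ⟨fun x hx y hy => ?_, ?_⟩⟩, hindex⟩
  · rw [hcomm x hx y hy, map_zero]
  · have h1 : finrank k (formRadical k g) = lieIndex k M := hg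
    rw [h1, add_comm, hindex]
    rfl

end CommutativePolarization

/-! ### Building full flags, and Lie's theorem -/

section AdaptedVectors

variable {k V : Type*} [Field k] [AddCommGroup V] [Module k V]

theorem span_image_Iio_succ (v : ℕ → V) (t : ℕ) :
    Submodule.span k (v '' Set.Iio (t + 1)) =
      Submodule.span k (v '' Set.Iio t) ⊔ Submodule.span k {v t} := by
  rw [← Submodule.span_union]
  congr 1
  ext x
  simp only [Set.mem_image, Set.mem_Iio, Set.mem_union, Set.mem_singleton_iff]
  constructor
  · rintro ⟨i, hi, rfl⟩
    rcases Nat.lt_succ_iff_lt_or_eq.1 hi with h | rfl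
    · exact Or.inl ⟨i, h, rfl⟩
    · exact Or.inr rfl
  · rintro (⟨i, hi, rfl⟩ | rfl)
    · exact ⟨i, by omega, rfl⟩
    · exact ⟨t, by omega, rfl⟩

theorem span_range_fin (v : ℕ → V) (t : ℕ) :
    Submodule.span k (Set.range fun i : Fin t => v i) = Submodule.span k (v '' Set.Iio t) := by
  congr 1
  ext x
  simp only [Set.mem_range, Set.mem_image, Set.mem_Iio]
  exact ⟨fun ⟨i, hi⟩ => ⟨i, i.2, hi⟩, fun ⟨i, h, hi⟩ => ⟨⟨i, h⟩, hi⟩⟩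

/-- If a family of subspaces contains `0` and each of its members of dimension less than `d` can be
enlarged by a vector, there are `d` independent vectors with the spans of the initial segments in
the family. -/
theorem exists_adapted_vectors (S : Submodule k V → Prop) (h0 : S ⊥) (d : ℕ)
    (hstep : ∀ U, S U → finrank k U < d → ∃ v ∉ U, S (U ⊔ Submodule.span k {v})) :
    ∃ v : ℕ → V, LinearIndependent k (fun i : Fin d => v i) ∧
      ∀ t ≤ d, S (Submodule.span k (v '' Set.Iio t)) := by
  suffices h : ∀ j ≤ d, ∃ v : ℕ → V, LinearIndependent k (fun i : Fin j => v i) ∧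
      ∀ t ≤ j, S (Submodule.span k (v '' Set.Iio t)) from h d le_rfl
  intro j
  induction j with
  | zero =>
    intro _
    refine ⟨fun _ => 0, linearIndependent_empty_type, fun t ht => ?_⟩
    rw [Nat.le_zero.1 ht]
    simpa
  | succ j ih =>
    intro hj
    obtain ⟨v, hv, hS⟩ := ih (by omega)
    obtain ⟨w, hw, hSw⟩ := hstep _ (hS j le_rfl) (by
      rw [← span_range_fin, finrank_span_eq_card hv, Fintype.card_fin]; omega)
    have himg : ∀ t ≤ j, Function.update v j w '' Set.Iio t = v '' Set.Iio t := by
      intro t ht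
      refine Set.image_congr fun i hi => Function.update_of_ne ?_ _ _
      have : i < t := hi
      omega
    refine ⟨Function.update v j w, ?_, fun t ht => ?_⟩
    · rw [linearIndependent_finSucc']
      have hinit : (Fin.init fun i : Fin (j + 1) => Function.update v j w i) =
          fun i : Fin j => v i := by
        funext i
        exact Function.update_of_ne (by simpa using i.2.ne) _ _
      rw [hinit]
      refine ⟨hv, ?_⟩
      rw [span_range_fin]
      simpa using hw
    · rcases Nat.lt_or_ge t (j + 1) with h | h
      · rw [himg t (by omega)]
        exact hS t (by omega)
      · obtain rfl : t = j + 1 := by omega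
        rw [span_image_Iio_succ, himg j le_rfl, Function.update_self]
        exact hSw

/-- A step of a chain of invariant subspaces of a solvable Lie algebra can be refined by a vector,
by Lie's theorem. -/
theorem exists_invariant_extension [IsAlgClosed k] [CharZero k] [FiniteDimensional k V]
    {L : Type*} [LieRing L] [LieAlgebra k L] (σ : L →ₗ[k] V →ₗ[k] V)
    (hσ : ∀ x y v, σ ⁅x, y⁆ v = σ x (σ y v) - σ y (σ x v)) (b : LieSubalgebra k L)
    [LieAlgebra.IsSolvable b] {U U' : Submodule k V} (hlt : U < U')
    (hU : ∀ x ∈ b, ∀ v ∈ U, σ x v ∈ U) (hU' : ∀ x ∈ b, ∀ v ∈ U', σ x v ∈ U') :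
    ∃ v ∈ U', v ∉ U ∧ ∀ x ∈ b, ∀ w ∈ U ⊔ Submodule.span k {v},
      σ x w ∈ U ⊔ Submodule.span k {v} := by
  let _ : LieRingModule b V :=
    { bracket := fun x v => σ x v
      add_lie := fun x y v => by change σ (x + y : L) v = _; rw [map_add]; rfl
      lie_add := fun x v w => map_add _ _ _
      leibniz_lie := fun x y v => by
        change σ x (σ y v) = σ ⁅(x : L), (y : L)⁆ v + σ y (σ x v)
        rw [hσ]; abel }
  let _ : LieModule k b V :=
    { smul_lie := fun t x v => by change σ (t • x : L) v = _; rw [map_smul]; rfl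
      lie_smul := fun t x v => map_smul _ _ _ }
  let N : LieSubmodule k b V := { U with lie_mem := fun {x v} hv => hU x x.2 v hv }
  let N' : LieSubmodule k b V := { U' with lie_mem := fun {x v} hv => hU' x x.2 v hv }
  have hN : ∀ v, v ∈ N ↔ v ∈ U := fun v => Iff.rfl
  obtain ⟨w, hwU', hwU⟩ := SetLike.exists_of_lt hlt
  -- Lie's theorem gives a common eigenvector in the nonzero quotient `U' / U`; any lift of it is
  -- the required vector.
  let C : LieSubmodule k b N' := N.comap N'.incl
  have : Nontrivial (N' ⧸ C) := by
    refine ⟨⟨LieSubmodule.Quotient.mk ⟨w, hwU'⟩, 0, fun h => hwU ?_⟩⟩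
    exact (LieSubmodule.Quotient.mk_eq_zero' (N := C)).1 h
  obtain ⟨χ, hχ⟩ := LieModule.exists_nontrivial_weightSpace_of_isSolvable k b (N' ⧸ C)
  obtain ⟨⟨z, hz⟩, hz0⟩ := exists_ne (0 : LieModule.weightSpace (N' ⧸ C) χ)
  rw [LieModule.mem_weightSpace] at hz
  obtain ⟨v, rfl⟩ := LieSubmodule.Quotient.surjective_mk' C z
  refine ⟨v, v.2, fun hvU => hz0 ?_, ?_⟩
  · ext
    exact (LieSubmodule.Quotient.mk_eq_zero' (N := C)).2 hvU
  · intro x hx w hw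
    obtain ⟨u, hu, y, hy, rfl⟩ := Submodule.mem_sup.1 hw
    obtain ⟨t, rfl⟩ := Submodule.mem_span_singleton.1 hy
    rw [map_add, map_smul]
    have h1 := hz ⟨x, hx⟩
    have h2 : (⁅(⟨x, hx⟩ : b), v⁆ - χ ⟨x, hx⟩ • v : N') ∈ C := by
      rw [← LieSubmodule.Quotient.mk_eq_zero']
      exact sub_eq_zero.2 h1
    have h3 : σ x v - χ ⟨x, hx⟩ • (v : V) ∈ U := h2
    have hle : U ≤ U ⊔ Submodule.span k {(v : V)} := le_sup_left
    have hv : (v : V) ∈ U ⊔ Submodule.span k {(v : V)} :=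
      Submodule.mem_sup_right (Submodule.mem_span_singleton_self _)
    refine add_mem (hle (hU x hx u hu)) (Submodule.smul_mem _ _ ?_)
    have := add_mem (hle h3) (Submodule.smul_mem _ (χ ⟨x, hx⟩) hv)
    rwa [sub_add_cancel] at this

end AdaptedVectors

/-! ### A generic weight that separates roots -/

section Weights

/-- Reduction modulo 5 kills the lowest digit, and one divides by 5. The bound 4 is what a
difference of two roots needs: four weight coordinates, each of absolute value at most 1. -/
theorem eq_zero_of_sum_mul_five_pow_eq_zero {n : ℕ} (d : Fin n → ℤ) (hd : ∀ i, |d i| ≤ 4)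
    (h : ∑ i, d i * 5 ^ (i : ℕ) = 0) : ∀ i, d i = 0 := by
  induction n with
  | zero => exact fun i => i.elim0
  | succ n ih =>
    rw [Fin.sum_univ_succ] at h
    have h1 : ∑ i : Fin n, d i.succ * 5 ^ ((i.succ : Fin (n + 1)) : ℕ) =
        5 * ∑ i : Fin n, d i.succ * 5 ^ (i : ℕ) := by
      rw [Finset.mul_sum]
      refine Finset.sum_congr rfl fun i _ => ?_
      rw [Fin.val_succ, pow_succ]
      ring
    rw [h1] at h
    have h0 := abs_le.1 (hd 0)
    simp only [Fin.val_zero, pow_zero, mul_one] at h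
    have h2 : d 0 = 0 := by omega
    have h3 : ∑ i : Fin n, d i.succ * 5 ^ (i : ℕ) = 0 := by omega
    intro i
    refine Fin.cases h2 (fun j => ?_) i
    exact ih (fun j => d j.succ) (fun j => hd _) h3 j

/-- The coordinates of the weight of the basis vector `a` of `k ^ (2 r)`. -/
def weightCoord {r : ℕ} (a : Fin r ⊕ Fin r) (j : Fin r) : ℤ :=
  a.elim (fun i => if i = j then 1 else 0) (fun i => if i = j then -1 else 0)

/-- The sign attached to a basis vector of `k ^ (2 r)`. -/
def spSign {r : ℕ} (a : Fin r ⊕ Fin r) : ℤ := a.elim (fun _ => 1) (fun _ => -1)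

/-- A generic weight for the symplectic algebra. -/
def spWeight {r : ℕ} (a : Fin r ⊕ Fin r) : ℤ := ∑ j, weightCoord a j * 5 ^ (j : ℕ)

theorem spWeight_swap {r : ℕ} (a : Fin r ⊕ Fin r) : spWeight a.swap = -spWeight a := by
  rw [spWeight, spWeight, ← Finset.sum_neg_distrib]
  refine Finset.sum_congr rfl fun j _ => ?_
  rcases a with i | i <;> by_cases h : i = j <;> simp [weightCoord, h]

theorem spSign_mul_self {r : ℕ} (a : Fin r ⊕ Fin r) : spSign a * spSign a = 1 := by
  rcases a with i | i <;> simp [spSign]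

theorem spSign_swap {r : ℕ} (a : Fin r ⊕ Fin r) : spSign a.swap = -spSign a := by
  rcases a with i | i <;> simp [spSign]

theorem swap_ne {r : ℕ} (a : Fin r ⊕ Fin r) : a.swap ≠ a := by
  rcases a with i | i <;> simp

/-- Equality of the integers gives equality of all coordinates of the two roots. The remaining
ambiguity is the symmetry that negates and exchanges the two weights. -/
theorem spWeight_sub_eq {r : ℕ} {a b a' b' : Fin r ⊕ Fin r} (hab : a ≠ b)
    (h : spWeight a' - spWeight b' = spWeight a - spWeight b) :
    (a' = a ∧ b' = b) ∨ (a' = b.swap ∧ b' = a.swap) := by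
  have h0 := eq_zero_of_sum_mul_five_pow_eq_zero
    (fun j => weightCoord a' j - weightCoord b' j - weightCoord a j + weightCoord b j) (by
      intro j
      have : ∀ a : Fin r ⊕ Fin r, |weightCoord a j| ≤ 1 := by
        intro a
        rcases a with i | i <;> by_cases h : i = j <;> simp [weightCoord, h]
      have h1 := abs_le.1 (this a)
      have h2 := abs_le.1 (this b)
      have h3 := abs_le.1 (this a')
      have h4 := abs_le.1 (this b')
      rw [abs_le]
      omega) (by
      simp only [spWeight] at h
      simp only [sub_mul, add_mul, Finset.sum_add_distrib, Finset.sum_sub_distrib]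
      linarith)
  rcases a with a | a <;> rcases b with b | b <;> rcases a' with a' | a' <;>
    rcases b' with b' | b' <;>
    simp only [weightCoord, Sum.elim_inl, Sum.elim_inr, Sum.swap_inl, Sum.swap_inr, Sum.inl.injEq,
      Sum.inr.injEq, reduceCtorEq, false_and, and_false, or_false, false_or, ne_eq,
      not_false_eq_true] at h0 hab ⊢ <;>
    · have ha := h0 a
      have hb := h0 b
      have ha' := h0 a'
      have hb' := h0 b'
      grind

end Weights

/-! ### Root data of the special linear and symplectic algebras -/

section Concrete

variable {k L : Type*} [Field k] [CharZero k] [LieRing L] [LieAlgebra k L]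

/-- Each root occupies a single position, which reduces the axioms to products of elementary
matrices. Characteristic zero separates the two coroot entries and excludes nonzero traceless
scalars. -/
theorem isRootRep_sl {n : ℕ} (ρ : L →ₗ[k] Matrix (Fin n) (Fin n) k)
    (hinj : Function.Injective ρ) (hlie : ∀ x y, ρ ⁅x, y⁆ = ρ x * ρ y - ρ y * ρ x)
    (hrange : ∀ A, (∃ x, ρ x = A) ↔ A.trace = 0) :
    ∃ c : Fin n → k, IsRootRep ρ c ∧
      ∀ a b a' b', a ≠ b → c a' - c b' = c a - c b → a' = a ∧ b' = b := by
  -- Subtracting the average makes the diagonal matrix traceless without changing differences of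
  -- weights.
  set avg : k := (∑ i : Fin n, (5 : k) ^ (i : ℕ)) / n
  set c : Fin n → k := fun i => 5 ^ (i : ℕ) - avg
  have hc : ∀ a b a' b', a ≠ b → c a' - c b' = c a - c b → a' = a ∧ b' = b := by
    intro a b a' b' hab h
    simp only [c, sub_sub_sub_cancel_right] at h
    have h' : spWeight (Sum.inl a' : Fin n ⊕ Fin n) - spWeight (Sum.inl b' : Fin n ⊕ Fin n) =
        spWeight (Sum.inl a : Fin n ⊕ Fin n) - spWeight (Sum.inl b : Fin n ⊕ Fin n) := by
      simp only [spWeight, weightCoord, Sum.elim_inl, ite_mul, one_mul, zero_mul,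
        Finset.sum_ite_eq, Finset.mem_univ, if_true]
      exact_mod_cast h
    rcases spWeight_sub_eq (by simpa using hab) h' with h | h
    · simpa using h
    · simp at h
  refine ⟨c, ?_, hc⟩
  have hsingle : ∀ {a b x}, a ≠ b → (∀ a' b', ρ x a' b' ≠ 0 → c a' - c b' = c a - c b) →
      ∀ a' b', ρ x a' b' ≠ 0 → a' = a ∧ b' = b :=
    fun hab h a' b' h' => hc _ _ _ _ hab (h a' b' h')
  refine
    { injective := hinj
      map_lie := hlie
      weight_injective := ?_
      exists_diagonal := ?_
      exists_ne_zero := ?_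
      line := ?_
      lie_ne_zero := ?_
      coroot := ?_
      scalar := ?_ }
  · intro a b hab
    by_contra hne
    exact hne (hc a b b a hne (by rw [hab])).1.symm
  · rw [hrange, Matrix.trace_diagonal]
    simp only [c, avg, Finset.sum_sub_distrib, Finset.sum_const, Finset.card_univ,
      Fintype.card_fin, nsmul_eq_mul]
    rcases Nat.eq_zero_or_pos n with h | h
    · subst h; simp
    · rw [mul_div_cancel₀, sub_self]
      exact_mod_cast h.ne'
  · intro a b hab
    obtain ⟨x, hx⟩ := (hrange (Matrix.single a b 1)).2 (Matrix.trace_single_eq_of_ne a b _ hab)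
    exact ⟨x, by simp [hx]⟩
  · intro a b x hab h0 h
    apply hinj
    ext a' b'
    rw [map_zero, Matrix.zero_apply]
    by_contra hne
    obtain ⟨rfl, rfl⟩ := hsingle hab h a' b' hne
    exact hne h0
  · intro a b d x y hab hbd had hx hy hxab hybd
    have hx' := hsingle hab hx
    have hy' := hsingle hbd hy
    rw [hlie, Matrix.sub_apply, Matrix.mul_apply, Matrix.mul_apply,
      Finset.sum_eq_single b, Finset.sum_eq_zero]
    · simpa using ⟨hxab, hybd⟩
    · intro t _
      by_contra hne
      exact hab (hy' _ _ (left_ne_zero_of_mul hne)).1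
    · intro t _ ht
      by_contra hne
      exact ht (hx' _ _ (left_ne_zero_of_mul hne)).2
    · simp
  · intro a b x y hab hx hy hxab hyba
    have hx' := hsingle hab hx
    have hy' := hsingle hab.symm hy
    have haa : ρ ⁅x, y⁆ a a = ρ x a b * ρ y b a := by
      rw [hlie, Matrix.sub_apply, Matrix.mul_apply, Matrix.mul_apply,
        Finset.sum_eq_single b, Finset.sum_eq_zero, sub_zero]
      · intro t _
        by_contra hne
        exact hab (hy' _ _ (left_ne_zero_of_mul hne)).1
      · intro t _ ht
        by_contra hne
        exact ht (hx' _ _ (left_ne_zero_of_mul hne)).2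
      · simp
    have hbb : ρ ⁅x, y⁆ b b = -(ρ x a b * ρ y b a) := by
      rw [hlie, Matrix.sub_apply, Matrix.mul_apply, Matrix.mul_apply,
        Finset.sum_eq_zero, Finset.sum_eq_single a, zero_sub, mul_comm]
      · intro t _ ht
        by_contra hne
        exact ht (hy' _ _ (left_ne_zero_of_mul hne)).2
      · simp
      · intro t _
        by_contra hne
        exact hab (hx' _ _ (left_ne_zero_of_mul hne)).1.symm
    rw [haa, hbb, ne_eq, self_eq_neg]
    exact mul_ne_zero hxab hyba
  · intro x h0 hs
    apply hinj
    have htr : (ρ x).trace = 0 := (hrange _).1 ⟨x, rfl⟩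
    ext a b
    rw [map_zero, Matrix.zero_apply]
    by_cases hab : a = b
    · subst hab
      rw [Matrix.trace, Finset.sum_congr rfl (fun i _ => show (ρ x).diag i = ρ x a a from hs i a),
        Finset.sum_const, Finset.card_univ, Fintype.card_fin, nsmul_eq_mul] at htr
      refine (mul_eq_zero.1 htr).resolve_left ?_
      have := a.pos
      exact_mod_cast this.ne'
    · exact h0 a b hab

/-- The entrywise description of the symplectic algebra. -/
def IsSpMatrix {r : ℕ} (A : Matrix (Fin r ⊕ Fin r) (Fin r ⊕ Fin r) k) : Prop :=
  ∀ a b, A b.swap a.swap = -(spSign a * spSign b : ℤ) * A a b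

omit [CharZero k] in
theorem isSpMatrix_diagonal {r : ℕ} {d : Fin r ⊕ Fin r → k} (hd : ∀ a, d a.swap = -d a) :
    IsSpMatrix (Matrix.diagonal d) := by
  intro a b
  by_cases hab : a = b
  · subst hab
    simp [hd, spSign_mul_self]
  · rw [Matrix.diagonal_apply_ne _ hab, Matrix.diagonal_apply_ne, mul_zero]
    intro h
    exact hab (by simpa using congrArg Sum.swap h.symm)

/-- The elementary element of the symplectic algebra with a nonzero entry at `(a, b)`. -/
def spSingle {r : ℕ} (k : Type*) [Field k] (a b : Fin r ⊕ Fin r) :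
    Matrix (Fin r ⊕ Fin r) (Fin r ⊕ Fin r) k :=
  Matrix.single a b 1 - ((spSign a * spSign b : ℤ) : k) • Matrix.single b.swap a.swap 1

theorem isSpMatrix_spSingle {r : ℕ} (a b : Fin r ⊕ Fin r) : IsSpMatrix (spSingle k a b) := by
  intro a' b'
  simp only [spSingle, Matrix.sub_apply, Matrix.smul_apply, Matrix.single_apply, smul_eq_mul]
  rcases a with a | a <;> rcases b with b | b <;> rcases a' with a' | a' <;>
    rcases b' with b' | b' <;> simp [spSign] <;> grind

theorem spSingle_apply_ne_zero {r : ℕ} (a b : Fin r ⊕ Fin r) : spSingle k a b a b ≠ 0 := by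
  rcases a with a | a <;> rcases b with b | b <;>
    simp [spSingle, spSign, Matrix.single_apply] <;> split_ifs <;> norm_num

omit [CharZero k] in
theorem spSingle_support {r : ℕ} {a b a' b' : Fin r ⊕ Fin r} (h : spSingle k a b a' b' ≠ 0) :
    (a' = a ∧ b' = b) ∨ (a' = b.swap ∧ b' = a.swap) := by
  by_contra hcon
  push Not at hcon
  refine h ?_
  rw [spSingle, Matrix.sub_apply, Matrix.smul_apply, Matrix.single_apply, Matrix.single_apply,
    if_neg, if_neg]
  · simp
  · rintro ⟨h1, h2⟩; exact hcon.2 h1.symm h2.symm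
  · rintro ⟨h1, h2⟩; exact hcon.1 h1.symm h2.symm

/-- A root now occupies the positions `(a, b)` and `(b.swap, a.swap)`, whose entries agree up to
sign. Hence root spaces are still lines, and a given row meets a root in at most one column. -/
theorem isRootRep_sp {r : ℕ} (ρ : L →ₗ[k] Matrix (Fin r ⊕ Fin r) (Fin r ⊕ Fin r) k)
    (hinj : Function.Injective ρ) (hlie : ∀ x y, ρ ⁅x, y⁆ = ρ x * ρ y - ρ y * ρ x)
    (hrange : ∀ A, (∃ x, ρ x = A) ↔ IsSpMatrix A) :
    ∃ c : Fin r ⊕ Fin r → k, IsRootRep ρ c ∧ ∀ a b a' b', a ≠ b → c a' - c b' = c a - c b →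
      (a' = a ∧ b' = b) ∨ (a' = b.swap ∧ b' = a.swap) := by
  set c : Fin r ⊕ Fin r → k := fun a => (spWeight a : ℤ)
  have hc : ∀ a b a' b', a ≠ b → c a' - c b' = c a - c b →
      (a' = a ∧ b' = b) ∨ (a' = b.swap ∧ b' = a.swap) := by
    intro a b a' b' hab h
    refine spWeight_sub_eq hab ?_
    simp only [c] at h
    exact_mod_cast h
  have hcne : ∀ a, c a.swap ≠ c a := by
    intro a h
    rcases hc a a.swap a.swap a (swap_ne a).symm (by rw [h]) with h | h
    · exact swap_ne a h.1
    · simp only [Sum.swap_swap] at h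
      exact swap_ne a h.1
  have hsym : ∀ x, IsSpMatrix (ρ x) := fun x => (hrange _).1 ⟨x, rfl⟩
  have hsupp : ∀ {a b x}, a ≠ b → (∀ a' b', ρ x a' b' ≠ 0 → c a' - c b' = c a - c b) →
      ∀ a' b', ρ x a' b' ≠ 0 → (a' = a ∧ b' = b) ∨ (a' = b.swap ∧ b' = a.swap) :=
    fun hab h a' b' h' => hc _ _ _ _ hab (h a' b' h')
  have hrow : ∀ {a b x}, a ≠ b → (∀ a' b', ρ x a' b' ≠ 0 → c a' - c b' = c a - c b) →
      ∀ t, ρ x a t ≠ 0 → t = b := by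
    intro a b x hab h t ht
    rcases hsupp hab h _ _ ht with h | h
    · exact h.2
    · rw [h.2, h.1, Sum.swap_swap]
  refine ⟨c, ?_, hc⟩
  refine
    { injective := hinj
      map_lie := hlie
      weight_injective := ?_
      exists_diagonal := ?_
      exists_ne_zero := ?_
      line := ?_
      lie_ne_zero := ?_
      coroot := ?_
      scalar := ?_ }
  · intro a b hab
    by_contra hne
    rcases hc a b a a hne (by rw [hab]) with h | h
    · exact hne h.2
    · exact swap_ne a h.2.symm
  · rw [hrange]
    refine isSpMatrix_diagonal fun a => ?_
    simp [c, spWeight_swap]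
  · intro a b _
    obtain ⟨x, hx⟩ := (hrange (spSingle k a b)).2 (isSpMatrix_spSingle a b)
    exact ⟨x, by rw [hx]; exact spSingle_apply_ne_zero a b⟩
  · intro a b x hab h0 h
    apply hinj
    ext a' b'
    rw [map_zero, Matrix.zero_apply]
    by_contra hne
    rcases hsupp hab h a' b' hne with ⟨rfl, rfl⟩ | ⟨rfl, rfl⟩
    · exact hne h0
    · rw [hsym x a b, h0, mul_zero] at hne
      exact hne rfl
  · intro a b d x y hab hbd had hx hy hxab hybd
    have h1 : (ρ x * ρ y) a d = ρ x a b * ρ y b d := by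
      rw [Matrix.mul_apply, Finset.sum_eq_single b]
      · intro t _ ht
        by_contra hne
        exact ht (hrow hab hx t (left_ne_zero_of_mul hne))
      · simp
    -- For a long root both products contribute to the entry. The signs make the contributions add
    -- rather than cancel, so the entry is twice a nonzero product.
    by_cases hd : a = d.swap
    · have h2 : (ρ y * ρ x) a d = -(ρ x a b * ρ y b d) := by
        rw [Matrix.mul_apply, Finset.sum_eq_single b.swap]
        · subst hd
          rw [hsym y b d]
          have : ρ x b.swap d = -(spSign d.swap * spSign b : ℤ) * ρ x d.swap b := by
            rw [← hsym x d.swap b, Sum.swap_swap]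
          rw [this, spSign_swap]
          have h3 : ((spSign b : ℤ) : k) * spSign b = 1 := by
            exact_mod_cast spSign_mul_self b
          have h4 : ((spSign d : ℤ) : k) * spSign d = 1 := by
            exact_mod_cast spSign_mul_self d
          push_cast
          linear_combination (-(ρ x d.swap b * ρ y b d)) * (spSign d * spSign d) * h3 -
            (ρ x d.swap b * ρ y b d) * h4
        · intro t _ ht
          by_contra hne
          rcases hsupp hbd hy _ _ (left_ne_zero_of_mul hne) with h | h
          · exact hab h.1
          · exact ht h.2
        · simp
      rw [hlie, Matrix.sub_apply, h1, h2, sub_neg_eq_add, ← two_mul]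
      exact mul_ne_zero two_ne_zero (mul_ne_zero hxab hybd)
    · have h2 : (ρ y * ρ x) a d = 0 := by
        rw [Matrix.mul_apply]
        refine Finset.sum_eq_zero fun t _ => ?_
        by_contra hne
        rcases hsupp hbd hy _ _ (left_ne_zero_of_mul hne) with h | h
        · exact hab h.1
        · exact hd h.1
      rw [hlie, Matrix.sub_apply, h1, h2, sub_zero]
      exact mul_ne_zero hxab hybd
  · intro a b x y hab hx hy hxab hyba
    have hnex : ∀ t, ρ x b t = 0 := by
      intro t
      by_contra hne
      rcases hsupp hab hx _ _ hne with h | h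
      · exact hab h.1.symm
      · exact swap_ne b h.1.symm
    have hney : ∀ t, ρ y a t = 0 := by
      intro t
      by_contra hne
      rcases hsupp hab.symm hy _ _ hne with h | h
      · exact hab h.1
      · exact swap_ne a h.1.symm
    have haa : ρ ⁅x, y⁆ a a = ρ x a b * ρ y b a := by
      rw [hlie, Matrix.sub_apply, Matrix.mul_apply, Matrix.mul_apply,
        Finset.sum_eq_single b, Finset.sum_eq_zero, sub_zero]
      · intro t _
        rw [hney, zero_mul]
      · intro t _ ht
        by_contra hne
        exact ht (hrow hab hx t (left_ne_zero_of_mul hne))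
      · simp
    have hbb : ρ ⁅x, y⁆ b b = -(ρ x a b * ρ y b a) := by
      rw [hlie, Matrix.sub_apply, Matrix.mul_apply, Matrix.mul_apply,
        Finset.sum_eq_zero, Finset.sum_eq_single a, zero_sub, mul_comm]
      · intro t _ ht
        by_contra hne
        exact ht (hrow hab.symm hy t (left_ne_zero_of_mul hne))
      · simp
      · intro t _
        rw [hnex, zero_mul]
    rw [haa, hbb, ne_eq, self_eq_neg]
    exact mul_ne_zero hxab hyba
  · intro x h0 hs
    apply hinj
    ext a b
    rw [map_zero, Matrix.zero_apply]
    by_cases hab : a = b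
    · subst hab
      have h1 := hsym x a a
      rw [spSign_mul_self, hs a.swap a, Int.cast_one, neg_one_mul, self_eq_neg] at h1
      exact h1
    · exact h0 a b hab

end Concrete

/-! ### Dimensions as numbers of positions -/

section Counting

/-- A space of matrices is determined by a set `S` of positions as soon as its elements are
determined by their entries in `S` and there are elements with a single nonzero entry in `S`. -/
theorem finrank_eq_card_positions {k M ι : Type*} [Field k] [AddCommGroup M] [Module k M]
    (φ : M →ₗ[k] Matrix ι ι k) (S : Finset (ι × ι))
    (h1 : ∀ x, (∀ s ∈ S, φ x s.1 s.2 = 0) → x = 0)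
    (h2 : ∀ s ∈ S, ∃ x, φ x s.1 s.2 ≠ 0 ∧ ∀ t ∈ S, φ x t.1 t.2 ≠ 0 → t = s) :
    finrank k M = S.card := by
  classical
  let ψ : M →ₗ[k] (S → k) :=
    LinearMap.pi fun s => (LinearMap.proj s.1.2).comp ((LinearMap.proj s.1.1).comp φ)
  have hψ : ∀ x s, ψ x s = φ x s.1.1 s.1.2 := fun _ _ => rfl
  have hinj : Function.Injective ψ := by
    rw [injective_iff_map_eq_zero]
    intro x hx
    exact h1 x fun s hs => congrFun hx ⟨s, hs⟩
  have hsurj : Function.Surjective ψ := by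
    intro g
    choose! X hX hX' using h2
    refine ⟨∑ s : S, (g s / φ (X s) s.1.1 s.1.2) • X s, ?_⟩
    funext t
    rw [map_sum, Finset.sum_apply, Finset.sum_eq_single t]
    · rw [map_smul, Pi.smul_apply, hψ, smul_eq_mul, div_mul_cancel₀ _ (hX t t.2)]
    · intro s _ hst
      rw [map_smul, Pi.smul_apply, hψ]
      by_cases h : φ (X s) t.1.1 t.1.2 = 0
      · rw [h, smul_zero]
      · exact absurd (Subtype.ext (hX' s s.2 t t.2 h)).symm hst
    · simp
  rw [(LinearEquiv.ofBijective ψ ⟨hinj, hsurj⟩).finrank_eq, finrank_fintype_fun_eq_card,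
    Fintype.card_coe]

theorem card_fin_between {n u v : ℕ} (hv : v ≤ n) :
    (Finset.univ.filter fun i : Fin n => u ≤ i ∧ (i : ℕ) < v).card = v - u := by
  rw [← Nat.card_Ico u v]
  refine Finset.card_bij (fun i _ => (i : ℕ)) ?_ ?_ ?_
  · intro i hi
    simpa using hi
  · intro i _ j _ h
    exact Fin.ext h
  · intro t ht
    rw [Finset.mem_Ico] at ht
    exact ⟨⟨t, by omega⟩, by simpa using ht, rfl⟩

/-- Split all pairs by comparing blocks. Transposition matches the two strict cases, and equality
contributes one square for each block. -/
theorem two_mul_card_lt_add {α : Type*} [Fintype α] [DecidableEq α] {m : ℕ} (g : α → Fin m) :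
    2 * (Finset.univ.filter fun s : α × α => g s.1 < g s.2).card +
      ∑ i, (Finset.univ.filter fun a => g a = i).card ^ 2 = Fintype.card α ^ 2 := by
  have h1 : (Finset.univ.filter fun s : α × α => g s.2 < g s.1).card =
      (Finset.univ.filter fun s : α × α => g s.1 < g s.2).card := by
    refine Finset.card_bij (fun s _ => s.swap) ?_ ?_ ?_
    · simp
    · intro s _ t _ h
      exact Prod.swap_injective h
    · intro s hs
      exact ⟨s.swap, by simpa using hs, by simp⟩
  have h2 : (Finset.univ.filter fun s : α × α => g s.1 = g s.2).card =
      ∑ i, (Finset.univ.filter fun a => g a = i).card ^ 2 := by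
    rw [Finset.card_eq_sum_card_fiberwise (f := fun s => g s.1) (t := Finset.univ)
      (fun _ _ => Finset.mem_coe.2 (Finset.mem_univ _))]
    refine Finset.sum_congr rfl fun i _ => ?_
    rw [sq, ← Finset.card_product]
    congr 1
    ext s
    simp only [Finset.mem_filter, Finset.mem_univ, true_and, Finset.mem_product]
    constructor
    · rintro ⟨h, h'⟩; exact ⟨h', h ▸ h'⟩
    · rintro ⟨h, h'⟩; exact ⟨h.trans h'.symm, h⟩
  have h3 := Finset.card_filter_add_card_filter_not (s := (Finset.univ : Finset (α × α)))
    (fun s => g s.1 < g s.2)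
  have h4 := Finset.card_filter_add_card_filter_not
    (s := Finset.univ.filter fun s : α × α => ¬ g s.1 < g s.2) (fun s => g s.1 = g s.2)
  rw [Finset.filter_filter, Finset.filter_filter] at h4
  have h5 : (Finset.univ.filter fun s : α × α => ¬ g s.1 < g s.2 ∧ g s.1 = g s.2) =
      Finset.univ.filter fun s : α × α => g s.1 = g s.2 := by
    ext s; simp only [Finset.mem_filter, Finset.mem_univ, true_and]
    exact ⟨fun h => h.2, fun h => ⟨h.not_lt, h⟩⟩
  have h6 : (Finset.univ.filter fun s : α × α => ¬ g s.1 < g s.2 ∧ ¬ g s.1 = g s.2) =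
      Finset.univ.filter fun s : α × α => g s.2 < g s.1 := by
    ext s; simp only [Finset.mem_filter, Finset.mem_univ, true_and]
    constructor
    · rintro ⟨h, h'⟩; exact lt_of_le_of_ne (not_lt.1 h) fun h'' => h' h''.symm
    · intro h; exact ⟨h.not_gt, h.ne'⟩
  rw [Finset.card_univ, Fintype.card_prod] at h3
  rw [h5, h6, h1, h2] at h4
  rw [sq]
  omega

theorem two_mul_card_le_fiber {α : Type*} [LinearOrder α] (T : Finset α) :
    2 * ((T ×ˢ T).filter fun s => s.1 ≤ s.2).card = T.card * (T.card + 1) := by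
  have h1 : ((T ×ˢ T).filter fun s => s.2 ≤ s.1).card =
      ((T ×ˢ T).filter fun s => s.1 ≤ s.2).card := by
    refine Finset.card_bij (fun s _ => s.swap) ?_ ?_ ?_
    · simp +contextual
    · intro s _ t _ h
      exact Prod.swap_injective h
    · intro s hs
      refine ⟨s.swap, ?_, by simp⟩
      simp only [Finset.mem_filter, Finset.mem_product] at hs ⊢
      exact ⟨⟨hs.1.2, hs.1.1⟩, hs.2⟩
  have h2 := Finset.card_union_add_card_inter ((T ×ˢ T).filter fun s => s.1 ≤ s.2)
    ((T ×ˢ T).filter fun s => s.2 ≤ s.1)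
  have h3 : ((T ×ˢ T).filter fun s => s.1 ≤ s.2) ∪ ((T ×ˢ T).filter fun s => s.2 ≤ s.1) =
      T ×ˢ T := by
    rw [← Finset.filter_or]
    exact Finset.filter_true_of_mem fun s _ => le_total _ _
  have h4 : ((T ×ˢ T).filter fun s => s.1 ≤ s.2) ∩ ((T ×ˢ T).filter fun s => s.2 ≤ s.1) =
      T.diag := by
    ext s
    simp only [Finset.mem_inter, Finset.mem_filter, Finset.mem_product, Finset.mem_diag]
    constructor
    · rintro ⟨⟨h, h'⟩, -, h''⟩; exact ⟨h.1, le_antisymm h' h''⟩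
    · rintro ⟨h, h'⟩; exact ⟨⟨⟨h, h' ▸ h⟩, h'.le⟩, ⟨h, h' ▸ h⟩, h'.ge⟩
  rw [h3, h4, Finset.card_product, Finset.diag_card, h1] at h2
  linarith

/-- Monotonicity makes `g s.1 < g s.2` imply `s.1 ≤ s.2`. What remains are the ordered pairs inside
each block below `m`, a triangular number for each. In type C this surplus is the index. -/
theorem sum_card_fiber_sq_of_monotone {r m : ℕ} (g : Fin r → ℕ) (hg : Monotone g) :
    2 * (Finset.univ.filter fun s : Fin r × Fin r =>
      s.1 ≤ s.2 ∧ (g s.1 < g s.2 ∨ g s.2 < m)).card =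
    2 * (Finset.univ.filter fun s : Fin r × Fin r => g s.1 < g s.2).card +
      ∑ t ∈ Finset.range m, (Finset.univ.filter fun i => g i = t).card *
        ((Finset.univ.filter fun i => g i = t).card + 1) := by
  have h1 : (Finset.univ.filter fun s : Fin r × Fin r =>
      s.1 ≤ s.2 ∧ (g s.1 < g s.2 ∨ g s.2 < m)).card =
      (Finset.univ.filter fun s : Fin r × Fin r => g s.1 < g s.2).card +
      (Finset.univ.filter fun s : Fin r × Fin r => s.1 ≤ s.2 ∧ g s.1 = g s.2 ∧ g s.2 < m).card := by
    rw [← Finset.card_union_of_disjoint]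
    · congr 1
      ext s
      simp only [Finset.mem_filter, Finset.mem_univ, true_and, Finset.mem_union]
      have hmono : s.1 ≤ s.2 → g s.1 ≤ g s.2 := fun h => hg h
      have hanti : s.2 ≤ s.1 → g s.2 ≤ g s.1 := fun h => hg h
      constructor
      · rintro ⟨h, h' | h'⟩
        · exact Or.inl h'
        · rcases (hmono h).lt_or_eq with h'' | h''
          · exact Or.inl h''
          · exact Or.inr ⟨h, h'', h'⟩
      · rintro (h | h)
        · refine ⟨?_, Or.inl h⟩
          by_contra hcon
          exact absurd (hanti (not_le.1 hcon).le) (not_le.2 h)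
        · exact ⟨h.1, Or.inr h.2.2⟩
    · rw [Finset.disjoint_filter]
      rintro s _ h ⟨-, h', -⟩
      omega
  rw [h1, mul_add]
  congr 1
  rw [Finset.card_eq_sum_card_fiberwise (f := fun s => g s.2) (t := Finset.range m), Finset.mul_sum]
  · refine Finset.sum_congr rfl fun t ht => ?_
    rw [← two_mul_card_le_fiber]
    congr 2
    ext s
    simp only [Finset.mem_filter, Finset.mem_univ, true_and, Finset.mem_product]
    rw [Finset.mem_range] at ht
    constructor
    · rintro ⟨⟨h, h', h''⟩, rfl⟩; exact ⟨⟨h', rfl⟩, h⟩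
    · rintro ⟨⟨h, h'⟩, h''⟩; exact ⟨⟨h'', h.trans h'.symm, h' ▸ ht⟩, h'⟩
  · intro s hs
    simp only [Finset.coe_filter, Finset.mem_univ, true_and, Set.mem_ofPred_eq] at hs
    simpa using hs.2.2

end Counting

/-! ### Commutative ideals supported on a block -/

namespace IsRootRep

section BlockIdeal

variable {k L ι : Type*} [Field k] [LieRing L] [LieAlgebra k L] [Fintype ι] [DecidableEq ι]
  {ρ : L →ₗ[k] Matrix ι ι k} {c : ι → k}

/-- The elements of an ideal of strictly block upper triangular matrices that map into the span of
the basis vectors that satisfy `X` and kill that span. -/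
def blockIdeal (R : IsRootRep ρ c) {q : LieSubalgebra k L} (N : LieIdeal k q) {blk : ι → ℕ}
    (hN : ∀ x ∈ N, ∀ a b, ρ x a b ≠ 0 → blk a < blk b) (X : ι → Prop)
    (hX : ∀ a b, blk a < blk b → X b → X a) : LieIdeal k N where
  carrier := {x | ∀ a b, ρ x a b ≠ 0 → X a ∧ ¬ X b}
  add_mem' := by
    intro x y hx hy a b h
    by_cases h' : ρ x a b = 0
    · refine hy a b fun h'' => h ?_
      simp [h', h'']
    · exact hx a b h'
  zero_mem' := by intro a b h; simp at h
  smul_mem' := by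
    intro t x hx a b h
    refine hx a b fun h' => h ?_
    simp [h']
  lie_mem := by
    intro x y hy a b h
    rw [show ((⁅x, y⁆ : N) : L) = ⁅(x : L), (y : L)⁆ from rfl, R.map_lie] at h
    by_contra hcon
    refine h ?_
    rw [Matrix.sub_apply, Matrix.mul_apply, Matrix.mul_apply, ← Finset.sum_sub_distrib]
    refine Finset.sum_eq_zero fun t _ => ?_
    rw [sub_eq_zero]
    have h1 : ρ x a t * ρ y t b = 0 := by
      by_contra hne
      have h1 := hN x x.2 _ _ (left_ne_zero_of_mul hne)
      have h2 := hy _ _ (right_ne_zero_of_mul hne)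
      exact hcon ⟨hX _ _ h1 h2.1, h2.2⟩
    have h2 : ρ y a t * ρ x t b = 0 := by
      by_contra hne
      have h1 := hy _ _ (left_ne_zero_of_mul hne)
      have h2 := hN x x.2 _ _ (right_ne_zero_of_mul hne)
      exact hcon ⟨h1.1, fun h => h1.2 (hX _ _ h2 h)⟩
    rw [h1, h2]

/-- Even the associative products vanish: the middle index would have to satisfy both `X` and its
negation. -/
theorem lie_eq_zero_of_mem_blockIdeal (R : IsRootRep ρ c) {q : LieSubalgebra k L}
    {N : LieIdeal k q} {blk : ι → ℕ} {hN : ∀ x ∈ N, ∀ a b, ρ x a b ≠ 0 → blk a < blk b} {X : ι → Prop}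
    {hX : ∀ a b, blk a < blk b → X b → X a} :
    ∀ x ∈ R.blockIdeal N hN X hX, ∀ y ∈ R.blockIdeal N hN X hX, ⁅x, y⁆ = 0 := by
  intro x hx y hy
  have hzero : ∀ x ∈ R.blockIdeal N hN X hX, ∀ y ∈ R.blockIdeal N hN X hX, ρ x * ρ y = 0 := by
    intro x hx y hy
    ext a b
    rw [Matrix.mul_apply]
    refine Finset.sum_eq_zero fun t _ => ?_
    by_contra hne
    exact (hx _ _ (left_ne_zero_of_mul hne)).2 (hy _ _ (right_ne_zero_of_mul hne)).1
  apply Subtype.ext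
  apply Subtype.ext
  apply R.injective
  rw [show ((⁅x, y⁆ : N) : L) = ⁅(x : L), (y : L)⁆ from rfl, R.map_lie, hzero x hx y hy,
    hzero y hy x hx, sub_zero]
  simp

end BlockIdeal

end IsRootRep

theorem single_one_mul_apply {k ι : Type*} [Field k] [Fintype ι] [DecidableEq ι] (i j a b : ι)
    (A : Matrix ι ι k) : ((Matrix.single i j 1 : Matrix ι ι k) * A) a b = if i = a then A j b else 0 := by
  rw [Matrix.mul_apply, Finset.sum_eq_single j]
  · simp [Matrix.single_apply]
  · intro t _ ht
    simp [ht.symm]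
  · simp

theorem mul_single_one_apply {k ι : Type*} [Field k] [Fintype ι] [DecidableEq ι] (i j a b : ι)
    (A : Matrix ι ι k) : (A * (Matrix.single i j 1 : Matrix ι ι k)) a b = if j = b then A a i else 0 := by
  rw [Matrix.mul_apply, Finset.sum_eq_single i]
  · simp [Matrix.single_apply]
  · intro t _ ht
    simp [ht.symm]
  · simp

/-! ### The antidiagonal form in type A -/

section TypeA

variable {k L : Type*} [Field k] [CharZero k] [LieRing L] [LieAlgebra k L] [FiniteDimensional k L]

/-- `hleft` and `hright` are what is used of the choice of `p`: no entry of `N` has both indices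
between `p` and `n - p`, where the form `f` sees nothing. -/
theorem exists_cpIdeal_sl {n : ℕ} {ρ : L →ₗ[k] Matrix (Fin n) (Fin n) k} {c : Fin n → k}
    (R : IsRootRep ρ c) (hrange : ∀ A, (∃ x, ρ x = A) ↔ A.trace = 0)
    {q : LieSubalgebra k L} {m : ℕ} (blk : Fin n → Fin m) (hblk : Monotone blk)
    (hq : ∀ x, x ∈ q ↔ ∀ a b, ρ x a b ≠ 0 → blk a ≤ blk b) {N : LieIdeal k q}
    (hN : ∀ x : q, x ∈ N ↔ ∀ a b, ρ x a b ≠ 0 → blk a < blk b) (p : ℕ) (hp : p ≤ n)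
    (hpblk : ∀ a b : Fin n, (a : ℕ) < p → p ≤ b → blk a < blk b)
    (hleft : ∀ a b : Fin n, blk a < blk b → n - p ≤ a → (b : ℕ) < p → False)
    (hright : ∀ a b : Fin n, blk a < blk b → p ≤ a → (b : ℕ) < n - p → False) :
    (∃ P : LieIdeal k N, IsCPIdeal k P ∧
      ∀ x, x ∈ P ↔ ∀ a b, ρ x a b ≠ 0 → (a : ℕ) < p ∧ p ≤ b) ∧
    lieIndex k N + (Finset.univ.filter fun s : Fin n × Fin n => blk s.1 < blk s.2).card =
      2 * (p * (n - p)) := by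
  have hlt : ∀ {a b}, blk a < blk b → a < b := fun h => by
    by_contra hcon
    exact absurd (hblk (not_lt.1 hcon)) (not_le.2 h)
  have hN' : ∀ x ∈ N, ∀ a b, ρ x a b ≠ 0 → (blk a : ℕ) < blk b := fun x hx => (hN x).1 hx
  let P := R.blockIdeal N hN' (fun a => (a : ℕ) < p) (fun a b h hb =>
    lt_trans (Fin.lt_def.1 (hlt h)) hb)
  have hP : ∀ x, x ∈ P ↔ ∀ a b, ρ x a b ≠ 0 → (a : ℕ) < p ∧ p ≤ b := by
    intro x
    refine forall_congr' fun a => forall_congr' fun b => imp_congr_right fun _ => ?_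
    exact and_congr_right fun _ => not_lt
  have hsingle : ∀ i j, blk i < blk j → ∃ y : N, ρ y = Matrix.single i j 1 := by
    intro i j hij
    obtain ⟨y, hy⟩ := (hrange (Matrix.single i j 1)).2
      (Matrix.trace_single_eq_of_ne i j _ (hlt hij).ne)
    have hs : ∀ a b, ρ y a b ≠ 0 → blk a < blk b := by
      intro a b hab
      rw [hy, Matrix.single_apply] at hab
      split_ifs at hab with h
      · rw [← h.1, ← h.2]; exact hij
      · exact absurd rfl hab
    exact ⟨⟨⟨y, (hq y).2 fun a b h => (hs a b h).le⟩, (hN _).2 hs⟩, hy⟩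
  -- These are the rows in which the antidiagonal meets the upper right block, so that `f` has
  -- maximal rank there.
  let s := min p (n - p)
  let f : Dual k N := ∑ i ∈ Finset.univ.filter (fun i : Fin n => (i : ℕ) < s),
    (LinearMap.proj i.rev).comp ((LinearMap.proj i).comp
      (ρ.comp (q.toSubmodule.subtype.comp N.toSubmodule.subtype)))
  have hf : ∀ x, f x = ∑ i ∈ Finset.univ.filter (fun i : Fin n => (i : ℕ) < s), ρ x i i.rev := by
    intro x
    simp only [f, LinearMap.sum_apply]
    rfl
  have hortho : ∀ x, (∀ y ∈ P, f ⁅y, x⁆ = 0) → x ∈ P := by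
    intro x hx
    have hstrict := hN' x x.2
    -- This is `f [E_ij, x] = 0` written out: it compares an entry of `x` in one diagonal corner
    -- with its reflection in the other.
    have hrel : ∀ i j : Fin n, (i : ℕ) < p → p ≤ j →
        (if (i : ℕ) < s then ρ x j i.rev else 0) =
          if (j.rev : ℕ) < s then ρ x j.rev i else 0 := by
      intro i j hi hj
      obtain ⟨y, hy⟩ := hsingle i j (hpblk i j hi hj)
      have hyP : y ∈ P := by
        rw [hP]
        intro a b hab
        rw [hy, Matrix.single_apply] at hab
        split_ifs at hab with h
        · rw [← h.1, ← h.2]; exact ⟨hi, hj⟩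
        · exact absurd rfl hab
      have h0 := hx y hyP
      rw [hf] at h0
      simp only [show ((⁅y, x⁆ : N) : L) = ⁅(y : L), (x : L)⁆ from rfl, R.map_lie, hy,
        Matrix.sub_apply, single_one_mul_apply, mul_single_one_apply, Finset.sum_sub_distrib] at h0
      rw [sub_eq_zero, Finset.sum_ite_eq, Finset.sum_filter, Finset.sum_eq_single j.rev] at h0
      · simpa using h0
      · intro t _ ht
        rw [if_neg (show ¬ j = t.rev from ?_), ite_self]
        rintro rfl
        exact ht (Fin.rev_rev t).symm
      · simp
    rw [hP]
    intro a b hab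
    have hblkab := hstrict a b hab
    have hab' : a < b := hlt hblkab
    have hz : ∀ a' b' : Fin n, b' < a' → ρ x a' b' = 0 := by
      intro a' b' h
      by_contra hne
      exact absurd (hlt (hstrict a' b' hne)) h.not_gt
    have han := a.2
    have hbn := b.2
    have harev := Fin.val_rev a
    have hbrev := Fin.val_rev b
    have hab'' : (a : ℕ) < b := hab'
    have hrl : b.rev < a.rev := Fin.rev_lt_rev.2 hab'
    rcases lt_or_ge (b : ℕ) p with hbp | hbp
    -- For `a < s`, `hrel` relates the entry at `(a, b)` to the one at `(a.rev, b.rev)`, which lies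
    -- below the diagonal and vanishes. Otherwise `s = n - p`, and both indices lie between `n - p`
    -- and `p`.
    · exfalso
      rcases lt_or_ge (a : ℕ) s with has | has
      · have h1 : (a : ℕ) < n - p := lt_of_lt_of_le has (min_le_right _ _)
        have h0 := hrel b a.rev hbp (by omega)
        rw [Fin.rev_rev, if_pos has, hz _ _ hrl, ite_self] at h0
        exact hab h0.symm
      · refine hleft a b hblkab ?_ hbp
        rcases min_choice p (n - p) with h | h
        · have : s = p := h
          omega
        · have : s = n - p := h
          omega
    · refine ⟨?_, hbp⟩
      by_contra hap
      rcases lt_or_ge (b.rev : ℕ) s with hbs | hbs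
      · have h1 : (b.rev : ℕ) < p := lt_of_lt_of_le hbs (min_le_left _ _)
        have h0 := hrel b.rev a h1 (not_lt.1 hap)
        rw [Fin.rev_rev, if_pos hbs, hz _ _ hrl, ite_self] at h0
        exact hab h0
      · refine hright a b hblkab (not_lt.1 hap) ?_
        rcases min_choice p (n - p) with h | h
        · have : s = p := h
          omega
        · have : s = n - p := h
          omega
  obtain ⟨hcp, hindex⟩ := isCPIdeal_and_lieIndex P R.lie_eq_zero_of_mem_blockIdeal f hortho
  refine ⟨⟨P, hcp, hP⟩, ?_⟩
  have hdimN : finrank k N =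
      (Finset.univ.filter fun s : Fin n × Fin n => blk s.1 < blk s.2).card := by
    refine finrank_eq_card_positions
      (ρ.comp (q.toSubmodule.subtype.comp N.toSubmodule.subtype)) _ ?_ ?_
    · intro x hx
      apply Subtype.ext
      apply Subtype.ext
      apply R.injective
      ext a b
      by_contra hne
      have hne' : ρ x a b ≠ 0 := by simpa using hne
      exact hne' (hx (a, b) (by simpa using hN' x x.2 a b hne'))
    · rintro ⟨i, j⟩ hij
      obtain ⟨y, hy⟩ := hsingle i j (by simpa using hij)
      have hy' : ∀ a b, (ρ.comp (q.toSubmodule.subtype.comp N.toSubmodule.subtype)) y a b =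
        Matrix.single i j (1 : k) a b := fun a b => by rw [← hy]; rfl
      refine ⟨y, by rw [hy']; simp, ?_⟩
      rintro ⟨a, b⟩ _ hab
      rw [hy', Matrix.single_apply] at hab
      split_ifs at hab with h
      · rw [h.1, h.2]
      · exact absurd rfl hab
  have hdimP : finrank k P = p * (n - p) := by
    have hcard : ((Finset.univ.filter fun i : Fin n => 0 ≤ (i : ℕ) ∧ (i : ℕ) < p) ×ˢ
        (Finset.univ.filter fun i : Fin n => p ≤ (i : ℕ) ∧ (i : ℕ) < n)).card = p * (n - p) := by
      rw [Finset.card_product, card_fin_between hp, card_fin_between le_rfl, Nat.sub_zero]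
    rw [← hcard]
    refine finrank_eq_card_positions ((ρ.comp (q.toSubmodule.subtype.comp
      N.toSubmodule.subtype)).comp P.toSubmodule.subtype) _ ?_ ?_
    · intro x hx
      apply Subtype.ext
      apply Subtype.ext
      apply Subtype.ext
      apply R.injective
      ext a b
      by_contra hne
      have hne' : ρ (x : N) a b ≠ 0 := by simpa using hne
      have := (hP x).1 x.2 a b hne'
      exact hne' (hx (a, b) (by simpa using this))
    · rintro ⟨i, j⟩ hij
      have hij' : (i : ℕ) < p ∧ p ≤ j := by simpa using hij
      obtain ⟨y, hy⟩ := hsingle i j (hpblk i j hij'.1 hij'.2)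
      have hs : ∀ a b, ρ y a b ≠ 0 → (a, b) = (i, j) := by
        intro a b hab
        rw [hy, Matrix.single_apply] at hab
        split_ifs at hab with h
        · rw [h.1, h.2]
        · exact absurd rfl hab
      refine ⟨⟨y, (hP y).2 fun a b hab => ?_⟩, ?_, ?_⟩
      · have := hs a b hab
        rw [Prod.mk.injEq] at this
        rw [this.1, this.2]
        exact hij'
      · change ρ y i j ≠ 0
        rw [hy]
        simp
      · rintro ⟨a, b⟩ _ hab
        exact hs a b hab
  rw [← hdimN, hindex, hdimP]

end TypeA

/-! ### The pairing form in type C -/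

section TypeC

variable {k L : Type*} [Field k] [CharZero k] [LieRing L] [LieAlgebra k L] [FiniteDimensional k L]

/-- An element of `N` is determined by its upper left block and half of its upper right block, and
`P` is the part without the first. With `dim N = |SA| + |SB|` and `dim P = |SB|`, the index is `|SB|
- |SA|`. -/
theorem exists_cpIdeal_sp {r : ℕ} {ρ : L →ₗ[k] Matrix (Fin r ⊕ Fin r) (Fin r ⊕ Fin r) k}
    {c : Fin r ⊕ Fin r → k} (R : IsRootRep ρ c) (hrange : ∀ A, (∃ x, ρ x = A) ↔ IsSpMatrix A)
    {q : LieSubalgebra k L} (blk : Fin r ⊕ Fin r → ℕ)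
    {M : ℕ} (hswap : ∀ a, blk a + blk a.swap = M) (hle : ∀ i j, blk (Sum.inl i) ≤ blk (Sum.inr j))
    (hq : ∀ x, x ∈ q ↔ ∀ a b, ρ x a b ≠ 0 → blk a ≤ blk b) {N : LieIdeal k q}
    (hN : ∀ x : q, x ∈ N ↔ ∀ a b, ρ x a b ≠ 0 → blk a < blk b) :
    (∃ P : LieIdeal k N, IsCPIdeal k P ∧
      ∀ x, x ∈ P ↔ ∀ a b, ρ x a b ≠ 0 → a.isLeft ∧ b.isRight) ∧
    lieIndex k N + (Finset.univ.filter fun s : Fin r × Fin r =>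
        blk (Sum.inl s.1) < blk (Sum.inl s.2)).card =
      (Finset.univ.filter fun s : Fin r × Fin r =>
        s.1 ≤ s.2 ∧ blk (Sum.inl s.1) < blk (Sum.inr s.2)).card := by
  have hN' : ∀ x ∈ N, ∀ a b, ρ x a b ≠ 0 → blk a < blk b := fun x hx => (hN x).1 hx
  let P := R.blockIdeal N hN' (fun a => a.isLeft) (fun a b h hb => by
    rcases a with a | a
    · rfl
    · rcases b with b | b
      · exact absurd h (hle b a).not_gt
      · exact hb)
  have hP : ∀ x, x ∈ P ↔ ∀ a b, ρ x a b ≠ 0 → a.isLeft ∧ b.isRight := by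
    intro x
    refine forall_congr' fun a => forall_congr' fun b => imp_congr_right fun _ => ?_
    exact and_congr_right fun _ => by simp
  have hsym : ∀ x, IsSpMatrix (ρ x) := fun x => (hrange _).1 ⟨x, rfl⟩
  have hsingle : ∀ a b, blk a < blk b → ∃ y : N, ρ y = spSingle k a b := by
    intro i j hij
    obtain ⟨y, hy⟩ := (hrange (spSingle k i j)).2 (isSpMatrix_spSingle i j)
    have hs : ∀ a b, ρ y a b ≠ 0 → blk a < blk b := by
      intro a b hab
      rw [hy] at hab
      have h1 := hswap i
      have h2 := hswap j
      rcases spSingle_support hab with ⟨rfl, rfl⟩ | ⟨rfl, rfl⟩ <;> omega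
    exact ⟨⟨⟨y, (hq y).2 fun a b h => (hs a b h).le⟩, (hN _).2 hs⟩, hy⟩
  let φ : N →ₗ[k] Matrix (Fin r ⊕ Fin r) (Fin r ⊕ Fin r) k :=
    ρ.comp (q.toSubmodule.subtype.comp N.toSubmodule.subtype)
  have hφ : ∀ x, φ x = ρ x := fun _ => rfl
  let f : Dual k N := ∑ i : Fin r,
    (LinearMap.proj (Sum.inr i)).comp ((LinearMap.proj (Sum.inl i)).comp φ)
  have hf : ∀ x, f x = ∑ i : Fin r, ρ x (Sum.inl i) (Sum.inr i) := by
    intro x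
    simp only [f, LinearMap.sum_apply]
    rfl
  have hortho : ∀ x, (∀ y ∈ P, f ⁅y, x⁆ = 0) → x ∈ P := by
    intro x hx
    have hstrict := hN' x x.2
    -- Testing against the elementary symmetric element at `(inl i, inr j)` gives twice this
    -- relation, once the lower right entries are rewritten by the symplectic symmetry.
    have hrel : ∀ i j : Fin r, blk (Sum.inl i) < blk (Sum.inr j) →
        ρ x (Sum.inl i) (Sum.inl j) + ρ x (Sum.inl j) (Sum.inl i) = 0 := by
      intro i j hij
      obtain ⟨y, hy⟩ := hsingle (Sum.inl i) (Sum.inr j) hij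
      have hyP : y ∈ P := by
        rw [hP]
        intro a b hab
        rw [hy] at hab
        rcases spSingle_support hab with ⟨rfl, rfl⟩ | ⟨rfl, rfl⟩ <;> simp
      have h0 := hx y hyP
      have h1 := hsym x (Sum.inl i) (Sum.inl j)
      have h2 := hsym x (Sum.inl j) (Sum.inl i)
      simp only [Sum.swap_inl, spSign, Sum.elim_inl, mul_one, Int.cast_one] at h1 h2
      rw [hf] at h0
      simp only [show ((⁅y, x⁆ : N) : L) = ⁅(y : L), (x : L)⁆ from rfl, R.map_lie, hy, spSingle,
        spSign, Matrix.sub_apply, sub_mul, mul_sub, smul_mul_assoc, mul_smul_comm,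
        Matrix.smul_apply, single_one_mul_apply, mul_single_one_apply, Finset.sum_sub_distrib,
        Sum.elim_inl, Sum.elim_inr, Sum.swap_inl, Sum.swap_inr, Sum.inl.injEq, Sum.inr.injEq,
        smul_eq_mul, Finset.sum_ite_eq, Finset.mem_univ, if_true, ← Finset.mul_sum] at h0
      push_cast at h0
      rw [h1, h2] at h0
      have h3 : (2 : k) * (ρ x (Sum.inl i) (Sum.inl j) + ρ x (Sum.inl j) (Sum.inl i)) = 0 := by
        linear_combination -h0
      exact (mul_eq_zero.1 h3).resolve_left two_ne_zero
    -- Of two transposed entries at most one is strictly block upper triangular, so a vanishing sum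
    -- kills both.
    have hAA : ∀ i j : Fin r, ρ x (Sum.inl i) (Sum.inl j) = 0 := by
      intro i j
      by_contra hne
      have hlt := hstrict _ _ hne
      have h0 := hrel i j (hlt.trans_le (hle j j))
      have h1 : ρ x (Sum.inl j) (Sum.inl i) = 0 := by
        by_contra hne'
        exact absurd (hstrict _ _ hne') hlt.not_gt
      rw [h1, add_zero] at h0
      exact hne h0
    rw [hP]
    rintro (i | i) (j | j) hab
    · exact absurd (hAA i j) hab
    · simp
    · exact absurd (hstrict _ _ hab) (hle j i).not_gt
    · have := hsym x (Sum.inl j) (Sum.inl i)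
      rw [hAA, mul_zero] at this
      exact absurd this hab
  obtain ⟨hcp, hindex⟩ := isCPIdeal_and_lieIndex P R.lie_eq_zero_of_mem_blockIdeal f hortho
  refine ⟨⟨P, hcp, hP⟩, ?_⟩
  set SA : Finset (Fin r × Fin r) :=
    Finset.univ.filter fun s => blk (Sum.inl s.1) < blk (Sum.inl s.2)
  set SB : Finset (Fin r × Fin r) :=
    Finset.univ.filter fun s => s.1 ≤ s.2 ∧ blk (Sum.inl s.1) < blk (Sum.inr s.2)
  let eA : Fin r × Fin r ↪ (Fin r ⊕ Fin r) × (Fin r ⊕ Fin r) :=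
    ⟨fun s => (Sum.inl s.1, Sum.inl s.2), fun s t h => by simpa [Prod.ext_iff] using h⟩
  let eB : Fin r × Fin r ↪ (Fin r ⊕ Fin r) × (Fin r ⊕ Fin r) :=
    ⟨fun s => (Sum.inl s.1, Sum.inr s.2), fun s t h => by simpa [Prod.ext_iff] using h⟩
  -- The upper right block is symmetric, so its entries with `i ≤ j` determine it.
  have hBzero : ∀ x : N, (∀ s ∈ SB.map eB, ρ x s.1 s.2 = 0) →
      ∀ i j, ρ x (Sum.inl i) (Sum.inr j) = 0 := by
    intro x hx i j
    by_contra hne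
    have hlt := hN' x x.2 _ _ hne
    rcases le_total i j with h | h
    · exact hne (hx (Sum.inl i, Sum.inr j)
        (Finset.mem_map.2 ⟨(i, j), by simp [SB, h, hlt], rfl⟩))
    · have h1 := hsym x (Sum.inl i) (Sum.inr j)
      have h2 := hswap (Sum.inl i)
      have h3 := hswap (Sum.inr j)
      simp only [Sum.swap_inl, Sum.swap_inr] at h1 h2 h3
      rw [hx (Sum.inl j, Sum.inr i)
        (Finset.mem_map.2 ⟨(j, i), by simp [SB, h]; omega, rfl⟩)] at h1
      refine (mul_ne_zero ?_ hne) h1.symm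
      simp [spSign]
  have hBsupp : ∀ i j, (i, j) ∈ SB → ∀ s : Fin r × Fin r, s ∈ SB →
      spSingle k (Sum.inl i) (Sum.inr j) (Sum.inl s.1) (Sum.inr s.2) ≠ 0 → s = (i, j) := by
    rintro i j hij ⟨a, b⟩ hs h
    simp only [SB, Finset.mem_filter, Finset.mem_univ, true_and] at hs hij
    rcases spSingle_support h with h' | h'
    · simpa [Prod.ext_iff] using h'
    · simp only [Sum.swap_inl, Sum.swap_inr, Sum.inl.injEq, Sum.inr.injEq] at h'
      have h1 : i = j := le_antisymm hij.1 (by rw [← h'.1, ← h'.2]; exact hs.1)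
      rw [h'.1, h'.2, h1]
  have hdimN : finrank k N = SA.card + SB.card := by
    have hdisj : Disjoint (SA.map eA) (SB.map eB) := by
      rw [Finset.disjoint_left]
      intro s hs hs'
      obtain ⟨t, -, rfl⟩ := Finset.mem_map.1 hs
      obtain ⟨t', -, h⟩ := Finset.mem_map.1 hs'
      simp [eA, eB, Prod.ext_iff] at h
    rw [← Finset.card_map eA (s := SA), ← Finset.card_map eB (s := SB),
      ← Finset.card_union_of_disjoint hdisj]
    refine finrank_eq_card_positions φ _ ?_ ?_
    · intro x hx
      have hB := hBzero x fun s hs => hx s (Finset.mem_union_right _ hs)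
      have hA : ∀ i j, ρ x (Sum.inl i) (Sum.inl j) = 0 := by
        intro i j
        by_contra hne
        have hlt := hN' x x.2 _ _ hne
        exact hne (hx (Sum.inl i, Sum.inl j) (Finset.mem_union_left _
          (Finset.mem_map.2 ⟨(i, j), by simp [SA, hlt], rfl⟩)))
      apply Subtype.ext
      apply Subtype.ext
      apply R.injective
      ext a b
      by_contra hne
      have hne' : ρ x a b ≠ 0 := by simpa using hne
      rcases a with i | i <;> rcases b with j | j
      · exact hne' (hA i j)
      · exact hne' (hB i j)
      · exact absurd (hN' x x.2 _ _ hne') (hle j i).not_gt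
      · have := hsym x (Sum.inl j) (Sum.inl i)
        rw [hA, mul_zero] at this
        exact hne' this
    · intro s hs
      rcases Finset.mem_union.1 hs with hs | hs
      · obtain ⟨⟨i, j⟩, hij, rfl⟩ := Finset.mem_map.1 hs
        obtain ⟨y, hy⟩ := hsingle (Sum.inl i) (Sum.inl j) (by simpa [SA] using hij)
        refine ⟨y, by rw [hφ, hy]; exact spSingle_apply_ne_zero _ _, ?_⟩
        intro t ht h
        rw [hφ, hy] at h
        rcases spSingle_support h with h' | h'
        · exact Prod.ext h'.1 h'.2
        · rcases Finset.mem_union.1 ht with ht | ht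
          · obtain ⟨t, -, rfl⟩ := Finset.mem_map.1 ht
            simp [eA] at h'
          · obtain ⟨t, -, rfl⟩ := Finset.mem_map.1 ht
            simp [eB] at h'
      · obtain ⟨⟨i, j⟩, hij, rfl⟩ := Finset.mem_map.1 hs
        have hlt : blk (Sum.inl i) < blk (Sum.inr j) := by
          simp only [SB, Finset.mem_filter] at hij; exact hij.2.2
        obtain ⟨y, hy⟩ := hsingle (Sum.inl i) (Sum.inr j) hlt
        refine ⟨y, by rw [hφ, hy]; exact spSingle_apply_ne_zero _ _, ?_⟩
        intro t ht h
        rw [hφ, hy] at h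
        rcases Finset.mem_union.1 ht with ht | ht
        · obtain ⟨t, -, rfl⟩ := Finset.mem_map.1 ht
          rcases spSingle_support h with h' | h' <;> simp [eA] at h'
        · obtain ⟨s', hs', rfl⟩ := Finset.mem_map.1 ht
          rw [hBsupp i j hij s' hs' h]
  have hdimP : finrank k P = SB.card := by
    rw [← Finset.card_map eB (s := SB)]
    refine finrank_eq_card_positions (φ.comp P.toSubmodule.subtype) _ ?_ ?_
    · intro x hx
      have hB := hBzero (x : N) hx
      apply Subtype.ext
      apply Subtype.ext
      apply Subtype.ext
      apply R.injective
      ext a b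
      by_contra hne
      have hne' : ρ (x : N) a b ≠ 0 := by simpa using hne
      have := (hP x).1 x.2 a b hne'
      rcases a with i | i <;> rcases b with j | j
      · simp at this
      · exact hne' (hB i j)
      · simp at this
      · simp at this
    · intro s hs
      obtain ⟨⟨i, j⟩, hij, rfl⟩ := Finset.mem_map.1 hs
      have hlt : blk (Sum.inl i) < blk (Sum.inr j) := by
        simp only [SB, Finset.mem_filter] at hij; exact hij.2.2
      obtain ⟨y, hy⟩ := hsingle (Sum.inl i) (Sum.inr j) hlt
      have hyP : y ∈ P := by
        rw [hP]
        intro a b hab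
        rw [hy] at hab
        rcases spSingle_support hab with ⟨rfl, rfl⟩ | ⟨rfl, rfl⟩ <;> simp
      refine ⟨⟨y, hyP⟩, ?_, ?_⟩
      · change ρ y (Sum.inl i) (Sum.inr j) ≠ 0
        rw [hy]
        exact spSingle_apply_ne_zero _ _
      · intro t ht h
        obtain ⟨s', hs', rfl⟩ := Finset.mem_map.1 ht
        change ρ y (Sum.inl s'.1) (Sum.inr s'.2) ≠ 0 at h
        rw [hy] at h
        rw [hBsupp i j hij s' hs' h]
  omega

end TypeC

/-! ### Coordinate subspaces -/

section CoordSpan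

variable {k V ι : Type*} [Field k] [AddCommGroup V] [Module k V]

/-- The span of the basis vectors at the indices that satisfy `X`. -/
def coordSpan (B : Basis ι k V) (X : ι → Prop) : Submodule k V where
  carrier := {v | ∀ a, ¬ X a → B.repr v a = 0}
  add_mem' := by
    intro v w hv hw a ha
    rw [map_add, Finsupp.add_apply, hv a ha, hw a ha, add_zero]
  zero_mem' := by intro a _; simp
  smul_mem' := by
    intro t v hv a ha
    rw [map_smul, Finsupp.smul_apply, hv a ha, smul_zero]

theorem mem_coordSpan {B : Basis ι k V} {X : ι → Prop} {v : V} :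
    v ∈ coordSpan B X ↔ ∀ a, ¬ X a → B.repr v a = 0 := Iff.rfl

theorem basis_mem_coordSpan {B : Basis ι k V} {X : ι → Prop} {b : ι} :
    B b ∈ coordSpan B X ↔ X b := by
  rw [mem_coordSpan]
  constructor
  · intro h
    by_contra hb
    simpa using h b hb
  · intro hb a ha
    rw [B.repr_self, Finsupp.single_eq_of_ne]
    rintro rfl
    exact ha hb

theorem coordSpan_mono {B : Basis ι k V} {X Y : ι → Prop} :
    coordSpan B X ≤ coordSpan B Y ↔ ∀ a, X a → Y a := by
  constructor
  · intro h a ha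
    exact basis_mem_coordSpan.1 (h (basis_mem_coordSpan.2 ha))
  · intro h v hv a ha
    exact hv a fun h' => ha (h a h')

theorem coordSpan_eq_span (B : Basis ι k V) (X : ι → Prop) :
    coordSpan B X = Submodule.span k (B '' {a | X a}) := by
  ext v
  rw [Basis.mem_span_image, mem_coordSpan]
  constructor
  · intro h a ha
    by_contra hX
    exact (Finsupp.mem_support_iff.1 ha) (h a hX)
  · intro h a ha
    by_contra hne
    exact ha (h (Finsupp.mem_support_iff.2 hne))

theorem forall_mem_coordSpan_apply {B : Basis ι k V} {X : ι → Prop} {V' : Type*}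
    [AddCommGroup V'] [Module k V'] {W : Submodule k V'} {f : V →ₗ[k] V'} : (∀ v ∈ coordSpan B X, f v ∈ W) ↔ ∀ b, X b → f (B b) ∈ W := by
  constructor
  · intro h b hb
    exact h _ (basis_mem_coordSpan.2 hb)
  · intro h
    change coordSpan B X ≤ W.comap f
    rw [coordSpan_eq_span, Submodule.span_le]
    rintro _ ⟨b, hb, rfl⟩
    exact h b hb

theorem finrank_coordSpan [Fintype ι] (B : Basis ι k V) (X : ι → Prop) [DecidablePred X] :
    finrank k (coordSpan B X) = (Finset.univ.filter X).card := by
  have : B '' {a | X a} = Set.range fun a : {a // X a} => B a := by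
    ext v
    constructor
    · rintro ⟨a, ha, rfl⟩; exact ⟨⟨a, ha⟩, rfl⟩
    · rintro ⟨⟨a, ha⟩, rfl⟩; exact ⟨a, ha, rfl⟩
  rw [coordSpan_eq_span, this, finrank_span_eq_card, Fintype.card_subtype]
  exact B.linearIndependent.comp _ Subtype.val_injective

end CoordSpan

/-! ### Matrices of a representation -/

section BasisRep

variable {k L V ι : Type*} [Field k] [LieRing L] [LieAlgebra k L] [AddCommGroup V] [Module k V]
  [Fintype ι] [DecidableEq ι]

/-- The matrix representation attached to a representation by endomorphisms and a basis. -/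
noncomputable def matrixRep (B : Basis ι k V) (σ : L →ₗ[k] V →ₗ[k] V) : L →ₗ[k] Matrix ι ι k :=
  (LinearMap.toMatrix B B).toLinearMap.comp σ

theorem matrixRep_eq (B : Basis ι k V) (σ : L →ₗ[k] V →ₗ[k] V) (x : L) :
    matrixRep B σ x = LinearMap.toMatrix B B (σ x) := rfl

theorem matrixRep_apply (B : Basis ι k V) (σ : L →ₗ[k] V →ₗ[k] V) (x : L) (a b : ι) :
    matrixRep B σ x a b = B.repr (σ x (B b)) a := by
  rw [matrixRep_eq, LinearMap.toMatrix_apply]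

theorem matrixRep_injective (B : Basis ι k V) {σ : L →ₗ[k] V →ₗ[k] V}
    (hσ : Function.Injective σ) : Function.Injective (matrixRep B σ) :=
  (LinearMap.toMatrix B B).injective.comp hσ

theorem matrixRep_lie (B : Basis ι k V) {σ : L →ₗ[k] V →ₗ[k] V}
    (hσ : ∀ x y v, σ ⁅x, y⁆ v = σ x (σ y v) - σ y (σ x v)) (x y : L) :
    matrixRep B σ ⁅x, y⁆ =
      matrixRep B σ x * matrixRep B σ y - matrixRep B σ y * matrixRep B σ x := by
  simp only [matrixRep_eq]
  rw [← LinearMap.toMatrix_comp, ← LinearMap.toMatrix_comp, ← map_sub]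
  congr 1
  ext v
  exact hσ x y v

theorem preserves_coordSpan_iff {B : Basis ι k V} {σ : L →ₗ[k] V →ₗ[k] V} {X : ι → Prop} {x : L} :
    (∀ v ∈ coordSpan B X, σ x v ∈ coordSpan B X) ↔
      ∀ a b, X b → ¬ X a → matrixRep B σ x a b = 0 := by
  rw [forall_mem_coordSpan_apply]
  simp only [mem_coordSpan, matrixRep_apply]
  exact ⟨fun h a b hb ha => h b hb a ha, fun h b hb a ha => h a b hb ha⟩

theorem maps_into_and_kills_coordSpan_iff {B : Basis ι k V} {σ : L →ₗ[k] V →ₗ[k] V}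
    {X : ι → Prop} {x : L} :
    ((∀ v, σ x v ∈ coordSpan B X) ∧ ∀ v ∈ coordSpan B X, σ x v = 0) ↔
      ∀ a b, matrixRep B σ x a b ≠ 0 → X a ∧ ¬ X b := by
  constructor
  · rintro ⟨h1, h2⟩ a b hab
    rw [matrixRep_apply] at hab
    constructor
    · by_contra ha
      exact hab (h1 (B b) a ha)
    · intro hb
      refine hab ?_
      rw [h2 _ (basis_mem_coordSpan.2 hb)]
      simp
  · intro h
    constructor
    · suffices h' : ∀ v ∈ coordSpan B fun _ => True, σ x v ∈ coordSpan B X from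
        fun v => h' v (mem_coordSpan.2 fun a ha => absurd trivial ha)
      rw [forall_mem_coordSpan_apply]
      intro b _ a ha
      rw [← matrixRep_apply]
      by_contra hne
      exact ha (h a b hne).1
    · suffices h' : ∀ v ∈ coordSpan B X, σ x v ∈ (⊥ : Submodule k V) from h'
      rw [forall_mem_coordSpan_apply]
      intro b hb
      rw [Submodule.mem_bot]
      apply B.repr.injective
      ext a
      rw [← matrixRep_apply, map_zero, Finsupp.zero_apply]
      by_contra hne
      exact (h a b hne).2 hb

end BasisRep

/-! ### Flags and comparable subspaces -/

section Flags

variable {k V : Type*} [Field k] [AddCommGroup V] [Module k V]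

theorem IsFlagOfType.strictMono {m : ℕ} {F : Fin (m + 1) → Submodule k V} {p : Fin m → ℕ}
    (h : IsFlagOfType F p) : StrictMono F := Fin.strictMono_iff_lt_succ.2 h.lt

theorem IsFlagOfType.finrank_eq_partialSum {m : ℕ} {F : Fin (m + 1) → Submodule k V}
    {p : Fin m → ℕ} (h : IsFlagOfType F p) (l : Fin (m + 1)) :
    finrank k (F l) = partialSum p l := by
  induction l using Fin.induction with
  | zero =>
    rw [h.bot, finrank_bot, partialSum, Finset.filter_false_of_mem, Finset.sum_empty]
    intro i _
    exact Fin.not_lt_zero _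
  | succ i ih =>
    rw [h.dim, ih, partialSum, partialSum]
    have : Finset.univ.filter (fun j : Fin m => j.castSucc < i.succ) =
        insert i (Finset.univ.filter fun j : Fin m => j.castSucc < i.castSucc) := by
      ext j
      simp only [Finset.mem_filter, Finset.mem_univ, true_and, Finset.mem_insert, Fin.lt_def,
        Fin.val_castSucc, Fin.val_succ, Fin.ext_iff]
      omega
    rw [this, Finset.sum_insert (by simp), add_comm]

variable [FiniteDimensional k V]

/-- A subspace comparable with all members of a flag and strictly inside `W` can be enlarged to
another such subspace. -/
theorem exists_comparable_extension {m : ℕ} {F : Fin (m + 1) → Submodule k V} (hF : Monotone F)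
    (htop : F (Fin.last m) = ⊤) {W : Submodule k V} (hW : ∀ i, F i ≤ W ∨ W ≤ F i)
    (U : Submodule k V) (hU : U ≤ W ∧ ∀ i, U ≤ F i ∨ F i ≤ U) (hlt : finrank k U < finrank k W) :
    ∃ v ∉ U, U ⊔ Submodule.span k {v} ≤ W ∧
      ∀ i, U ⊔ Submodule.span k {v} ≤ F i ∨ F i ≤ U ⊔ Submodule.span k {v} := by
  have hne : ({i | ¬ F i ⊓ W ≤ U} : Set (Fin (m + 1))).Nonempty := by
    refine ⟨Fin.last m, fun h => ?_⟩
    rw [htop, top_inf_eq] at h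
    exact absurd (Submodule.finrank_mono h) (not_le.2 hlt)
  -- Take the new vector from the first member of the flag whose intersection with `W` is not yet
  -- exhausted by `U`. Earlier members inside `W` lie in `U`; from the `i`-th on, all contain `U`
  -- and the vector.
  obtain ⟨i, hi, hmin⟩ := wellFounded_lt.has_min _ hne
  obtain ⟨v, hv, hvU⟩ := SetLike.not_le_iff_exists.1 hi
  have hvW : U ⊔ Submodule.span k {v} ≤ W :=
    sup_le hU.1 ((Submodule.span_singleton_le_iff_mem _ _).2 hv.2)
  refine ⟨v, hvU, hvW, fun j => ?_⟩
  rcases lt_or_ge j i with hj | hj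
  · have h1 : F j ⊓ W ≤ U := by
      by_contra hcon
      exact hmin j hcon hj
    rcases hW j with h | h
    · rw [inf_eq_left.2 h] at h1
      exact Or.inr (h1.trans le_sup_left)
    · exact Or.inl (hvW.trans h)
  · left
    refine sup_le ?_ ((Submodule.span_singleton_le_iff_mem _ _).2 (hF hj hv.1))
    exact ((hU.2 i).resolve_right fun h => hi (inf_le_left.trans h)).trans (hF hj)

theorem eq_of_comparable_of_finrank_eq {U W : Submodule k V} (h : U ≤ W ∨ W ≤ U)
    (hd : finrank k U = finrank k W) : U = W := by
  rcases h with h | h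
  · exact Submodule.eq_of_le_of_finrank_eq h hd
  · exact (Submodule.eq_of_le_of_finrank_eq h hd.symm).symm

end Flags

/-! ### Blocks of positions cut out by dimensions -/

section Blocks

/-- The index of the block of a flag with dimensions `d` to which a position belongs. -/
theorem exists_block {m n : ℕ} (d : Fin (m + 1) → ℕ) (h0 : d 0 = 0) (hn : d (Fin.last m) = n) :
    ∃ g : Fin n → Fin m, ∀ a, d (g a).castSucc ≤ a ∧ (a : ℕ) < d (g a).succ := by
  suffices h : ∀ a : Fin n, ∃ j : Fin m, d j.castSucc ≤ a ∧ (a : ℕ) < d j.succ from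
    ⟨fun a => (h a).choose, fun a => (h a).choose_spec⟩
  intro a
  by_contra! hcon
  have : ∀ i : Fin (m + 1), d i ≤ a := by
    intro i
    induction i using Fin.induction with
    | zero => omega
    | succ i ih => exact hcon i ih
  have := this (Fin.last m)
  have := a.2
  omega

variable {m n : ℕ} {d : Fin (m + 1) → ℕ} {g : Fin n → Fin m}

theorem block_eq_iff (hd : StrictMono d)
    (hg : ∀ a, d (g a).castSucc ≤ a ∧ (a : ℕ) < d (g a).succ) {a : Fin n} {j : Fin m} :
    g a = j ↔ d j.castSucc ≤ a ∧ (a : ℕ) < d j.succ := by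
  constructor
  · rintro rfl; exact hg a
  · rintro ⟨h1, h2⟩
    have h3 := hd.lt_iff_lt.1 ((hg a).1.trans_lt h2)
    have h4 := hd.lt_iff_lt.1 (h1.trans_lt (hg a).2)
    rw [Fin.castSucc_lt_succ_iff] at h3 h4
    exact le_antisymm h3 h4

theorem block_lt_iff (hd : StrictMono d)
    (hg : ∀ a, d (g a).castSucc ≤ a ∧ (a : ℕ) < d (g a).succ) {a b : Fin n} :
    g a < g b ↔ ∃ i, (a : ℕ) < d i ∧ d i ≤ b := by
  constructor
  · intro h
    refine ⟨(g b).castSucc, (hg a).2.trans_le (hd.monotone ?_), (hg b).1⟩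
    rwa [Fin.succ_le_castSucc_iff]
  · rintro ⟨i, h1, h2⟩
    have h3 := hd.lt_iff_lt.1 ((hg a).1.trans_lt h1)
    have h4 := hd.lt_iff_lt.1 (h2.trans_lt (hg b).2)
    rw [Fin.lt_def, Fin.val_castSucc] at h3
    rw [Fin.lt_def, Fin.val_succ] at h4
    rw [Fin.lt_def]
    omega

theorem block_monotone (hd : StrictMono d)
    (hg : ∀ a, d (g a).castSucc ≤ a ∧ (a : ℕ) < d (g a).succ) : Monotone g := by
  intro a b hab
  by_contra hcon
  obtain ⟨i, h1, h2⟩ := (block_lt_iff hd hg).1 (not_le.1 hcon)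
  have : (a : ℕ) ≤ b := hab
  omega

end Blocks

/-! ### Borel subalgebras and steps of the standard flag -/

section Borel

variable {k L V ι : Type*} [Field k] [LieRing L] [LieAlgebra k L] [AddCommGroup V] [Module k V]
  [Fintype ι]

/-- If a Borel subalgebra consists of upper triangular matrices, it contains all of them. -/
theorem mem_borel_of_upperTriangular {ρ : L →ₗ[k] Matrix ι ι k} (hinj : Function.Injective ρ)
    (hlie : ∀ x y, ρ ⁅x, y⁆ = ρ x * ρ y - ρ y * ρ x) {o : ι → ℕ} (ho : Function.Injective o)
    {b : LieSubalgebra k L} (hb : IsBorelSubalgebra k b)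
    (hup : ∀ x ∈ b, ∀ i j, ρ x i j ≠ 0 → o i ≤ o j) (x : L)
    (hx : ∀ i j, ρ x i j ≠ 0 → o i ≤ o j) : x ∈ b := by
  -- All upper triangular elements form a solvable subalgebra containing `b`, so maximality of `b`
  -- applies.
  let T : LieSubalgebra k L :=
    { carrier := {x | ∀ i j, ρ x i j ≠ 0 → o i ≤ o j}
      add_mem' := by
        intro x y hx hy i j h
        by_cases h' : ρ x i j = 0
        · refine hy i j fun h'' => h ?_
          simp [h', h'']
        · exact hx i j h'
      zero_mem' := by intro i j h; simp at h
      smul_mem' := by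
        intro t x hx i j h
        refine hx i j fun h' => h ?_
        simp [h']
      lie_mem' := by
        intro x y hx hy i j h
        have := commutator_shift (j := 0) ho hx hy i j (by rwa [← hlie])
        omega }
  have hT : LieAlgebra.IsSolvable T :=
    isSolvable_of_upperTriangular hinj hlie ho T fun x hx => hx
  exact hb.2 hT (fun y hy => hup y hy) hx

theorem finrank_coordSpan_lt (B : Basis ι k V) {o : ι → ℕ} {n : ℕ} (ho : Function.Injective o)
    (hsurj : ∀ t < n, ∃ a, o a = t) {t : ℕ} (ht : t ≤ n) :
    finrank k (coordSpan B fun a => o a < t) = t := by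
  classical
  rw [finrank_coordSpan]
  conv_rhs => rw [← Finset.card_range t]
  refine Finset.card_bij (fun a _ => o a) ?_ ?_ ?_
  · intro a ha
    simpa using ha
  · intro a _ b _ h
    exact ho h
  · intro s hs
    rw [Finset.mem_range] at hs
    obtain ⟨a, rfl⟩ := hsurj s (by omega)
    exact ⟨a, by simpa using hs, rfl⟩

theorem isFlagOfType_coordSpan (B : Basis ι k V) {o : ι → ℕ} {n : ℕ} (ho : Function.Injective o)
    (hlt : ∀ a, o a < n) (hsurj : ∀ t < n, ∃ a, o a = t) {m : ℕ} {τ : Fin (m + 1) → ℕ}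
    (hτ : StrictMono τ) (h0 : τ 0 = 0) (hn : τ (Fin.last m) = n) :
    IsFlagOfType (fun i => coordSpan B fun a => o a < τ i)
      (fun i : Fin m => τ i.succ - τ i.castSucc) := by
  have hle : ∀ i, τ i ≤ n := fun i => hn ▸ hτ.monotone (Fin.le_last i)
  refine ⟨?_, ?_, fun i => ?_, fun i => ?_⟩
  · rw [eq_bot_iff]
    intro v hv
    rw [Submodule.mem_bot]
    apply B.repr.injective
    ext a
    rw [hv a (by rw [h0]; exact Nat.not_lt_zero _)]
    simp
  · rw [eq_top_iff]
    intro v _ a ha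
    exact absurd (hn ▸ hlt a) ha
  · have h1 : τ i.castSucc < τ i.succ := hτ Fin.castSucc_lt_succ
    refine lt_of_le_of_ne (coordSpan_mono.2 fun a ha => ha.trans h1) fun heq => ?_
    have h2 := congrArg (fun U : Submodule k V => finrank k U) heq
    rw [finrank_coordSpan_lt B ho hsurj (hle _), finrank_coordSpan_lt B ho hsurj (hle _)] at h2
    omega
  · have h1 : τ i.castSucc < τ i.succ := hτ Fin.castSucc_lt_succ
    rw [finrank_coordSpan_lt B ho hsurj (hle _), finrank_coordSpan_lt B ho hsurj (hle _)]
    omega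

variable [DecidableEq ι]

theorem upperTriangular_of_preserves {B : Basis ι k V} {σ : L →ₗ[k] V →ₗ[k] V} {o : ι → ℕ} {n : ℕ}
    (hlt : ∀ a, o a < n) {x : L}
    (h : ∀ t ≤ n, ∀ v ∈ coordSpan B (fun a => o a < t), σ x v ∈ coordSpan B fun a => o a < t)
    (a b : ι) (hab : matrixRep B σ x a b ≠ 0) : o a ≤ o b := by
  by_contra hcon
  exact hab (preserves_coordSpan_iff.1 (h (o b + 1) (hlt b)) a b (Nat.lt_succ_self _) (by omega))

/-- A subalgebra that contains the upper triangular elements is the stabilizer of the steps of the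
standard flag that it preserves. -/
theorem exists_steps {B : Basis ι k V} {σ : L →ₗ[k] V →ₗ[k] V} {c : ι → k}
    (R : IsRootRep (matrixRep B σ) c) (q : LieSubalgebra k L) (o : ι → ℕ) {n : ℕ}
    (ho : Function.Injective o) (hlt : ∀ a, o a < n) (hsurj : ∀ t < n, ∃ a, o a = t)
    (hcompat : ∀ a b a' b', a ≠ b → c a' - c b' = c a - c b → o a ≤ o b → o a' ≤ o b')
    (hT : ∀ x, (∀ a b, matrixRep B σ x a b ≠ 0 → o a ≤ o b) → x ∈ q) :
    ∃ (m : ℕ) (τ : Fin (m + 1) → ℕ), StrictMono τ ∧ τ 0 = 0 ∧ τ (Fin.last m) = n ∧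
      (∀ t, (∃ i, τ i = t) ↔ t ≤ n ∧ ∀ y ∈ q, ∀ v ∈ coordSpan B (fun a => o a < t),
        σ y v ∈ coordSpan B fun a => o a < t) ∧
      ∀ x, x ∈ q ↔ ∀ i, ∀ v ∈ coordSpan B (fun a => o a < τ i),
        σ x v ∈ coordSpan B fun a => o a < τ i := by
  classical
  -- The partial flag consists of every step preserved by `q`, listed in increasing order of
  -- dimension.
  let S : Finset ℕ := (Finset.range (n + 1)).filter fun t =>
    ∀ y ∈ q, ∀ v ∈ coordSpan B (fun a => o a < t), σ y v ∈ coordSpan B fun a => o a < t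
  have hS : ∀ t, t ∈ S ↔ t ≤ n ∧ ∀ y ∈ q, ∀ v ∈ coordSpan B (fun a => o a < t),
      σ y v ∈ coordSpan B fun a => o a < t := by
    intro t
    rw [Finset.mem_filter, Finset.mem_range, Nat.lt_succ_iff]
  have h0 : 0 ∈ S := by
    refine (hS 0).2 ⟨Nat.zero_le _, fun y _ => preserves_coordSpan_iff.2 ?_⟩
    intro a b hb
    exact absurd hb (Nat.not_lt_zero _)
  have hn : n ∈ S := by
    refine (hS n).2 ⟨le_rfl, fun y _ => preserves_coordSpan_iff.2 ?_⟩
    intro a b _ ha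
    exact absurd (hlt a) ha
  obtain ⟨m, hm⟩ : ∃ m, S.card = m + 1 :=
    Nat.exists_eq_succ_of_ne_zero (Finset.card_ne_zero_of_mem h0)
  let τ := S.orderEmbOfFin hm
  have hrange : ∀ t, (∃ i, τ i = t) ↔ t ∈ S := by
    intro t
    have := Finset.range_orderEmbOfFin S hm
    rw [← Finset.mem_coe, ← this]
    rfl
  have hmono : StrictMono τ := τ.strictMono
  refine ⟨m, τ, hmono, ?_, ?_, fun t => (hrange t).trans (hS t), fun x => ⟨?_, ?_⟩⟩
  · obtain ⟨i, hi⟩ := (hrange 0).2 h0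
    have := hmono.monotone (Fin.zero_le i)
    omega
  · obtain ⟨i, hi⟩ := (hrange n).2 hn
    have h1 := hmono.monotone (Fin.le_last i)
    have h2 := ((hS _).1 ((hrange _).1 ⟨Fin.last m, rfl⟩)).1
    omega
  · intro hx i
    exact ((hS _).1 ((hrange _).1 ⟨i, rfl⟩)).2 x hx
  · intro hx
    refine R.mem_of_preserves_steps q o ho hlt hsurj hcompat hT x fun t ht hq => ?_
    have htS : t ∈ S := (hS t).2 ⟨ht, fun y hy => preserves_coordSpan_iff.2 fun a b hb ha =>
      hq y hy a b hb (not_lt.1 ha)⟩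
    obtain ⟨i, rfl⟩ := (hrange t).2 htS
    intro a b hb ha
    exact preserves_coordSpan_iff.1 (hx i) a b hb (not_lt.2 ha)

end Borel

/-! ### Flags and parabolic subalgebras in type A -/

section TypeAFlags

variable {k L V : Type*} [Field k] [LieRing L] [LieAlgebra k L] [AddCommGroup V] [Module k V]

theorem matrixRep_range_sl {ι : Type*} [Fintype ι] [DecidableEq ι] (B : Basis ι k V)
    {σ : L →ₗ[k] V →ₗ[k] V} (hrange : ∀ f, (∃ x, σ x = f) ↔ LinearMap.trace k V f = 0)
    (A : Matrix ι ι k) : (∃ x, matrixRep B σ x = A) ↔ A.trace = 0 := by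
  have h1 : LinearMap.trace k V (Matrix.toLin B B A) = A.trace := by
    rw [LinearMap.trace_eq_matrix_trace k B, LinearMap.toMatrix_toLin]
  rw [← h1, ← hrange]
  refine exists_congr fun x => ?_
  rw [matrixRep_eq]
  constructor
  · intro h
    rw [← h, Matrix.toLin_toMatrix]
  · intro h
    rw [h, LinearMap.toMatrix_toLin]

/-- An entry leads out of some member of the flag exactly when a flag dimension separates its column
from its row. -/
theorem mem_stabilizer_iff_block_le {ι : Type*} [Fintype ι] [DecidableEq ι] {B : Basis ι k V}
    {σ : L →ₗ[k] V →ₗ[k] V} {n m : ℕ} {d : Fin (m + 1) → ℕ} (hd : StrictMono d) {g : Fin n → Fin m}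
    (hg : ∀ a, d (g a).castSucc ≤ a ∧ (a : ℕ) < d (g a).succ) (o : ι → Fin n) (x : L) :
    (∀ i, ∀ v ∈ coordSpan B (fun a => (o a : ℕ) < d i),
      σ x v ∈ coordSpan B fun a => (o a : ℕ) < d i) ↔
      ∀ a b, matrixRep B σ x a b ≠ 0 → g (o a) ≤ g (o b) := by
  simp only [preserves_coordSpan_iff, not_lt]
  constructor
  · intro h a b hab
    by_contra hcon
    obtain ⟨i, h1, h2⟩ := (block_lt_iff hd hg).1 (not_le.1 hcon)
    exact hab (h i a b h1 h2)
  · intro h i a b hb ha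
    by_contra hne
    exact absurd ((block_lt_iff hd hg).2 ⟨i, hb, ha⟩) (not_lt.2 (h a b hne))

/-- A smaller dimension that is no closer to `n / 2` must lie at or below the reflection of the
chosen one. The index 0 does not compete for the minimum, but its dimension is 0. -/
theorem IsClosestToHalf.add_le {n : ℕ} {m : ℕ} {p : Fin m → ℕ} {l : Fin (m + 1)}
    (h : IsClosestToHalf n p l) (hl : partialSum p l ≤ n) (j : Fin (m + 1))
    (hj : partialSum p j < partialSum p l) (hn : n < 2 * partialSum p l) :
    partialSum p j + partialSum p l ≤ n := by
  by_cases hj0 : j = 0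
  · subst hj0
    have : partialSum p 0 = 0 := by
      rw [partialSum, Finset.filter_false_of_mem, Finset.sum_empty]
      intro i _
      exact Fin.not_lt_zero _
    omega
  · have h1 := h.2 j hj0
    have h2 : (n : ℚ) < 2 * partialSum p l := by exact_mod_cast hn
    have h3 : (partialSum p j : ℚ) < partialSum p l := by exact_mod_cast hj
    rw [abs_of_nonneg (by linarith), le_abs] at h1
    have h4 : (partialSum p j : ℚ) + partialSum p l ≤ n := by
      rcases h1 with h1 | h1 <;> linarith
    exact_mod_cast h4

theorem IsClosestToHalf.le_add {n : ℕ} {m : ℕ} {p : Fin m → ℕ} {l : Fin (m + 1)}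
    (h : IsClosestToHalf n p l) (j : Fin (m + 1))
    (hj : partialSum p l < partialSum p j) (hn : 2 * partialSum p l < n) :
    n ≤ partialSum p j + partialSum p l := by
  have hj0 : j ≠ 0 := by
    rintro rfl
    rw [partialSum, partialSum, Finset.filter_false_of_mem (s := Finset.univ)
      (p := fun i : Fin m => i.castSucc < 0) (fun i _ => Fin.not_lt_zero _),
      Finset.sum_empty] at hj
    exact Nat.not_lt_zero _ hj
  have h1 := h.2 j hj0
  have h2 : 2 * (partialSum p l : ℚ) < n := by exact_mod_cast hn
  have h3 : (partialSum p l : ℚ) < partialSum p j := by exact_mod_cast hj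
  rw [abs_of_nonpos (by linarith), le_abs] at h1
  have h4 : (n : ℚ) ≤ partialSum p j + partialSum p l := by
    rcases h1 with h1 | h1 <;> linarith
  exact_mod_cast h4

theorem exists_isClosestToHalf (n : ℕ) {m : ℕ} (hm : m ≠ 0) (p : Fin m → ℕ) :
    ∃ l, IsClosestToHalf n p l := by
  have hne : (Finset.univ.filter fun l : Fin (m + 1) => l ≠ 0).Nonempty :=
    ⟨Fin.last m, by
      rw [Finset.mem_filter]
      refine ⟨Finset.mem_univ _, fun h => hm ?_⟩
      simpa using congrArg Fin.val h⟩
  obtain ⟨l, hl, hmin⟩ := Finset.exists_min_image _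
    (fun l : Fin (m + 1) => |(partialSum p l : ℚ) - n / 2|) hne
  rw [Finset.mem_filter] at hl
  exact ⟨l, hl.2, fun j hj => hmin j (by simpa using hj)⟩

variable [FiniteDimensional k V]

/-- A flag has a basis adapted to it. -/
theorem IsFlagOfType.exists_basis {n m : ℕ} (hn : finrank k V = n)
    {F : Fin (m + 1) → Submodule k V} {p : Fin m → ℕ} (hF : IsFlagOfType F p) :
    ∃ B : Basis (Fin n) k V, ∀ i, F i = coordSpan B fun a => (a : ℕ) < partialSum p i := by
  have hmono := hF.strictMono.monotone
  obtain ⟨v, hv, hS⟩ := exists_adapted_vectors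
    (fun U => U ≤ (⊤ : Submodule k V) ∧ ∀ i, U ≤ F i ∨ F i ≤ U)
    ⟨bot_le, fun i => Or.inl bot_le⟩ n (fun U hU hlt =>
      exists_comparable_extension hmono hF.top (fun i => Or.inl le_top) U hU
        (by rwa [finrank_top, hn]))
  refine ⟨basisOfLinearIndependentOfCardEqFinrank' _ hv (by rw [Fintype.card_fin, hn]), fun i => ?_⟩
  have hle : partialSum p i ≤ n := by
    rw [← hF.finrank_eq_partialSum, ← hn]
    exact Submodule.finrank_le _
  have hspan : coordSpan (basisOfLinearIndependentOfCardEqFinrank' _ hv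
      (by rw [Fintype.card_fin, hn])) (fun a => (a : ℕ) < partialSum p i) =
      Submodule.span k (v '' Set.Iio (partialSum p i)) := by
    rw [coordSpan_eq_span, coe_basisOfLinearIndependentOfCardEqFinrank']
    congr 1
    ext w
    constructor
    · rintro ⟨a, ha, rfl⟩; exact ⟨a, ha, rfl⟩
    · rintro ⟨a, ha, rfl⟩; exact ⟨⟨a, lt_of_lt_of_le ha hle⟩, ha, rfl⟩
  rw [hspan]
  -- Every initial span is comparable with each member of the flag, so equal dimension forces
  -- equality.
  refine (eq_of_comparable_of_finrank_eq ((hS _ hle).2 i) ?_).symm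
  rw [← hspan, finrank_coordSpan_lt _ Fin.val_injective (fun t ht => ⟨⟨t, ht⟩, rfl⟩) hle,
    hF.finrank_eq_partialSum]

variable [CharZero k]

/-- The commutative polarization and the index of the nilradical of the stabilizer of a flag in the
special linear Lie algebra. -/
theorem cpIdeal_and_index_sl [FiniteDimensional k L] {n m : ℕ} (hn : finrank k V = n) {σ : L →ₗ[k] V →ₗ[k] V}
    (hinj : Function.Injective σ) (hlie : ∀ x y v, σ ⁅x, y⁆ v = σ x (σ y v) - σ y (σ x v))
    (hrange : ∀ f, (∃ x, σ x = f) ↔ LinearMap.trace k V f = 0) (q : LieSubalgebra k L)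
    {F : Fin (m + 1) → Submodule k V} {p : Fin m → ℕ} (hF : IsFlagOfType F p)
    (hq : ∀ x, x ∈ q ↔ ∀ i, ∀ v ∈ F i, σ x v ∈ F i) (l : Fin (m + 1))
    (hl : IsClosestToHalf n p l) :
    (∃ P : LieIdeal k (lieNilradical k q), IsCPIdeal k P ∧
      ∀ x : lieNilradical k q, x ∈ P ↔ (∀ v, σ x v ∈ F l) ∧ ∀ v ∈ F l, σ x v = 0) ∧
    (lieIndex k (lieNilradical k q) : ℚ) =
      2 * (partialSum p l : ℚ) * ((n : ℚ) - (partialSum p l : ℚ))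
        - 1 / 2 * ((n : ℚ) ^ 2 - ∑ i, (p i : ℚ) ^ 2) := by
  obtain ⟨B, hB⟩ := hF.exists_basis hn
  obtain ⟨c, R, hc⟩ := isRootRep_sl (matrixRep B σ) (matrixRep_injective B hinj)
    (matrixRep_lie B hlie) (matrixRep_range_sl B hrange)
  have hrank := hF.finrank_eq_partialSum
  have hd : StrictMono (partialSum p) := fun i j hij => by
    rw [← hrank, ← hrank]
    exact Submodule.finrank_lt_finrank_of_lt (hF.strictMono hij)
  have hd0 : partialSum p 0 = 0 := by rw [← hrank, hF.bot, finrank_bot]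
  have hdn : partialSum p (Fin.last m) = n := by rw [← hrank, hF.top, finrank_top, hn]
  obtain ⟨g, hg⟩ := exists_block (partialSum p) hd0 hdn
  have hgm := block_monotone hd hg
  have hlt : ∀ {a b}, g a < g b ↔ _ := fun {a b} => block_lt_iff hd hg (a := a) (b := b)
  have hqb : ∀ x, x ∈ q ↔ ∀ a b, matrixRep B σ x a b ≠ 0 → g a ≤ g b := by
    intro x
    rw [hq]
    refine Iff.trans ?_ (mem_stabilizer_iff_block_le (B := B) (σ := σ) hd hg id x)
    refine forall_congr' fun i => ?_
    rw [hB]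
    rfl
  have hN := R.mem_lieNilradical_iff q (fun a => (g a : ℕ)) hqb (fun a b a' b' hab h hle => by
    obtain ⟨rfl, rfl⟩ := hc a b a' b' hab h
    exact hle)
  have hpn : partialSum p l ≤ n := by rw [← hdn]; exact hd.monotone (Fin.le_last l)
  obtain ⟨⟨P, hP, hPmem⟩, hindex⟩ := exists_cpIdeal_sl R (matrixRep_range_sl B hrange) g hgm hqb hN
    (partialSum p l) hpn (fun a b ha hb => hlt.2 ⟨l, ha, hb⟩)
    -- Different blocks provide a flag dimension above `a` and at most `b`, hence strictly between
    -- `n - p` and `p`. The choice of `l` excludes this.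
    (fun a b hab ha hb => by
      obtain ⟨j, h1, h2⟩ := hlt.1 hab
      have h3 := hl.add_le hpn j (by omega) (by omega)
      omega)
    (fun a b hab ha hb => by
      obtain ⟨j, h1, h2⟩ := hlt.1 hab
      have h3 := hl.le_add j (by omega) (by omega)
      omega)
  refine ⟨⟨P, hP, fun x => ?_⟩, ?_⟩
  · rw [hPmem, hB l, maps_into_and_kills_coordSpan_iff]
    simp only [not_lt]
  · have hfib : ∀ i, (Finset.univ.filter fun a => g a = i).card = p i := by
      intro i
      have h1 : partialSum p i.succ = partialSum p i.castSucc + p i := by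
        rw [← hrank, ← hrank, hF.dim]
      have h2 : partialSum p i.succ ≤ n := by rw [← hdn]; exact hd.monotone (Fin.le_last _)
      simp only [block_eq_iff hd hg]
      rw [card_fin_between h2, h1, Nat.add_sub_cancel_left]
    have hcount := two_mul_card_lt_add g
    simp only [hfib, Fintype.card_fin] at hcount
    have h1 : (lieIndex k (lieNilradical k q) : ℚ) +
        ((Finset.univ.filter fun s : Fin n × Fin n => g s.1 < g s.2).card : ℚ) =
        2 * ((partialSum p l : ℚ) * ((n : ℚ) - partialSum p l)) := by
      rw [← Nat.cast_sub hpn]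
      exact_mod_cast hindex
    have h2 : 2 * ((Finset.univ.filter fun s : Fin n × Fin n => g s.1 < g s.2).card : ℚ) +
        ∑ i, (p i : ℚ) ^ 2 = (n : ℚ) ^ 2 := by exact_mod_cast hcount
    linarith

/-- Parabolic subalgebras of the special linear Lie algebra are stabilizers of flags. -/
theorem exists_flag_sl [IsAlgClosed k] {n : ℕ} (hn : finrank k V = n) {σ : L →ₗ[k] V →ₗ[k] V}
    (hinj : Function.Injective σ) (hlie : ∀ x y v, σ ⁅x, y⁆ v = σ x (σ y v) - σ y (σ x v))
    (hrange : ∀ f, (∃ x, σ x = f) ↔ LinearMap.trace k V f = 0) (q : LieSubalgebra k L)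
    (hq : IsParabolicSubalgebra k q) :
    ∃ (m : ℕ) (F : Fin (m + 1) → Submodule k V) (p : Fin m → ℕ),
      IsFlagOfType F p ∧ ∀ x, x ∈ q ↔ ∀ i, ∀ v ∈ F i, σ x v ∈ F i := by
  obtain ⟨b, hb, hbq⟩ := hq
  have hsolv : LieAlgebra.IsSolvable b := hb.1
  obtain ⟨v, hv, hS⟩ := exists_adapted_vectors
    (fun U : Submodule k V => ∀ x ∈ b, ∀ v ∈ U, σ x v ∈ U)
    (by intro x _ v hv; rw [(Submodule.mem_bot k).1 hv, map_zero]; exact Submodule.zero_mem _) n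
    (fun U hU hlt => by
      have hlt' : U < ⊤ := by
        rw [lt_top_iff_ne_top]
        rintro rfl
        rw [finrank_top] at hlt
        omega
      obtain ⟨v, -, hv, h⟩ := exists_invariant_extension σ hlie b hlt' hU (fun _ _ _ _ => trivial)
      exact ⟨v, hv, h⟩)
  set B := basisOfLinearIndependentOfCardEqFinrank' _ hv (by rw [Fintype.card_fin, hn])
  have hspan : ∀ t ≤ n, coordSpan B (fun a => (a : ℕ) < t) =
      Submodule.span k (v '' Set.Iio t) := by
    intro t ht
    rw [coordSpan_eq_span, coe_basisOfLinearIndependentOfCardEqFinrank']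
    congr 1
    ext w
    constructor
    · rintro ⟨a, ha, rfl⟩; exact ⟨a, ha, rfl⟩
    · rintro ⟨a, ha, rfl⟩; exact ⟨⟨a, lt_of_lt_of_le ha ht⟩, ha, rfl⟩
  obtain ⟨c, R, hc⟩ := isRootRep_sl (matrixRep B σ) (matrixRep_injective B hinj)
    (matrixRep_lie B hlie) (matrixRep_range_sl B hrange)
  have hup : ∀ x ∈ b, ∀ i j, matrixRep B σ x i j ≠ 0 → (i : ℕ) ≤ j := by
    intro x hx
    refine upperTriangular_of_preserves (fun a => a.2) fun t ht => ?_
    rw [hspan t ht]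
    exact hS t ht x hx
  obtain ⟨m, τ, hτ, h0, hlast, -, hmem⟩ := exists_steps R q (fun a : Fin n => (a : ℕ))
    Fin.val_injective (fun a => a.2) (fun t ht => ⟨⟨t, ht⟩, rfl⟩)
    (fun a b a' b' hab h hle => by
      obtain ⟨rfl, rfl⟩ := hc a b a' b' hab h
      exact hle)
    (fun x hx => hbq (mem_borel_of_upperTriangular R.injective R.map_lie Fin.val_injective hb
      hup x hx))
  exact ⟨m, _, _, isFlagOfType_coordSpan B Fin.val_injective (fun a => a.2)
    (fun t ht => ⟨⟨t, ht⟩, rfl⟩) hτ h0 hlast, hmem⟩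

end TypeAFlags

/-! ### Symplectic bases -/

section Symplectic

variable {k V : Type*} [Field k] [AddCommGroup V] [Module k V] {r : ℕ}

/-- The basis `B` is a symplectic basis: the matrix of the form `φ` is the standard one. -/
def IsSymplecticBasis (φ : LinearMap.BilinForm k V) (B : Basis (Fin r ⊕ Fin r) k V) : Prop :=
  ∀ a b, φ (B a) (B b) = if b = a.swap then -((spSign a : ℤ) : k) else 0

variable {φ : LinearMap.BilinForm k V} {B : Basis (Fin r ⊕ Fin r) k V}

theorem IsSymplecticBasis.apply_left (h : IsSymplecticBasis φ B) (a : Fin r ⊕ Fin r) (v : V) :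
    φ (B a) v = -((spSign a : ℤ) : k) * B.repr v a.swap := by
  conv_lhs => rw [← B.sum_repr v]
  rw [map_sum, Finset.sum_eq_single a.swap]
  · rw [map_smul, h, if_pos rfl, smul_eq_mul, mul_comm]
  · intro b _ hb
    rw [map_smul, h, if_neg hb, smul_zero]
  · simp

theorem IsSymplecticBasis.apply_right (h : IsSymplecticBasis φ B) (b : Fin r ⊕ Fin r) (v : V) :
    φ v (B b) = ((spSign b : ℤ) : k) * B.repr v b.swap := by
  conv_lhs => rw [← B.sum_repr v]
  rw [map_sum, LinearMap.sum_apply, Finset.sum_eq_single b.swap]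
  · rw [map_smul, LinearMap.smul_apply, h, if_pos (Sum.swap_swap b).symm, smul_eq_mul, spSign_swap,
      mul_comm]
    push_cast
    ring
  · intro a _ ha
    rw [map_smul, LinearMap.smul_apply, h, if_neg, smul_zero]
    rintro rfl
    exact ha (Sum.swap_swap a).symm
  · simp

theorem spSign_cast_mul_self (a : Fin r ⊕ Fin r) : ((spSign a : ℤ) : k) * (spSign a : ℤ) = 1 := by
  exact_mod_cast congrArg (Int.cast : ℤ → k) (spSign_mul_self a)

theorem spSign_cast_ne_zero (a : Fin r ⊕ Fin r) : ((spSign a : ℤ) : k) ≠ 0 :=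
  left_ne_zero_of_mul (spSign_cast_mul_self (k := k) a ▸ one_ne_zero)

theorem IsSymplecticBasis.skew_iff (h : IsSymplecticBasis φ B) (f : V →ₗ[k] V) :
    (∀ u v, φ (f u) v + φ u (f v) = 0) ↔ IsSpMatrix (LinearMap.toMatrix B B f) := by
  have h1 : (∀ u v, φ (f u) v + φ u (f v) = 0) ↔
      ∀ a b, φ (f (B a)) (B b) + φ (B a) (f (B b)) = 0 := by
    refine ⟨fun h' a b => h' _ _, fun h' => ?_⟩
    have h2 : LinearMap.comp (φ : V →ₗ[k] V →ₗ[k] k) f + LinearMap.compl₂ φ f = 0 := by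
      refine B.ext fun a => B.ext fun b => ?_
      exact h' a b
    intro u v
    exact congrFun (congrArg DFunLike.coe (congrFun (congrArg DFunLike.coe h2) u)) v
  rw [h1]
  have h2 : ∀ a b, φ (f (B a)) (B b) + φ (B a) (f (B b)) = 0 ↔
      LinearMap.toMatrix B B f b.swap a =
        (spSign a * spSign b : ℤ) * LinearMap.toMatrix B B f a.swap b := by
    intro a b
    rw [h.apply_right, h.apply_left, LinearMap.toMatrix_apply, LinearMap.toMatrix_apply]
    have h3 := spSign_cast_mul_self (k := k) b
    push_cast
    constructor
    · intro h4
      linear_combination (spSign b : k) * h4 - (B.repr (f (B a)) b.swap) * h3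
    · intro h4
      linear_combination (spSign b : k) * h4 +
        (spSign a : k) * (B.repr (f (B b)) a.swap) * h3
  simp only [h2, IsSpMatrix]
  constructor
  · intro h' a b
    have := h' a.swap b
    rw [Sum.swap_swap, spSign_swap] at this
    rw [this]
    push_cast
    ring
  · intro h' a b
    have := h' a.swap b
    rw [Sum.swap_swap, spSign_swap] at this
    rw [this]
    push_cast
    ring

/-- Pairing with a basis vector reads off, up to sign, the coordinate at the dual index. -/
theorem IsSymplecticBasis.orthogonal_coordSpan (h : IsSymplecticBasis φ B)
    (X : Fin r ⊕ Fin r → Prop) :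
    φ.orthogonal (coordSpan B X) = coordSpan B fun a => ¬ X a.swap := by
  ext v
  have h1 : v ∈ φ.orthogonal (coordSpan B X) ↔
      ∀ u ∈ coordSpan B X, φ.flip v u ∈ (⊥ : Submodule k k) := Iff.rfl
  rw [h1, forall_mem_coordSpan_apply, mem_coordSpan]
  have h2 : ∀ b, φ.flip v (B b) ∈ (⊥ : Submodule k k) ↔ B.repr v b.swap = 0 := by
    intro b
    rw [Submodule.mem_bot]
    change φ (B b) v = 0 ↔ _
    rw [h.apply_left, mul_eq_zero, neg_eq_zero]
    exact or_iff_right (spSign_cast_ne_zero b)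
  simp only [not_not, h2]
  constructor
  · intro h' a ha
    simpa using h' a.swap ha
  · intro h' b hb
    exact h' b.swap (by simpa using hb)

/-- The position of a vector of a symplectic basis in the order in which the second half follows the
first half in reverse. -/
def spIndex (a : Fin r ⊕ Fin r) : Fin (2 * r) :=
  a.elim (fun i : Fin r => ⟨i, by omega⟩) (fun i : Fin r => ⟨2 * r - 1 - i, by omega⟩)

theorem spIndex_inl (i : Fin r) : (spIndex (Sum.inl i) : ℕ) = i := rfl

theorem spIndex_inr (i : Fin r) : (spIndex (Sum.inr i) : ℕ) = 2 * r - 1 - i := rfl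

theorem spIndex_swap (a : Fin r ⊕ Fin r) :
    (spIndex a.swap : ℕ) = 2 * r - 1 - (spIndex a : ℕ) := by
  rcases a with i | i
  · rfl
  · rw [spIndex_inr, Sum.swap_inr, spIndex_inl]
    omega

theorem spIndex_injective : Function.Injective fun a : Fin r ⊕ Fin r => (spIndex a : ℕ) := by
  rintro (i | i) (j | j) h <;> simp only [spIndex_inl, spIndex_inr] at h
  · rw [Fin.ext h]
  · omega
  · omega
  · congr 1
    ext
    omega

theorem spIndex_surjective (t : ℕ) (ht : t < 2 * r) :
    ∃ a : Fin r ⊕ Fin r, (spIndex a : ℕ) = t := by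
  rcases lt_or_ge t r with h | h
  · exact ⟨Sum.inl ⟨t, h⟩, rfl⟩
  · refine ⟨Sum.inr ⟨2 * r - 1 - t, by omega⟩, ?_⟩
    rw [spIndex_inr]
    simp only
    omega

theorem IsSymplecticBasis.orthogonal_step (h : IsSymplecticBasis φ B) {t : ℕ} (ht : t ≤ 2 * r) :
    φ.orthogonal (coordSpan B fun a => (spIndex a : ℕ) < t) =
      coordSpan B fun a => (spIndex a : ℕ) < 2 * r - t := by
  rw [h.orthogonal_coordSpan]
  congr 1
  funext a
  rw [spIndex_swap, eq_iff_iff]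
  have := (spIndex a).2
  omega

theorem coordSpan_isLeft (B : Basis (Fin r ⊕ Fin r) k V) :
    coordSpan B (fun a => a.isLeft) = coordSpan B fun a => (spIndex a : ℕ) < r := by
  congr 1
  funext a
  rw [eq_iff_iff]
  rcases a with i | i
  · simp [spIndex_inl]
  · simp only [Sum.isLeft_inr, spIndex_inr]
    constructor
    · intro h; simp at h
    · intro h; omega

variable [FiniteDimensional k V]

/-- A basis of a Lagrangian subspace is half of a symplectic basis. -/
theorem exists_symplectic_basis [CharZero k] (halt : φ.IsAlt) (hnd : φ.Nondegenerate)
    (hn : finrank k V = 2 * r) (v : Fin r → V) (hv : LinearIndependent k v)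
    (hiso : ∀ i j, φ (v i) (v j) = 0) :
    ∃ B : Basis (Fin r ⊕ Fin r) k V, IsSymplecticBasis φ B ∧ ∀ i, B (Sum.inl i) = v i := by
  -- A functional vanishing on the range is a combination of the `v i` orthogonal to everything;
  -- nondegeneracy and independence make it zero.
  have hsurj : Function.Surjective (LinearMap.pi fun i => φ (v i) : V →ₗ[k] (Fin r → k)) := by
    rw [← LinearMap.range_eq_top]
    by_contra hne
    obtain ⟨g, hg, hg0⟩ := Submodule.exists_le_ker_of_lt_top _ (lt_top_iff_ne_top.2 hne)
    have h1 : ∑ i, g (Pi.single i 1) • v i = 0 := by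
      refine hnd.1 _ fun u => ?_
      rw [map_sum, LinearMap.sum_apply]
      have h2 : g ((LinearMap.pi fun i => φ (v i) : V →ₗ[k] (Fin r → k)) u) = 0 :=
        hg0 ⟨u, rfl⟩
      rw [LinearMap.pi_apply_eq_sum_univ] at h2
      rw [← h2]
      refine Finset.sum_congr rfl fun i _ => ?_
      rw [map_smul, LinearMap.smul_apply, smul_eq_mul, smul_eq_mul, mul_comm, LinearMap.pi_apply,
        show (fun j => if i = j then (1 : k) else 0) = Pi.single i 1 by
          funext j; simp [Pi.single_apply, eq_comm]]
    have h2 := Fintype.linearIndependent_iff.1 hv _ h1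
    refine hg ?_
    refine (Pi.basisFun k (Fin r)).ext fun i => ?_
    rw [Pi.basisFun_apply, h2 i, LinearMap.zero_apply]
  choose u hu using fun j : Fin r => hsurj (-Pi.single j 1)
  have hvu : ∀ i j, φ (v i) (u j) = if i = j then -1 else 0 := by
    intro i j
    have := congrFun (hu j) i
    rw [LinearMap.pi_apply, Pi.neg_apply, Pi.single_apply] at this
    rw [this]
    split_ifs <;> simp
  have hneg : ∀ x y, φ x y = -φ y x := fun x y => (halt.neg_eq x y).symm ▸ by simp [halt.neg_eq]
  have huv : ∀ i j, φ (u i) (v j) = if i = j then 1 else 0 := by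
    intro i j
    rw [hneg, hvu]
    by_cases h : i = j
    · simp [h]
    · rw [if_neg h, if_neg (Ne.symm h), neg_zero]
  -- Half of the defect `φ (u i) (u j)` is absorbed by each argument. Since the `v i` are isotropic,
  -- the pairings with them do not change.
  let w : Fin r → V := fun j => u j + ∑ i, (-(φ (u i) (u j)) / 2) • v i
  have hvw : ∀ i j, φ (v i) (w j) = if i = j then -1 else 0 := by
    intro i j
    simp only [w, map_add, map_sum, map_smul, hiso, smul_zero, Finset.sum_const_zero, add_zero, hvu]
  have hwv : ∀ i j, φ (w i) (v j) = if i = j then 1 else 0 := by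
    intro i j
    rw [hneg, hvw]
    by_cases h : i = j
    · simp [h]
    · rw [if_neg h, if_neg (Ne.symm h), neg_zero]
  have hww : ∀ i j, φ (w i) (w j) = 0 := by
    intro i j
    have h1 : φ (w i) (w j) = φ (w i) (u j) + ∑ t, (-(φ (u t) (u j)) / 2) * φ (w i) (v t) := by
      simp only [w, map_add, map_sum, map_smul, smul_eq_mul]
    have h2 : φ (w i) (u j) = φ (u i) (u j) + ∑ t, (-(φ (u t) (u i)) / 2) * φ (v t) (u j) := by
      simp only [w, map_add, map_sum, map_smul, smul_eq_mul, LinearMap.add_apply,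
        LinearMap.sum_apply, LinearMap.smul_apply]
    simp only [hwv, mul_ite, mul_one, mul_zero, Finset.sum_ite_eq, Finset.mem_univ, if_true] at h1
    simp only [hvu, mul_ite, mul_neg, mul_one, mul_zero, Finset.sum_ite_eq', Finset.mem_univ,
      if_true] at h2
    rw [h1, h2, hneg (u j) (u i)]
    ring
  have hgram : ∀ a b, φ (Sum.elim v w a) (Sum.elim v w b) =
      if b = a.swap then -((spSign a : ℤ) : k) else 0 := by
    rintro (i | i) (j | j)
    · simp [hiso]
    · simp [hvw, spSign, eq_comm]
    · simp [hwv, spSign, eq_comm]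
    · simp [hww]
  have hli : LinearIndependent k (Sum.elim v w) := by
    rw [Fintype.linearIndependent_iff]
    intro t ht a
    have h1 : φ (∑ b, t b • Sum.elim v w b) (Sum.elim v w a.swap) = 0 := by rw [ht]; simp
    rw [map_sum, LinearMap.sum_apply, Finset.sum_eq_single a] at h1
    · rw [map_smul, LinearMap.smul_apply, hgram, if_pos rfl, smul_eq_mul] at h1
      exact (mul_eq_zero.1 h1).resolve_right (neg_ne_zero.2 (spSign_cast_ne_zero a))
    · intro b _ hb
      rw [map_smul, LinearMap.smul_apply, hgram, if_neg, smul_zero]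
      intro h
      exact hb (by simpa using (congrArg Sum.swap h).symm)
    · simp
  refine ⟨basisOfLinearIndependentOfCardEqFinrank' _ hli
    (by rw [Fintype.card_sum, Fintype.card_fin, hn, two_mul]), ?_, ?_⟩
  · intro a b
    rw [coe_basisOfLinearIndependentOfCardEqFinrank']
    exact hgram a b
  · intro i
    rw [coe_basisOfLinearIndependentOfCardEqFinrank']
    rfl

end Symplectic

/-! ### Isotropic flags and parabolic subalgebras in type C -/

section TypeCFlags

variable {k L V : Type*} [Field k] [LieRing L] [LieAlgebra k L] [AddCommGroup V] [Module k V] {r : ℕ}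
  {φ : LinearMap.BilinForm k V}

theorem matrixRep_range_sp {B : Basis (Fin r ⊕ Fin r) k V} (hB : IsSymplecticBasis φ B)
    {σ : L →ₗ[k] V →ₗ[k] V}
    (hrange : ∀ f, (∃ x, σ x = f) ↔ ∀ u v, φ (f u) v + φ u (f v) = 0)
    (A : Matrix (Fin r ⊕ Fin r) (Fin r ⊕ Fin r) k) :
    (∃ x, matrixRep B σ x = A) ↔ IsSpMatrix A := by
  have h1 : IsSpMatrix A ↔ ∃ x, σ x = Matrix.toLin B B A := by
    rw [hrange, hB.skew_iff, LinearMap.toMatrix_toLin]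
  rw [h1]
  refine exists_congr fun x => ?_
  rw [matrixRep_eq]
  constructor
  · intro h
    rw [← h, Matrix.toLin_toMatrix]
  · intro h
    rw [h, LinearMap.toMatrix_toLin]

theorem coordSpan_spIndex_lt {B : Basis (Fin r ⊕ Fin r) k V} {v : ℕ → V}
    (hB : ∀ i : Fin r, B (Sum.inl i) = v i) {t : ℕ} (ht : t ≤ r) :
    coordSpan B (fun a => (spIndex a : ℕ) < t) = Submodule.span k (v '' Set.Iio t) := by
  rw [coordSpan_eq_span]
  congr 1
  ext w
  constructor
  · rintro ⟨a | a, ha, rfl⟩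
    · exact ⟨a, ha, (hB a).symm⟩
    · have h1 : (spIndex (Sum.inr a) : ℕ) < t := ha
      rw [spIndex_inr] at h1
      omega
  · rintro ⟨a, ha, rfl⟩
    exact ⟨Sum.inl ⟨a, lt_of_lt_of_le ha ht⟩, ha, hB _⟩

theorem le_orthogonal_sup_span (halt : φ.IsAlt) {U : Submodule k V} (hU : U ≤ φ.orthogonal U)
    {v : V} (hv : v ∈ φ.orthogonal U) :
    U ⊔ Submodule.span k {v} ≤ φ.orthogonal (U ⊔ Submodule.span k {v}) := by
  intro x hx y hy
  obtain ⟨u, hu, a, ha, rfl⟩ := Submodule.mem_sup.1 hx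
  obtain ⟨u', hu', a', ha', rfl⟩ := Submodule.mem_sup.1 hy
  obtain ⟨s, rfl⟩ := Submodule.mem_span_singleton.1 ha
  obtain ⟨s', rfl⟩ := Submodule.mem_span_singleton.1 ha'
  have h1 : φ u' u = 0 := hU hu u' hu'
  have h2 : φ u' v = 0 := hv u' hu'
  have h3 : φ v u = 0 := by rw [← halt.neg_eq, show φ u v = 0 from hv u hu, neg_zero]
  have h4 : φ v v = 0 := halt v
  change φ (u' + s' • v) (u + s • v) = 0
  simp [h1, h2, h3, h4]

variable [FiniteDimensional k V]

/-- An isotropic subspace is contained in a Lagrangian subspace. -/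
theorem exists_lagrangian (halt : φ.IsAlt) {U : Submodule k V} (hU : U ≤ φ.orthogonal U) :
    ∃ W, U ≤ W ∧ φ.orthogonal W = W := by
  obtain ⟨W, ⟨hUW, hW⟩, hmax⟩ := (wellFounded_gt (α := Submodule k V)).has_min
    {W | U ≤ W ∧ W ≤ φ.orthogonal W} ⟨U, le_rfl, hU⟩
  refine ⟨W, hUW, le_antisymm (fun v hv => ?_) hW⟩
  by_contra hvW
  refine hmax (W ⊔ Submodule.span k {v}) ⟨hUW.trans le_sup_left, le_orthogonal_sup_span halt hW hv⟩ ?_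
  refine lt_of_le_of_ne le_sup_left fun h => hvW ?_
  rw [h]
  exact Submodule.mem_sup_right (Submodule.mem_span_singleton_self _)

variable [CharZero k]

/-- An isotropic flag and a Lagrangian subspace containing its lower half have a common adapted
symplectic basis. -/
theorem IsFlagOfType.exists_symplectic_basis (halt : φ.IsAlt) (hnd : φ.Nondegenerate)
    (hn : finrank k V = 2 * r) {m : ℕ} {F : Fin (m + 1) → Submodule k V} {p : Fin m → ℕ}
    (hF : IsFlagOfType F p) (hiso : IsIsotropicFlag φ F) {W : Submodule k V}
    (hW : φ.orthogonal W = W) {s : Fin (m + 1)} (hs : (s : ℕ) = m / 2) (hFW : F s ≤ W) :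
    ∃ B : Basis (Fin r ⊕ Fin r) k V, IsSymplecticBasis φ B ∧
      (∀ i, F i = coordSpan B fun a => (spIndex a : ℕ) < partialSum p i) ∧
      W = coordSpan B fun a => a.isLeft := by
  have hmono := hF.strictMono.monotone
  have hWr : finrank k W = r := by
    have h1 := LinearMap.BilinForm.finrank_orthogonal hnd W
    have h2 := Submodule.finrank_le W
    rw [hW, hn] at h1
    rw [hn] at h2
    omega
  have hlow : ∀ i : Fin (m + 1), (i : ℕ) ≤ m / 2 → F i ≤ W := fun i hi =>
    (hmono (Fin.le_def.2 (hs ▸ hi))).trans hFW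
  -- Dualize the lower half: `W = W^⊥` contains `F i.rev`, whose orthogonal is `F i`.
  have hhigh : ∀ i : Fin (m + 1), m / 2 < (i : ℕ) → W ≤ F i := by
    intro i hi
    have h1 : F i.rev ≤ W := hlow _ (by rw [Fin.val_rev]; omega)
    have h2 := LinearMap.BilinForm.orthogonal_le (B := φ) h1
    rwa [hW, hiso, Fin.rev_rev] at h2
  obtain ⟨v, hv, hS⟩ := exists_adapted_vectors
    (fun U => U ≤ W ∧ ∀ i, U ≤ F i ∨ F i ≤ U)
    ⟨bot_le, fun i => Or.inl bot_le⟩ r (fun U hU hlt =>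
      exists_comparable_extension hmono hF.top
        (fun i => (le_or_gt (i : ℕ) (m / 2)).imp (hlow i) (hhigh i)) U hU (by rwa [hWr]))
  have hvW : ∀ i : Fin r, v i ∈ W := fun i =>
    (hS r le_rfl).1 (Submodule.subset_span ⟨i, i.2, rfl⟩)
  obtain ⟨B, hB, hBv⟩ := _root_.exists_symplectic_basis halt hnd hn (fun i : Fin r => v i) hv
    (fun i j => by
      have h1 := hvW j
      rw [← hW] at h1
      exact h1 _ (hvW i))
  have hstep := fun t ht => finrank_coordSpan_lt B spIndex_injective spIndex_surjective (t := t) ht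
  have hspan := fun t ht => coordSpan_spIndex_lt (k := k) hBv (t := t) ht
  have hdim := hF.finrank_eq_partialSum
  have hFlow : ∀ i : Fin (m + 1), (i : ℕ) ≤ m / 2 →
      F i = coordSpan B fun a => (spIndex a : ℕ) < partialSum p i := by
    intro i hi
    have hle : partialSum p i ≤ r := by
      rw [← hdim, ← hWr]
      exact Submodule.finrank_mono (hlow i hi)
    rw [hspan _ hle]
    refine (eq_of_comparable_of_finrank_eq ((hS _ hle).2 i) ?_).symm
    rw [← hspan _ hle, hstep _ (by omega), hdim]
  refine ⟨B, hB, fun i => ?_, ?_⟩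
  · rcases le_or_gt (i : ℕ) (m / 2) with hi | hi
    · exact hFlow i hi
    · have h1 : F i = φ.orthogonal (F i.rev) := by rw [hiso, Fin.rev_rev]
      have h2 : partialSum p i.rev ≤ 2 * r := by
        rw [← hdim, ← hn]
        exact Submodule.finrank_le _
      have h3 : F i = coordSpan B fun a => (spIndex a : ℕ) < 2 * r - partialSum p i.rev := by
        rw [h1, hFlow i.rev (by rw [Fin.val_rev]; omega), hB.orthogonal_step h2]
      have h4 : partialSum p i = 2 * r - partialSum p i.rev := by
        rw [← hdim i, h3, hstep _ (Nat.sub_le _ _)]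
      rw [h4]
      exact h3
  · rw [coordSpan_isLeft, hspan r le_rfl]
    refine (Submodule.eq_of_le_of_finrank_eq (hS r le_rfl).1 ?_).symm
    rw [← hspan r le_rfl, hstep r (by omega), hWr]

/-- The commutative polarization and the index of the nilradical of the stabilizer of an isotropic
flag in the symplectic Lie algebra. -/
theorem cpIdeal_and_index_sp [FiniteDimensional k L] (halt : φ.IsAlt) (hnd : φ.Nondegenerate)
    (hn : finrank k V = 2 * r) {σ : L →ₗ[k] V →ₗ[k] V}
    (hinj : Function.Injective σ) (hlie : ∀ x y v, σ ⁅x, y⁆ v = σ x (σ y v) - σ y (σ x v))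
    (hrange : ∀ f, (∃ x, σ x = f) ↔ ∀ u v, φ (f u) v + φ u (f v) = 0) (q : LieSubalgebra k L)
    {m : ℕ} {F : Fin (m + 1) → Submodule k V} {p : Fin m → ℕ} (hF : IsFlagOfType F p)
    (hiso : IsIsotropicFlag φ F) (hq : ∀ x, x ∈ q ↔ ∀ i, ∀ v ∈ F i, σ x v ∈ F i)
    {W : Submodule k V} (hW : φ.orthogonal W = W) {s : Fin (m + 1)}
    (hs : (s : ℕ) = m / 2) (hFW : F s ≤ W) :
    (∃ P : LieIdeal k (lieNilradical k q), IsCPIdeal k P ∧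
      ∀ x : lieNilradical k q, x ∈ P ↔ (∀ v, σ x v ∈ W) ∧ ∀ v ∈ W, σ x v = 0) ∧
    2 * lieIndex k (lieNilradical k q) = ∑ i : Fin m with i.val < m / 2, p i * (p i + 1) := by
  obtain ⟨B, hB, hFB, hWB⟩ := hF.exists_symplectic_basis halt hnd hn hiso hW hs hFW
  obtain ⟨c, R, hc⟩ := isRootRep_sp (matrixRep B σ) (matrixRep_injective B hinj)
    (matrixRep_lie B hlie) (matrixRep_range_sp hB hrange)
  have hrank := hF.finrank_eq_partialSum
  have hd : StrictMono (partialSum p) := fun i j hij => by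
    rw [← hrank, ← hrank]
    exact Submodule.finrank_lt_finrank_of_lt (hF.strictMono hij)
  have hd0 : partialSum p 0 = 0 := by rw [← hrank, hF.bot, finrank_bot]
  have hdn : partialSum p (Fin.last m) = 2 * r := by rw [← hrank, hF.top, finrank_top, hn]
  have hdle : ∀ i, partialSum p i ≤ 2 * r := fun i => hdn ▸ hd.monotone (Fin.le_last i)
  have hdrev : ∀ i, partialSum p i.rev = 2 * r - partialSum p i := by
    intro i
    rw [← hrank, ← hrank, ← hiso i, LinearMap.BilinForm.finrank_orthogonal hnd, hn]
  obtain ⟨g, hg⟩ := exists_block (partialSum p) hd0 hdn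
  have hgm := block_monotone hd hg
  have hgswap : ∀ a : Fin r ⊕ Fin r, g (spIndex a.swap) = (g (spIndex a)).rev := by
    intro a
    rw [block_eq_iff hd hg, ← Fin.rev_succ, ← Fin.rev_castSucc, hdrev, hdrev, spIndex_swap]
    have h1 := hg (spIndex a)
    have h2 := (spIndex a).2
    have h3 := hdle (g (spIndex a)).succ
    omega
  have hswap : ∀ a : Fin r ⊕ Fin r,
      (g (spIndex a) : ℕ) + (g (spIndex a.swap) : ℕ) = m - 1 := by
    intro a
    rw [hgswap, Fin.val_rev]
    have := (g (spIndex a)).2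
    omega
  have hle : ∀ i j : Fin r, (g (spIndex (Sum.inl i)) : ℕ) ≤ g (spIndex (Sum.inr j)) := by
    intro i j
    refine hgm (Fin.le_def.2 ?_)
    rw [spIndex_inl, spIndex_inr]
    omega
  have hqb : ∀ x, x ∈ q ↔ ∀ a b, matrixRep B σ x a b ≠ 0 →
      (g (spIndex a) : ℕ) ≤ g (spIndex b) := by
    intro x
    rw [hq]
    refine Iff.trans ?_ (mem_stabilizer_iff_block_le (B := B) (σ := σ) hd hg spIndex x)
    refine forall_congr' fun i => ?_
    rw [hFB]
  have hN := R.mem_lieNilradical_iff q (fun a => (g (spIndex a) : ℕ)) hqb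
    (fun a b a' b' hab h hle => by
      have h1 := hswap a
      have h2 := hswap b
      rcases hc a b a' b' hab h with ⟨rfl, rfl⟩ | ⟨rfl, rfl⟩
      · exact hle
      · omega)
  obtain ⟨⟨P, hP, hPmem⟩, hindex⟩ := exists_cpIdeal_sp R (matrixRep_range_sp hB hrange)
    (fun a => (g (spIndex a) : ℕ)) hswap hle hqb hN
  refine ⟨⟨P, hP, fun x => ?_⟩, ?_⟩
  · rw [hPmem, hWB, maps_into_and_kills_coordSpan_iff]
    simp
  · set c' : Fin r → ℕ := fun i => (g (spIndex (Sum.inl i)) : ℕ)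
    have hmono : Monotone c' := by
      intro i j hij
      exact hgm (Fin.le_def.2 hij)
    have hcount := sum_card_fiber_sq_of_monotone (m := m / 2) c' hmono
    -- The dual index of block `t` lies in block `m - 1 - t`. For two indices in one block the
    -- position is excluded only when that block is its own mirror, the middle block of odd `m`.
    have hSB : (Finset.univ.filter fun s : Fin r × Fin r =>
        s.1 ≤ s.2 ∧ (g (spIndex (Sum.inl s.1)) : ℕ) < (g (spIndex (Sum.inr s.2)) : ℕ)) =
        Finset.univ.filter fun s : Fin r × Fin r =>
          s.1 ≤ s.2 ∧ (c' s.1 < c' s.2 ∨ c' s.2 < m / 2) := by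
      refine Finset.filter_congr fun s _ => and_congr_right fun hs => ?_
      have h1 := hswap (Sum.inl s.2)
      have h2 := hle s.2 s.2
      have h3 : c' s.1 ≤ c' s.2 := hmono hs
      have h4 := (g (spIndex (Sum.inl s.2))).2
      rw [Sum.swap_inl] at h1
      simp only [c'] at h3 ⊢
      omega
    rw [hSB] at hindex
    have hsum : ∑ t ∈ Finset.range (m / 2), (Finset.univ.filter fun i => c' i = t).card *
        ((Finset.univ.filter fun i => c' i = t).card + 1) =
        ∑ i : Fin m with i.val < m / 2, p i * (p i + 1) := by
      symm
      refine Finset.sum_bij (fun i _ => (i : ℕ)) ?_ ?_ ?_ ?_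
      · intro i hi
        simpa using hi
      · intro i _ j _ h
        exact Fin.ext h
      · intro t ht
        rw [Finset.mem_range] at ht
        exact ⟨⟨t, by omega⟩, by simpa using ht, rfl⟩
      · intro i hi
        have hi' : (i : ℕ) < m / 2 := by simpa using hi
        have h1 : partialSum p i.succ = partialSum p i.castSucc + p i := by
          rw [← hrank, ← hrank, hF.dim]
        -- Blocks below the middle lie in the first half of the basis, so all their positions are
        -- counted.
        have h2 : partialSum p i.succ ≤ r := by
          have h3 : i.succ ≤ i.succ.rev := by
            rw [Fin.le_def, Fin.val_rev, Fin.val_succ]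
            omega
          have h4 := hd.monotone h3
          rw [hdrev] at h4
          have := hdle i.succ
          omega
        have h3 : (Finset.univ.filter fun j => c' j = (i : ℕ)).card = p i := by
          have h4 : ∀ j : Fin r, c' j = (i : ℕ) ↔
              partialSum p i.castSucc ≤ j ∧ (j : ℕ) < partialSum p i.succ := by
            intro j
            rw [← spIndex_inl j, ← block_eq_iff hd hg, Fin.ext_iff]
          simp only [h4]
          rw [card_fin_between h2, h1, Nat.add_sub_cancel_left]
        rw [h3]
    rw [hsum] at hcount
    simp only [c'] at hcount hindex
    omega

/-- Parabolic subalgebras of the symplectic Lie algebra are stabilizers of isotropic flags. -/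
theorem exists_flag_sp [IsAlgClosed k] (halt : φ.IsAlt) (hnd : φ.Nondegenerate)
    (hn : finrank k V = 2 * r) {σ : L →ₗ[k] V →ₗ[k] V}
    (hinj : Function.Injective σ) (hlie : ∀ x y v, σ ⁅x, y⁆ v = σ x (σ y v) - σ y (σ x v))
    (hrange : ∀ f, (∃ x, σ x = f) ↔ ∀ u v, φ (f u) v + φ u (f v) = 0) (q : LieSubalgebra k L)
    (hq : IsParabolicSubalgebra k q) :
    ∃ (m : ℕ) (F : Fin (m + 1) → Submodule k V) (p : Fin m → ℕ),
      IsFlagOfType F p ∧ IsIsotropicFlag φ F ∧ ∀ x, x ∈ q ↔ ∀ i, ∀ v ∈ F i, σ x v ∈ F i := by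
  obtain ⟨b, hb, hbq⟩ := hq
  have hsolv : LieAlgebra.IsSolvable b := hb.1
  have horth : ∀ (x : L) (U : Submodule k V), (∀ v ∈ U, σ x v ∈ U) →
      ∀ v ∈ φ.orthogonal U, σ x v ∈ φ.orthogonal U := by
    intro x U hU v hv u hu
    have h1 := (hrange (σ x)).1 ⟨x, rfl⟩ u v
    have h2 : φ (σ x u) v = 0 := hv _ (hU u hu)
    rw [h2, zero_add] at h1
    exact h1
  obtain ⟨v, hv, hS⟩ := exists_adapted_vectors
    (fun U : Submodule k V => U ≤ φ.orthogonal U ∧ ∀ x ∈ b, ∀ v ∈ U, σ x v ∈ U)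
    ⟨bot_le, by
      intro x _ v hv; rw [(Submodule.mem_bot k).1 hv, map_zero]; exact Submodule.zero_mem _⟩ r
    -- Apply Lie's theorem between `U` and its orthogonal, which is invariant because `L` acts by
    -- skew maps. A vector orthogonal to `U` keeps the extension isotropic.
    (fun U hU hlt => by
      have hlt' : U < φ.orthogonal U := by
        refine lt_of_le_of_ne hU.1 fun h => ?_
        have h1 := LinearMap.BilinForm.finrank_orthogonal hnd U
        rw [← h, hn] at h1
        omega
      obtain ⟨v, hvU, hv, h⟩ := exists_invariant_extension σ hlie b hlt' hU.2
        (fun x hx => horth x U (hU.2 x hx))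
      exact ⟨v, hv, le_orthogonal_sup_span halt hU.1 hvU, h⟩)
  have hvS : ∀ i : Fin r, v i ∈ Submodule.span k (v '' Set.Iio r) := fun i =>
    Submodule.subset_span ⟨i, i.2, rfl⟩
  obtain ⟨B, hB, hBv⟩ := exists_symplectic_basis halt hnd hn (fun i : Fin r => v i) hv
    (fun i j => (hS r le_rfl).1 (hvS j) _ (hvS i))
  have hstep : ∀ x ∈ b, ∀ t ≤ 2 * r, ∀ w ∈ coordSpan B (fun a => (spIndex a : ℕ) < t),
      σ x w ∈ coordSpan B fun a => (spIndex a : ℕ) < t := by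
    intro x hx t ht
    rcases le_or_gt t r with h | h
    · rw [coordSpan_spIndex_lt hBv h]
      exact (hS t h).2 x hx
    · have h1 := hB.orthogonal_step (t := 2 * r - t) (by omega)
      rw [show 2 * r - (2 * r - t) = t by omega] at h1
      rw [← h1, coordSpan_spIndex_lt hBv (t := 2 * r - t) (by omega)]
      exact horth x _ ((hS _ (by omega)).2 x hx)
  obtain ⟨c, R, hc⟩ := isRootRep_sp (matrixRep B σ) (matrixRep_injective B hinj)
    (matrixRep_lie B hlie) (matrixRep_range_sp hB hrange)
  have hup : ∀ x ∈ b, ∀ i j, matrixRep B σ x i j ≠ 0 → (spIndex i : ℕ) ≤ spIndex j := by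
    intro x hx
    exact upperTriangular_of_preserves (fun a => (spIndex a).2) (hstep x hx)
  obtain ⟨m, τ, hτ, h0, hlast, hτq, hmem⟩ := exists_steps R q
    (fun a : Fin r ⊕ Fin r => (spIndex a : ℕ))
    spIndex_injective (fun a => (spIndex a).2) spIndex_surjective
    (fun a b a' b' hab h hle => by
      have h1 := spIndex_swap a
      have h2 := spIndex_swap b
      rcases hc a b a' b' hab h with ⟨rfl, rfl⟩ | ⟨rfl, rfl⟩
      · exact hle
      · omega)
    (fun x hx => hbq (mem_borel_of_upperTriangular R.injective R.map_lie spIndex_injective hb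
      hup x hx))
  have hτle : ∀ i, τ i ≤ 2 * r := fun i => ((hτq _).1 ⟨i, rfl⟩).1
  -- The set of preserved dimensions is symmetric under `t ↦ 2 * r - t`, by taking orthogonals. A
  -- strictly increasing enumeration is determined by its range.
  have hτrev : ∀ i, τ i.rev = 2 * r - τ i := by
    have hmono' : StrictMono fun i : Fin (m + 1) => 2 * r - τ i.rev := by
      intro i j hij
      have h1 := hτ (Fin.rev_lt_rev.2 hij)
      have h2 := hτle i.rev
      simp only
      omega
    have hsub : ∀ i, ∃ j, τ j = 2 * r - τ i := by
      intro i
      refine (hτq _).2 ⟨Nat.sub_le _ _, fun y hy => ?_⟩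
      rw [← hB.orthogonal_step (hτle i)]
      exact horth y _ (((hτq _).1 ⟨i, rfl⟩).2 y hy)
    have heq : (fun i : Fin (m + 1) => 2 * r - τ i.rev) = τ := by
      refine (hmono'.range_inj hτ).1 ?_
      ext t
      constructor
      · rintro ⟨i, rfl⟩
        exact hsub i.rev
      · rintro ⟨i, rfl⟩
        obtain ⟨j, hj⟩ := hsub i
        refine ⟨j.rev, ?_⟩
        have := hτle i
        simp only [Fin.rev_rev]
        omega
    intro i
    have h1 := congrFun heq i
    have h2 := hτle i.rev
    change 2 * r - τ i.rev = τ i at h1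
    omega
  refine ⟨m, _, _, isFlagOfType_coordSpan B spIndex_injective (fun a => (spIndex a).2)
    spIndex_surjective hτ h0 hlast, fun i => ?_, hmem⟩
  change φ.orthogonal (coordSpan B fun a => (spIndex a : ℕ) < τ i) =
    coordSpan B fun a => (spIndex a : ℕ) < τ i.rev
  rw [hB.orthogonal_step (hτle i), hτrev]

end TypeCFlags

/-! ### The classical matrix algebras as algebras of endomorphisms -/

section Identification

open LieAlgebra.SpecialLinear LieAlgebra.Symplectic

attribute [local instance 100] LieRing.ofAssociativeRing

variable {k : Type*} [Field k] {L : Type*} [LieRing L] [LieAlgebra k L] {r : ℕ}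

/-- The action of `L` on `k ^ (r + 1)` as a linear map. -/
def TypeAIso.linearAct (e : TypeAIso r k L) :
    L →ₗ[k] (Fin (r + 1) → k) →ₗ[k] (Fin (r + 1) → k) :=
  (Matrix.toLin'.toLinearMap).comp
    ((sl (Fin (r + 1)) k).toSubmodule.subtype.comp (e : L →ₗ[k] sl (Fin (r + 1)) k))

theorem TypeAIso.linearAct_apply (e : TypeAIso r k L) (x : L) : e.linearAct x = e.act x := rfl

theorem TypeAIso.linearAct_injective (e : TypeAIso r k L) : Function.Injective e.linearAct :=
  Matrix.toLin'.injective.comp (Subtype.val_injective.comp e.injective)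

theorem TypeAIso.linearAct_lie (e : TypeAIso r k L) (x y : L) (v : Fin (r + 1) → k) :
    e.linearAct ⁅x, y⁆ v = e.linearAct x (e.linearAct y v) - e.linearAct y (e.linearAct x v) := by
  simp only [TypeAIso.linearAct_apply, TypeAIso.act]
  rw [LieEquiv.map_lie, sl_bracket, map_sub, Matrix.toLin'_mul, Matrix.toLin'_mul]
  rfl

theorem TypeAIso.exists_linearAct_eq (e : TypeAIso r k L)
    (f : (Fin (r + 1) → k) →ₗ[k] (Fin (r + 1) → k)) :
    (∃ x, e.linearAct x = f) ↔ LinearMap.trace k _ f = 0 := by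
  have h1 : ∀ A : Matrix (Fin (r + 1)) (Fin (r + 1)) k, A ∈ sl (Fin (r + 1)) k ↔ A.trace = 0 :=
    fun A => Iff.rfl
  have h2 : LinearMap.trace k _ f = (LinearMap.toMatrix' f).trace := by
    rw [LinearMap.trace_eq_matrix_trace k (Pi.basisFun k (Fin (r + 1))),
      LinearMap.toMatrix_eq_toMatrix']
  rw [h2, ← h1]
  constructor
  · rintro ⟨x, rfl⟩
    rw [TypeAIso.linearAct_apply, TypeAIso.act, LinearMap.toMatrix'_toLin']
    exact (e x).2
  · intro h
    refine ⟨e.symm ⟨_, h⟩, ?_⟩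
    rw [TypeAIso.linearAct_apply, TypeAIso.act, LieEquiv.apply_symm_apply, Matrix.toLin'_toMatrix']

theorem TypeAIso.finiteDimensional (e : TypeAIso r k L) : FiniteDimensional k L :=
  Module.Finite.of_injective _ e.linearAct_injective

/-- The action of `L` on `k ^ (2 r)` as a linear map. -/
def TypeCIso.linearAct (e : TypeCIso r k L) :
    L →ₗ[k] (Fin r ⊕ Fin r → k) →ₗ[k] (Fin r ⊕ Fin r → k) :=
  (Matrix.toLin'.toLinearMap).comp
    ((sp (Fin r) k).toSubmodule.subtype.comp (e : L →ₗ[k] sp (Fin r) k))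

theorem TypeCIso.linearAct_apply (e : TypeCIso r k L) (x : L) : e.linearAct x = e.act x := rfl

theorem TypeCIso.linearAct_injective (e : TypeCIso r k L) : Function.Injective e.linearAct :=
  Matrix.toLin'.injective.comp (Subtype.val_injective.comp e.injective)

theorem TypeCIso.linearAct_lie (e : TypeCIso r k L) (x y : L) (v : Fin r ⊕ Fin r → k) :
    e.linearAct ⁅x, y⁆ v = e.linearAct x (e.linearAct y v) - e.linearAct y (e.linearAct x v) := by
  simp only [TypeCIso.linearAct_apply, TypeCIso.act]
  rw [LieEquiv.map_lie, LieSubalgebra.coe_bracket, Ring.lie_def, map_sub, Matrix.toLin'_mul,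
    Matrix.toLin'_mul]
  rfl

theorem mem_sp_iff (A : Matrix (Fin r ⊕ Fin r) (Fin r ⊕ Fin r) k) :
    A ∈ sp (Fin r) k ↔ ∀ u v, symplecticForm r k (Matrix.toLin' A u) v +
      symplecticForm r k u (Matrix.toLin' A v) = 0 := by
  rw [sp, mem_skewAdjointMatricesLieSubalgebra, mem_skewAdjointMatricesSubmodule,
    Matrix.IsSkewAdjoint, ← isAdjointPair_toLinearMap₂']
  refine forall_congr' fun u => forall_congr' fun v => ?_
  rw [symplecticForm, map_neg]
  simp only [LinearMap.neg_apply, map_neg]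
  exact eq_neg_iff_add_eq_zero

theorem TypeCIso.exists_linearAct_eq (e : TypeCIso r k L)
    (f : (Fin r ⊕ Fin r → k) →ₗ[k] (Fin r ⊕ Fin r → k)) :
    (∃ x, e.linearAct x = f) ↔
      ∀ u v, symplecticForm r k (f u) v + symplecticForm r k u (f v) = 0 := by
  constructor
  · rintro ⟨x, rfl⟩
    exact (mem_sp_iff _).1 (e x).2
  · intro h
    rw [← Matrix.toLin'_toMatrix' f, ← mem_sp_iff] at h
    refine ⟨e.symm ⟨_, h⟩, ?_⟩
    rw [TypeCIso.linearAct_apply, TypeCIso.act, LieEquiv.apply_symm_apply, Matrix.toLin'_toMatrix']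

theorem TypeCIso.finiteDimensional (e : TypeCIso r k L) : FiniteDimensional k L :=
  Module.Finite.of_injective _ e.linearAct_injective

theorem isSymplecticBasis_basisFun :
    IsSymplecticBasis (symplecticForm r k) (Pi.basisFun k (Fin r ⊕ Fin r)) := by
  intro a b
  rw [symplecticForm, Pi.basisFun_apply, Pi.basisFun_apply, Matrix.toBilin'_single]
  rcases a with a | a <;> rcases b with b | b <;>
    simp only [Matrix.J, Matrix.fromBlocks_apply₁₁, Matrix.fromBlocks_apply₁₂,
      Matrix.fromBlocks_apply₂₁, Matrix.fromBlocks_apply₂₂, Matrix.zero_apply, Matrix.neg_apply,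
      Matrix.one_apply, spSign, Sum.elim_inl, Sum.elim_inr, Sum.swap_inl, Sum.swap_inr,
      Sum.inl.injEq, Sum.inr.injEq, reduceCtorEq, if_false, eq_comm (a := a)] <;>
    split_ifs <;> simp

theorem symplecticForm_nondegenerate : (symplecticForm r k).Nondegenerate := by
  rw [symplecticForm, LinearMap.BilinForm.nondegenerate_toBilin'_iff_det_ne_zero]
  exact (Matrix.isUnit_det_J (Fin r) k).ne_zero

theorem symplecticForm_isAlt [CharZero k] : (symplecticForm r k).IsAlt := by
  have h : ∀ u v, symplecticForm r k u v + symplecticForm r k v u = 0 := by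
    have h1 : symplecticForm r k + (symplecticForm r k).flip = 0 := by
      refine (Pi.basisFun k (Fin r ⊕ Fin r)).ext fun a =>
        (Pi.basisFun k (Fin r ⊕ Fin r)).ext fun b => ?_
      change symplecticForm r k _ _ + symplecticForm r k _ _ = 0
      rw [isSymplecticBasis_basisFun, isSymplecticBasis_basisFun]
      by_cases hab : b = a.swap
      · rw [if_pos hab, if_pos (by rw [hab, Sum.swap_swap]), hab, spSign_swap]
        simp
      · rw [if_neg hab, if_neg (fun h => hab (by rw [h, Sum.swap_swap])), add_zero]
    intro u v
    exact congrFun (congrArg DFunLike.coe (congrFun (congrArg DFunLike.coe h1) u)) v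
  intro v
  have h1 := h v v
  rw [← two_mul] at h1
  exact (mul_eq_zero.1 h1).resolve_left two_ne_zero

theorem finrank_symplecticSpace : finrank k (Fin r ⊕ Fin r → k) = 2 * r := by
  rw [finrank_fintype_fun_eq_card, Fintype.card_sum, Fintype.card_fin, two_mul]

end Identification

theorem IsIsotropicFlag.half_le_orthogonal {k V : Type*} [Field k] [AddCommGroup V] [Module k V]
    {φ : LinearMap.BilinForm k V} {m : ℕ} {F : Fin (m + 1) → Submodule k V}
    (h : IsIsotropicFlag φ F) (hF : Monotone F) {s : Fin (m + 1)}
    (hs : (s : ℕ) = m / 2) :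
    F s ≤ φ.orthogonal (F s) := by
  rw [h]
  refine hF ?_
  rw [Fin.le_def, Fin.val_rev]
  omega

theorem theorem6p2 {k : Type*} [Field k] [IsAlgClosed k] [CharZero k]
    {L : Type*} [LieRing L] [LieAlgebra k L] [LieAlgebra.IsSimple k L]
    (q : LieSubalgebra k L) (hq : IsParabolicSubalgebra k q) (r : ℕ) :
    -- type `A_r`
    (∀ e : TypeAIso r k L,
      (∃ P : LieIdeal k (lieNilradical k q), IsCPIdeal k P) ∧
      (∃ (m : ℕ) (F : Fin (m + 1) → Submodule k (Fin (r + 1) → k)) (p : Fin m → ℕ),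
        IsFlagOfType F p ∧ IsFlagStabilizer e.act F q) ∧
      ∀ (m : ℕ) (F : Fin (m + 1) → Submodule k (Fin (r + 1) → k)) (p : Fin m → ℕ),
        IsFlagOfType F p → IsFlagStabilizer e.act F q →
        ∀ l : Fin (m + 1), IsClosestToHalf (r + 1) p l →
          (∃ P : LieIdeal k (lieNilradical k q), IsCPIdeal k P ∧
            ∀ x : lieNilradical k q,
              x ∈ P ↔ (∀ v, e.act x v ∈ F l) ∧ ∀ v ∈ F l, e.act x v = 0) ∧
          (lieIndex k (lieNilradical k q) : ℚ) =
            2 * (partialSum p l : ℚ) * (((r + 1 : ℕ) : ℚ) - (partialSum p l : ℚ))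
              - 1 / 2 * (((r + 1 : ℕ) : ℚ) ^ 2 - ∑ i, (p i : ℚ) ^ 2)) ∧
    -- type `C_r`
    (∀ e : TypeCIso r k L,
      (∃ P : LieIdeal k (lieNilradical k q), IsCPIdeal k P) ∧
      (∃ (m : ℕ) (F : Fin (m + 1) → Submodule k (Fin r ⊕ Fin r → k)) (p : Fin m → ℕ),
        IsFlagOfType F p ∧ IsIsotropicFlag (symplecticForm r k) F ∧
          IsFlagStabilizer e.act F q) ∧
      ∀ (m : ℕ) (F : Fin (m + 1) → Submodule k (Fin r ⊕ Fin r → k)) (p : Fin m → ℕ),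
        IsFlagOfType F p → IsIsotropicFlag (symplecticForm r k) F →
        IsFlagStabilizer e.act F q →
          (∀ W : Submodule k (Fin r ⊕ Fin r → k),
            (symplecticForm r k).orthogonal W = W → F ⟨m / 2, by omega⟩ ≤ W →
            ∃ P : LieIdeal k (lieNilradical k q), IsCPIdeal k P ∧
              ∀ x : lieNilradical k q,
                x ∈ P ↔ (∀ v, e.act x v ∈ W) ∧ ∀ v ∈ W, e.act x v = 0) ∧
          (lieIndex k (lieNilradical k q) : ℚ) =
            1 / 2 * ∑ i : Fin m with i.val < m / 2, (p i : ℚ) * ((p i : ℚ) + 1)) := by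
  constructor
  · intro e
    have := e.finiteDimensional
    have hn : finrank k (Fin (r + 1) → k) = r + 1 := by
      rw [finrank_fintype_fun_eq_card, Fintype.card_fin]
    have hflag := exists_flag_sl hn e.linearAct_injective e.linearAct_lie e.exists_linearAct_eq q hq
    have hmain := fun (m : ℕ) (F : Fin (m + 1) → Submodule k (Fin (r + 1) → k)) (p : Fin m → ℕ)
        (hF : IsFlagOfType F p) (hFq : IsFlagStabilizer e.act F q) (l : Fin (m + 1))
        (hl : IsClosestToHalf (r + 1) p l) =>
      cpIdeal_and_index_sl hn e.linearAct_injective e.linearAct_lie e.exists_linearAct_eq q hF hFq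
        l hl
    refine ⟨?_, hflag, hmain⟩
    obtain ⟨m, F, p, hF, hFq⟩ := hflag
    have hm : m ≠ 0 := by
      rintro rfl
      have h1 := hF.finrank_eq_partialSum (Fin.last 0)
      rw [hF.top, finrank_top, hn] at h1
      simp [partialSum] at h1
    obtain ⟨l, hl⟩ := exists_isClosestToHalf (r + 1) hm p
    obtain ⟨⟨P, hP, -⟩, -⟩ := hmain m F p hF hFq l hl
    exact ⟨P, hP⟩
  · intro e
    have := e.finiteDimensional
    have halt := symplecticForm_isAlt (r := r) (k := k)
    have hnd := symplecticForm_nondegenerate (r := r) (k := k)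
    have hn := finrank_symplecticSpace (r := r) (k := k)
    have hflag := exists_flag_sp halt hnd hn e.linearAct_injective e.linearAct_lie
      e.exists_linearAct_eq q hq
    have hmain := fun (m : ℕ) (F : Fin (m + 1) → Submodule k (Fin r ⊕ Fin r → k)) (p : Fin m → ℕ)
        (hF : IsFlagOfType F p) (hiso : IsIsotropicFlag (symplecticForm r k) F)
        (hFq : IsFlagStabilizer e.act F q) (W : Submodule k (Fin r ⊕ Fin r → k))
        (hW : (symplecticForm r k).orthogonal W = W) (hFW : F ⟨m / 2, by omega⟩ ≤ W) =>
      cpIdeal_and_index_sp halt hnd hn e.linearAct_injective e.linearAct_lie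
        e.exists_linearAct_eq q hF hiso hFq hW rfl hFW
    refine ⟨?_, hflag, fun m F p hF hiso hFq => ⟨fun W hW hFW =>
      (hmain m F p hF hiso hFq W hW hFW).1, ?_⟩⟩
    · obtain ⟨m, F, p, hF, hiso, hFq⟩ := hflag
      obtain ⟨W, hFW, hW⟩ := exists_lagrangian halt
        (hiso.half_le_orthogonal (s := ⟨m / 2, by omega⟩) hF.strictMono.monotone rfl)
      obtain ⟨⟨P, hP, -⟩, -⟩ := hmain m F p hF hiso hFq W hW hFW
      exact ⟨P, hP⟩
    -- The index formula does not involve `W`, but its proof passes through the ideal of some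
    -- Lagrangian subspace containing the isotropic half of the flag.
    · obtain ⟨W, hFW, hW⟩ := exists_lagrangian halt
        (hiso.half_le_orthogonal (s := ⟨m / 2, by omega⟩) hF.strictMono.monotone rfl)
      have h1 := (hmain m F p hF hiso hFq W hW hFW).2
      have h2 : 2 * (lieIndex k (lieNilradical k q) : ℚ) =
          ∑ i : Fin m with i.val < m / 2, (p i : ℚ) * ((p i : ℚ) + 1) := by
        exact_mod_cast h1
      rw [← h2]
      ring
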